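/- Let $\mathbb D$ be the open unit disc, $\mathcal H(\mathbb D)$ the analytic functions in $\mathbb D$ and $dA=\frac{dx\,dy}{\pi}$. A radial weight is $\mu(z)=\mu(|z|)$, where $\mu\in L^1([0,1))$ is a non-negative function with $\widehat\mu(r)=\int_r^1\mu(s)\,ds>0$ for all $r\in(0,1)$; put $\widehat\mu(z)=\widehat\mu(|z|)$ and $\mu_x=\int_0^1 s^x\mu(s)\,ds$. A radial weight $\omega$ belongs to $\widehat{\mathcal D}$ if there is $C>0$ with $\widehat\omega(r)\le C\,\widehat\omega\left(\frac{1+r}{2}\right)$ for $0\le r<1$, and to $\widecheck{\mathcal D}$ if there are $K>1$ and $C>1$ with $\widehat\omega(r)\ge C\,\widehat\omega\left(1-\frac{1-r}{K}\right)$ for $0\le r<1$; $\mathcal D=\widehat{\mathcal D}\cap\widecheck{\mathcal D}$. For $f(z)=\sum_{n\ge0}\widehat f(n)z^n\in\mathcal H(\mathbb D)$ let $D^\mu(f)(z)=\sum_{n\ge0}\frac{\widehat f(n)}{\mu_{2n+1}}z^n$. For $0<p<\infty$ let $n_p$ be the smallest $n\in\mathbb N$ with $np>1$, and define, with values in $[0,\infty]$,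 $$\|f\|_{B_p}^p=\sum_{j=0}^{n_p-1}|f^{(j)}(0)|^p+\int_{\mathbb D}|f^{(n_p)}(z)|^p(1-|z|^2)^{n_pp-2}\,dA(z),\qquad \|f\|_{B_{p,\mu}}^p=\int_{\mathbb D}|D^\mu(f)(z)|^p\frac{\widehat\mu(z)^p}{(1-|z|^2)^2}\,dA(z).$$ **Theorem.** Let $1\le p<\infty$ and let $\mu$ be a radial weight. The following are equivalent: (i) $\frac{\widehat\mu(z)^p}{(1-|z|)^2}$ is a radial weight in $\mathcal D$; (ii) $\|g\|_{B_{p,\mu}}\asymp\|g\|_{B_p}$ for $g\in\mathcal H(\mathbb D)$, that is, there are constants $C_1,C_2\in(0,\infty)$, independent of $g$, such that $\|g\|_{B_{p,\mu}}\le C_1\|g\|_{B_p}$ and $\|g\|_{B_p}\le C_2\|g\|_{B_{p,\mu}}$ for all $g\in\mathcal H(\mathbb D)$; (iii) $\|g\|_{B_{p,\mu}}\lesssim\|g\|_{B_p}$ for $g\in\mathcal H(\mathbb D)$, that is, there is a constant $C\in(0,\infty)$, independent of $g$, such that $\|g\|_{B_{p,\mu}}\le C\|g\|_{B_p}$ for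 all $g\in\mathcal H(\mathbb D)$. Moreover, if $0<p\le1$ and $\mu\in\widehat{\mathcal D}$, then (i), (ii) and (iii) are also equivalent. -/

import Mathlib

open MeasureTheory Set

namespace FracBesov

noncomputable section

/-- The tail integral `μ̂(r) = ∫_r^1 μ(s) ds`. -/
def tail (μ : ℝ → ℝ) (r : ℝ) : ℝ := ∫ s in Ico r 1, μ s

/-- `μ` (through its values on `[0,1)`) is a radial weight: a non-negative function in `L¹([0,1))`
with `μ̂(r) > 0` for all `r ∈ (0,1)`. On the unit disc it is read as `z ↦ μ ‖z‖`. -/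
structure IsRadialWeight (μ : ℝ → ℝ) : Prop where
  nonneg : ∀ r ∈ Ico (0 : ℝ) 1, 0 ≤ μ r
  integrableOn : IntegrableOn μ (Ico 0 1)
  tail_pos : ∀ r ∈ Ioo (0 : ℝ) 1, 0 < tail μ r

/-- The class `𝒟̂` of radial weights. -/
def MemDHat (μ : ℝ → ℝ) : Prop :=
  IsRadialWeight μ ∧
    ∃ C : ℝ, 0 < C ∧ ∀ r ∈ Ico (0 : ℝ) 1, tail μ r ≤ C * tail μ ((1 + r) / 2)

/-- The class `𝒟̌` of radial weights. -/
def MemDCheck (μ : ℝ → ℝ) : Prop :=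
  IsRadialWeight μ ∧
    ∃ K : ℝ, 1 < K ∧ ∃ C : ℝ, 1 < C ∧
      ∀ r ∈ Ico (0 : ℝ) 1, C * tail μ (1 - (1 - r) / K) ≤ tail μ r

/-- The class `𝒟 = 𝒟̂ ∩ 𝒟̌` of radial doubling weights. -/
def MemD (μ : ℝ → ℝ) : Prop := MemDHat μ ∧ MemDCheck μ

/-- The moments `μ_x = ∫_0^1 s^x μ(s) ds`. -/
def moment (μ : ℝ → ℝ) (x : ℝ) : ℝ := ∫ s in Ico (0 : ℝ) 1, s ^ x * μ s

/-- The open unit disc. -/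
def disc : Set ℂ := Metric.ball 0 1

/-- Analytic functions in the unit disc. -/
def IsAnalytic (f : ℂ → ℂ) : Prop := DifferentiableOn ℂ f disc

/-- Taylor coefficients at the origin. -/
def coeff (f : ℂ → ℂ) (n : ℕ) : ℂ := iteratedDeriv n f 0 / (n.factorial : ℂ)

/-- The fractional derivative `D^μ(f)(z) = ∑ f̂(n) / μ_{2n+1} zⁿ`. -/
def fracDeriv (μ : ℝ → ℝ) (f : ℂ → ℂ) (z : ℂ) : ℂ :=
  ∑' n : ℕ, coeff f n / ((moment μ (2 * (n : ℝ) + 1) : ℝ) : ℂ) * z ^ n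

/-- Normalized Lebesgue area measure on the unit disc. -/
def areaMeasure : Measure ℂ := ENNReal.ofReal (Real.pi⁻¹) • volume.restrict disc

/-- The smallest natural number `n` with `n p > 1`. -/
def besovOrder (p : ℝ) : ℕ := sInf {n : ℕ | 1 < (n : ℝ) * p}

/-- The quantity `‖f‖_{B_p} ∈ [0,∞]`; `f ∈ B_p` means that it is finite. -/
def besovNorm (p : ℝ) (f : ℂ → ℂ) : ENNReal :=
  ((∑ j ∈ Finset.range (besovOrder p), ‖iteratedDeriv j f 0‖ₑ ^ p) +
    ∫⁻ z, ‖iteratedDeriv (besovOrder p) f z‖ₑ ^ p *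
      ENNReal.ofReal ((1 - ‖z‖ ^ 2) ^ ((besovOrder p : ℝ) * p - 2)) ∂areaMeasure) ^ (1 / p)

/-- The quantity `‖f‖_{B_{p,μ}} ∈ [0,∞]`; `f ∈ B_{p,μ}` means that it is finite. -/
def fracBesovNorm (p : ℝ) (μ : ℝ → ℝ) (f : ℂ → ℂ) : ENNReal :=
  (∫⁻ z, ‖fracDeriv μ f z‖ₑ ^ p *
    ENNReal.ofReal (tail μ ‖z‖ ^ p / (1 - ‖z‖ ^ 2) ^ 2) ∂areaMeasure) ^ (1 / p)

/-- `‖g‖_{B_{p,μ}} ≲ ‖g‖_{B_p}` for all analytic `g`. -/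
def FracBesovLeBesov (p : ℝ) (μ : ℝ → ℝ) : Prop :=
  ∃ C : NNReal, 0 < C ∧ ∀ g : ℂ → ℂ, IsAnalytic g →
    fracBesovNorm p μ g ≤ (C : ENNReal) * besovNorm p g

/-- `‖g‖_{B_p} ≲ ‖g‖_{B_{p,μ}}` for all analytic `g`. -/
def BesovLeFracBesov (p : ℝ) (μ : ℝ → ℝ) : Prop :=
  ∃ C : NNReal, 0 < C ∧ ∀ g : ℂ → ℂ, IsAnalytic g →
    besovNorm p g ≤ (C : ENNReal) * fracBesovNorm p μ g

end

end FracBesov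

/-! Write H(t) = μ̂(1 - t), which is `tailFun μ`, and let Φ(t) be the tail integral over [1 - t, 1)
of the weight μ̂(r)^p / (1 - r)^2, which is `powWeight p μ`.

What (i) says about H is `exists_powerType_of_memD`: H is doubling and decays at least like t^γ for
some γ with γp > 1. The condition 𝒟̌ gives Φ(t) ≲ H(t)^p / t, and 𝒟̂ for Φ then makes H doubling.
Hence Φ(t) ≲ Φ(t) - Φ(t/2), so Φ decays like some t^ε. Since H^p ≲ tΦ, the p-th power of H has decay
exponent 1 + ε.

Sufficiency. The moments μ_{2n+1} are comparable to H(1/(n+1)), and differencing in n inserts a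
factor 1 - s^2 into the moment, which gains 1/(n+1). So the moments and their reciprocals are smooth
symbols, and the passage between f^{(k)} and D^μ f (up to k initial coefficients) is a coefficient
multiplier with smooth symbol, in both directions. Against the Bergman weight (1 - |w|^2)^b such a
multiplier is an integral operator with kernel K(z w̄). Summation by parts bounds |1 - ζ|^N |K(ζ)|,
and a Forelli-Rudin estimate completes the proof: through a Schur test if p ≥ 1, and, if p ≤ 1, by
moving the power p inside the integral by means of the pointwise growth of analytic functions. This
is `lintegral_multiplier_le`. The condition γp > 1 is what makes the radial integrals near the
boundary converge.

Necessity. Testing (iii) on z^n gives ∫ r^{np+1} μ̂(r)^p / (1 - r)^2 dr ≲ n μ_{2n+1}^p. If H is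
doubling, n of size 1/t yields Φ(t) ≲ H(t)^p / t, and this implies (i). If p ≥ 1, doubling need not
be assumed: Hölder's inequality bounds the moment of index 2j by the weighted integral just tested
at index 3j, so the moments decay slowly (`momentSeq_two_mul_le`), and iterating this forces H to be
doubling (`doubling_of_momentSeq`). For p < 1 this use of Hölder is not available, and μ ∈ 𝒟̂ takes
its place. -/

namespace FracBesov

/-! ### Functions of power type on (0,1] -/

/-- `A` is positive on `(0,1]` and behaves there like a power with exponent between `a` and `b`. -/
structure PowerType (A : ℝ → ℝ) (a b : ℝ) : Prop where
  measurable : Measurable A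
  pos : ∀ t, 0 < t → t ≤ 1 → 0 < A t
  bound : ∃ C, 0 < C ∧ ∀ x y, 0 < y → y ≤ x → x ≤ 1 →
    A x ≤ C * (x / y) ^ b * A y ∧ A y ≤ C * (y / x) ^ a * A x

theorem PowerType.rpow_id (a : ℝ) : PowerType (fun t => t ^ a) a a where
  measurable := by fun_prop
  pos t h _ := Real.rpow_pos_of_pos h a
  bound := by
    refine ⟨1, one_pos, fun x y hy hxy hx => ?_⟩
    have hx0 : 0 < x := hy.trans_le hxy
    have h1 := Real.rpow_pos_of_pos hx0 a
    have h2 := Real.rpow_pos_of_pos hy a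
    rw [Real.div_rpow hx0.le hy.le, Real.div_rpow hy.le hx0.le]
    constructor <;> apply le_of_eq <;> field_simp

theorem PowerType.mul {A B : ℝ → ℝ} {a b a' b' : ℝ} (hA : PowerType A a b)
    (hB : PowerType B a' b') : PowerType (fun t => A t * B t) (a + a') (b + b') where
  measurable := hA.measurable.mul hB.measurable
  pos t h h1 := mul_pos (hA.pos t h h1) (hB.pos t h h1)
  bound := by
    obtain ⟨C, hC, h1⟩ := hA.bound
    obtain ⟨D, hD, h2⟩ := hB.bound
    refine ⟨C * D, mul_pos hC hD, fun x y hy hxy hx => ?_⟩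
    have hx0 : 0 < x := hy.trans_le hxy
    obtain ⟨u1, u2⟩ := h1 x y hy hxy hx
    obtain ⟨v1, v2⟩ := h2 x y hy hxy hx
    rw [Real.rpow_add (div_pos hx0 hy), Real.rpow_add (div_pos hy hx0)]
    have ax := hA.pos x hx0 hx
    have ay := hA.pos y hy (hxy.trans hx)
    have bx := hB.pos x hx0 hx
    have bY := hB.pos y hy (hxy.trans hx)
    constructor
    · calc A x * B x ≤ (C * (x / y) ^ b * A y) * (D * (x / y) ^ b' * B y) := by gcongr
        _ = _ := by ring
    · calc A y * B y ≤ (C * (y / x) ^ a * A x) * (D * (y / x) ^ a' * B x) := by gcongr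
        _ = _ := by ring

theorem PowerType.inv {A : ℝ → ℝ} {a b : ℝ} (hA : PowerType A a b) :
    PowerType (fun t => (A t)⁻¹) (-b) (-a) where
  measurable := hA.measurable.inv
  pos t h h1 := inv_pos.2 (hA.pos t h h1)
  bound := by
    obtain ⟨C, hC, h1⟩ := hA.bound
    refine ⟨C, hC, fun x y hy hxy hx => ?_⟩
    have hx0 : 0 < x := hy.trans_le hxy
    obtain ⟨u1, u2⟩ := h1 x y hy hxy hx
    have ax := hA.pos x hx0 hx
    have ay := hA.pos y hy (hxy.trans hx)
    have e1 : (x / y) ^ (-a) = (y / x) ^ a := by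
      rw [Real.rpow_neg (by positivity), ← Real.inv_rpow (by positivity), inv_div]
    have e2 : (y / x) ^ (-b) = (x / y) ^ b := by
      rw [Real.rpow_neg (by positivity), ← Real.inv_rpow (by positivity), inv_div]
    rw [e1, e2]
    constructor
    · rw [inv_le_iff_one_le_mul₀ ax, mul_assoc, mul_comm (A y)⁻¹, ← mul_assoc, ← div_eq_mul_inv,
        le_div_iff₀ ay, one_mul]
      exact u2
    · rw [inv_le_iff_one_le_mul₀ ay, mul_assoc, mul_comm (A x)⁻¹, ← mul_assoc, ← div_eq_mul_inv,
        le_div_iff₀ ax, one_mul]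
      exact u1

theorem PowerType.rpow {A : ℝ → ℝ} {a b c : ℝ} (hA : PowerType A a b) (hc : 0 ≤ c) :
    PowerType (fun t => A t ^ c) (a * c) (b * c) where
  measurable := hA.measurable.pow_const c
  pos t h h1 := Real.rpow_pos_of_pos (hA.pos t h h1) c
  bound := by
    obtain ⟨C, hC, h1⟩ := hA.bound
    refine ⟨C ^ c, by positivity, fun x y hy hxy hx => ?_⟩
    have hx0 : 0 < x := hy.trans_le hxy
    obtain ⟨u1, u2⟩ := h1 x y hy hxy hx
    have ax := hA.pos x hx0 hx
    have ay := hA.pos y hy (hxy.trans hx)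
    rw [Real.rpow_mul (by positivity), Real.rpow_mul (by positivity),
      ← Real.mul_rpow (by positivity) (by positivity), ← Real.mul_rpow (by positivity) ay.le,
      ← Real.mul_rpow (by positivity) (by positivity), ← Real.mul_rpow (by positivity) ax.le]
    exact ⟨Real.rpow_le_rpow ax.le u1 hc, Real.rpow_le_rpow ay.le u2 hc⟩

theorem PowerType.congr {A B : ℝ → ℝ} {a b : ℝ} (hA : PowerType A a b) (hB : Measurable B)
    (h : ∀ t, 0 < t → t ≤ 1 → B t = A t) : PowerType B a b where
  measurable := hB
  pos t h1 h2 := by rw [h t h1 h2]; exact hA.pos t h1 h2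
  bound := by
    obtain ⟨C, hC, h1⟩ := hA.bound
    refine ⟨C, hC, fun x y hy hxy hx => ?_⟩
    rw [h x (hy.trans_le hxy) hx, h y hy (hxy.trans hx)]
    exact h1 x y hy hxy hx

/-- Values at comparable points are comparable. -/
theorem PowerType.le_of_le_two_mul {A : ℝ → ℝ} {a b : ℝ} (hA : PowerType A a b) :
    ∃ C, 0 < C ∧ ∀ x y, 0 < y → y ≤ x → x ≤ 2 * y → x ≤ 1 → A x ≤ C * A y := by
  obtain ⟨C, hC, h1⟩ := hA.bound
  refine ⟨C * 2 ^ |b|, by positivity, fun x y hy hxy hx2 hx => ?_⟩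
  have ay := hA.pos y hy (hxy.trans hx)
  refine (h1 x y hy hxy hx).1.trans ?_
  have : (x / y) ^ b ≤ 2 ^ |b| := by
    have h1 : 1 ≤ x / y := by rwa [le_div_iff₀ hy, one_mul]
    have h2 : x / y ≤ 2 := by rwa [div_le_iff₀ hy]
    calc (x / y) ^ b ≤ (x / y) ^ |b| := Real.rpow_le_rpow_of_exponent_le h1 (le_abs_self b)
      _ ≤ 2 ^ |b| := Real.rpow_le_rpow (by positivity) h2 (abs_nonneg b)
  gcongr

/-! ### Radial integrals of functions of power type -/

theorem lintegral_Ioc_div_rpow {e x : ℝ} (he : -1 < e) (hx : 0 < x) :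
    ∫⁻ y in Ioc 0 x, ENNReal.ofReal ((y / x) ^ e) = ENNReal.ofReal (x / (e + 1)) := by
  have hi : IntegrableOn (fun y : ℝ => y ^ e) (Ioc 0 x) := by
    rw [← intervalIntegrable_iff_integrableOn_Ioc_of_le hx.le]
    exact intervalIntegral.intervalIntegrable_rpow' he
  have hi' : IntegrableOn (fun y : ℝ => (y / x) ^ e) (Ioc 0 x) := by
    refine IntegrableOn.congr_fun (f := fun y : ℝ => y ^ e / x ^ e) (hi.div_const (x ^ e)) (fun y hy => ?_) measurableSet_Ioc
    exact (Real.div_rpow hy.1.le hx.le e).symm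
  rw [← ofReal_integral_eq_lintegral_ofReal hi' ?_]
  · congr 1
    rw [setIntegral_congr_fun measurableSet_Ioc
      (fun y hy => Real.div_rpow (le_of_lt hy.1) hx.le e), integral_div,
      ← intervalIntegral.integral_of_le hx.le, integral_rpow (Or.inl he),
      Real.zero_rpow (by linarith), Real.rpow_add hx, Real.rpow_one]
    have := Real.rpow_pos_of_pos hx e
    field_simp
    ring
  · filter_upwards [ae_restrict_mem measurableSet_Ioc] with y hy
    exact Real.rpow_nonneg (div_nonneg hy.1.le hx.le) e

theorem lintegral_Ioi_div_rpow {h x : ℝ} (hh : h < -1) (hx : 0 < x) :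
    ∫⁻ y in Ioi x, ENNReal.ofReal ((y / x) ^ h) = ENNReal.ofReal (x / (-h - 1)) := by
  have hi : IntegrableOn (fun y : ℝ => y ^ h) (Ioi x) := integrableOn_Ioi_rpow_of_lt hh hx
  have hi' : IntegrableOn (fun y : ℝ => (y / x) ^ h) (Ioi x) := by
    refine IntegrableOn.congr_fun (f := fun y : ℝ => y ^ h / x ^ h) (hi.div_const (x ^ h)) (fun y hy => ?_) measurableSet_Ioi
    exact (Real.div_rpow (hx.trans hy).le hx.le h).symm
  rw [← ofReal_integral_eq_lintegral_ofReal hi' ?_]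
  · congr 1
    rw [setIntegral_congr_fun measurableSet_Ioi
      (fun y hy => Real.div_rpow (le_of_lt (hx.trans hy)) hx.le h), integral_div,
      integral_Ioi_rpow_of_lt hh hx, Real.rpow_add hx, Real.rpow_one]
    have := Real.rpow_pos_of_pos hx h
    have h1 : h + 1 ≠ 0 := by linarith
    have h2 : -h - 1 ≠ 0 := by linarith
    field_simp
    ring
  · filter_upwards [ae_restrict_mem measurableSet_Ioi] with y hy
    exact Real.rpow_nonneg (div_nonneg (hx.trans hy).le hx.le) h

/-- The argument x + y - xy lies between max(x, y) and twice it. For y ≤ x, Q is frozen at x and E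
contributes (y/x)^e, integrable at 0 because e > -1. For y > x, Q may be evaluated at y and the
product EQ contributes (y/x)^h, integrable at infinity because h < -1. -/
theorem lintegral_powerType_le {E Q : ℝ → ℝ} {e e' q q' h h' : ℝ} (hE : PowerType E e e')
    (hQ : PowerType Q q q') (hEQ : PowerType (fun t => E t * Q t) h' h) (he : -1 < e)
    (hh : h < -1) :
    ∃ C, 0 < C ∧ ∀ x, 0 < x → x ≤ 1 →
      ∫⁻ y in Ioo 0 1, ENNReal.ofReal (E y * Q (x + y - x * y)) ≤
        ENNReal.ofReal (C * (x * (E x * Q x))) := by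
  obtain ⟨C₁, hC₁, h₁⟩ := hE.bound
  obtain ⟨C₂, hC₂, h₂⟩ := hQ.le_of_le_two_mul
  obtain ⟨C₃, hC₃, h₃⟩ := hEQ.bound
  have he1 : 0 < e + 1 := by linarith
  have hh1 : 0 < -h - 1 := by linarith
  refine ⟨C₁ * C₂ / (e + 1) + C₂ * C₃ / (-h - 1), by positivity, fun x hx hx1 => ?_⟩
  have hEx := hE.pos x hx hx1
  have hQx := hQ.pos x hx hx1
  have key : ∀ y ∈ Ioo (0 : ℝ) 1, ENNReal.ofReal (E y * Q (x + y - x * y)) ≤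
      (Ioc 0 x).indicator (fun y => ENNReal.ofReal (C₁ * C₂ * (E x * Q x)) *
        ENNReal.ofReal ((y / x) ^ e)) y +
      (Ioi x).indicator (fun y => ENNReal.ofReal (C₂ * C₃ * (E x * Q x)) *
        ENNReal.ofReal ((y / x) ^ h)) y := by
    rintro y ⟨hy, hy1⟩
    have hEy := hE.pos y hy hy1.le
    have hτ1 : x + y - x * y ≤ 1 := by nlinarith
    have hxτ : x ≤ x + y - x * y := by nlinarith
    have hyτ : y ≤ x + y - x * y := by nlinarith
    rcases le_or_gt y x with hyx | hyx
    · rw [indicator_of_mem (show y ∈ Ioc 0 x from ⟨hy, hyx⟩),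
        indicator_of_notMem (show y ∉ Ioi x from not_lt.2 hyx), add_zero,
        ← ENNReal.ofReal_mul (by positivity)]
      apply ENNReal.ofReal_le_ofReal
      have a1 := (h₁ x y hy hyx hx1).2
      have a2 := h₂ (x + y - x * y) x hx hxτ (by nlinarith) hτ1
      calc E y * Q (x + y - x * y) ≤ (C₁ * (y / x) ^ e * E x) * (C₂ * Q x) := by
            apply mul_le_mul a1 a2 (hQ.pos _ (by linarith) hτ1).le
            positivity
        _ = _ := by ring
    · rw [indicator_of_mem (show y ∈ Ioi x from hyx),
        indicator_of_notMem (show y ∉ Ioc 0 x from fun h => not_lt.2 h.2 hyx), zero_add,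
        ← ENNReal.ofReal_mul (by positivity)]
      apply ENNReal.ofReal_le_ofReal
      have a1 := (h₃ y x hx hyx.le hy1.le).1
      have a2 := h₂ (x + y - x * y) y hy hyτ (by nlinarith) hτ1
      calc E y * Q (x + y - x * y) ≤ E y * (C₂ * Q y) := by gcongr
        _ = C₂ * (E y * Q y) := by ring
        _ ≤ C₂ * (C₃ * (y / x) ^ h * (E x * Q x)) := by gcongr
        _ = _ := by ring
  have m1 : Measurable fun y : ℝ => ENNReal.ofReal ((y / x) ^ e) := by fun_prop
  have m2 : Measurable fun y : ℝ => ENNReal.ofReal ((y / x) ^ h) := by fun_prop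
  calc ∫⁻ y in Ioo 0 1, ENNReal.ofReal (E y * Q (x + y - x * y))
      ≤ ∫⁻ y in Ioo 0 1, _ := setLIntegral_mono' measurableSet_Ioo key
    _ ≤ ∫⁻ y, _ := setLIntegral_le_lintegral _ _
    _ = ENNReal.ofReal (C₁ * C₂ * (E x * Q x)) * ENNReal.ofReal (x / (e + 1)) +
        ENNReal.ofReal (C₂ * C₃ * (E x * Q x)) * ENNReal.ofReal (x / (-h - 1)) := by
      rw [lintegral_add_left ((m1.const_mul _).indicator measurableSet_Ioc),
        lintegral_indicator measurableSet_Ioc, lintegral_indicator measurableSet_Ioi,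
        lintegral_const_mul _ m1, lintegral_const_mul _ m2, lintegral_Ioc_div_rpow he hx,
        lintegral_Ioi_div_rpow hh hx]
    _ = _ := by
      rw [← ENNReal.ofReal_mul (by positivity), ← ENNReal.ofReal_mul (by positivity),
        ← ENNReal.ofReal_add (by positivity) (by positivity)]
      congr 1
      ring

/-! ### Polar coordinates, circle averages and a Forelli-Rudin estimate -/

theorem polarCoord_symm_eq_circleMap (p : ℝ × ℝ) :
    Complex.polarCoord.symm p = circleMap 0 p.1 p.2 := by
  rw [Complex.polarCoord_symm_apply, circleMap, zero_add, Complex.exp_mul_I,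
    Complex.ofReal_cos, Complex.ofReal_sin]

theorem lintegral_ball_polar {f : ℂ → ENNReal} (hf : Measurable f) (c : ℂ) (R : ℝ) :
    ∫⁻ z in Metric.ball c R, f z =
      ∫⁻ r in Ioo 0 R, ENNReal.ofReal r *
        ∫⁻ θ in Ioo (-Real.pi) Real.pi, f (circleMap c r θ) := by
  have hm : Measurable ((Metric.ball c R).indicator f) := hf.indicator Metric.isOpen_ball.measurableSet
  rw [← lintegral_indicator Metric.isOpen_ball.measurableSet,
    ← lintegral_add_left_eq_self _ c, ← Complex.lintegral_comp_polarCoord_symm,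
    show polarCoord.target = Ioi (0 : ℝ) ×ˢ Ioo (-Real.pi) Real.pi from rfl,
    Measure.volume_eq_prod, ← Measure.prod_restrict]
  have hmc : Measurable fun p : ℝ × ℝ => c + circleMap 0 p.1 p.2 := by
    unfold circleMap; fun_prop
  have hm1 : Measurable fun p : ℝ × ℝ => ENNReal.ofReal p.1 •
      (Metric.ball c R).indicator f (c + Complex.polarCoord.symm p) := by
    simp_rw [polarCoord_symm_eq_circleMap]
    exact (ENNReal.measurable_ofReal.comp measurable_fst).smul (hm.comp hmc)
  rw [lintegral_prod _ hm1.aemeasurable]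
  have : Ioo (0 : ℝ) R = Ioi 0 ∩ Iio R := rfl
  rw [this, ← lintegral_indicator (measurableSet_Ioi.inter measurableSet_Iio),
    ← lintegral_indicator measurableSet_Ioi]
  congr 1 with r
  by_cases hr : r ∈ Ioi (0 : ℝ)
  · rw [indicator_of_mem hr]
    have hm2 : Measurable fun θ : ℝ =>
        (Metric.ball c R).indicator f (c + Complex.polarCoord.symm (r, θ)) := by
      simp_rw [polarCoord_symm_eq_circleMap]
      exact hm.comp (hmc.comp (measurable_const.prodMk measurable_id))
    simp only [smul_eq_mul]
    rw [lintegral_const_mul _ hm2]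
    have hr' : (0 : ℝ) < r := hr
    by_cases hR : r < R
    · rw [indicator_of_mem (show r ∈ Ioi (0 : ℝ) ∩ Iio R from ⟨hr, hR⟩)]
      congr 2 with θ
      rw [polarCoord_symm_eq_circleMap]
      rw [indicator_of_mem]
      · simp [circleMap]
      · simp [circleMap, abs_of_pos hr', hR]
    · rw [indicator_of_notMem (fun h => hR h.2)]
      convert mul_zero _
      refine (lintegral_congr fun θ => ?_).trans lintegral_zero
      rw [polarCoord_symm_eq_circleMap, indicator_of_notMem]
      simp [circleMap, abs_of_pos hr']
      linarith
  · rw [indicator_of_notMem hr, indicator_of_notMem (fun h => hr h.1)]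

theorem lintegral_areaMeasure (f : ℂ → ENNReal) :
    ∫⁻ z, f z ∂areaMeasure = ENNReal.ofReal Real.pi⁻¹ * ∫⁻ z in disc, f z := by
  rw [areaMeasure, lintegral_smul_measure, smul_eq_mul]

theorem circleAverage_eq_setIntegral {E : Type*} [NormedAddCommGroup E] [NormedSpace ℝ E]
    (f : ℂ → E) (c : ℂ) (r : ℝ) :
    Real.circleAverage f c r =
      (2 * Real.pi)⁻¹ • ∫ θ in Ioo (-Real.pi) Real.pi, f (circleMap c r θ) := by
  rw [Real.circleAverage_eq_integral_add (-Real.pi),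
    intervalIntegral.integral_comp_add_right (fun θ => f (circleMap c r θ)),
    intervalIntegral.integral_of_le (by linarith [Real.pi_pos]), integral_Ioc_eq_integral_Ioo]
  congr 3
  ring_nf

theorem lintegral_circle_eq_circleAverage {f : ℂ → ℝ} {c : ℂ} {r : ℝ}
    (hf : ContinuousOn f (Metric.sphere c |r|)) (h0 : ∀ z ∈ Metric.sphere c |r|, 0 ≤ f z) :
    ∫⁻ θ in Ioo (-Real.pi) Real.pi, ENNReal.ofReal (f (circleMap c r θ)) =
      ENNReal.ofReal (2 * Real.pi * Real.circleAverage f c r) := by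
  have hc : Continuous fun θ => f (circleMap c r θ) :=
    hf.comp_continuous (continuous_circleMap c r) fun θ => circleMap_mem_sphere' c r θ
  rw [circleAverage_eq_setIntegral, smul_eq_mul, mul_inv_cancel_left₀ (by positivity),
    ofReal_integral_eq_lintegral_ofReal]
  · exact (hc.integrableOn_Icc (a := -Real.pi) (b := Real.pi)).mono_set Ioo_subset_Icc_self
  · exact Filter.Eventually.of_forall fun θ => h0 _ (circleMap_mem_sphere' c r θ)

/-- With ζ = za, the real part of (1 + ζ)/(1 - ζ) is (1 - |ζ|^2)/|1 - ζ|^2, and its average over the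
circle is its value 1 at the centre. -/
theorem circleAverage_inv_normSq {a : ℂ} {r : ℝ} (hr : 0 ≤ r) (ha : r * ‖a‖ < 1) :
    Real.circleAverage (fun z => 1 / ‖1 - z * a‖ ^ 2) 0 r = 1 / (1 - (r * ‖a‖) ^ 2) := by
  have hnorm : ∀ z ∈ Metric.closedBall (0 : ℂ) |r|, ‖z * a‖ ≤ r * ‖a‖ := by
    intro z hz
    rw [mem_closedBall_zero_iff, abs_of_nonneg hr] at hz
    rw [norm_mul]
    gcongr
  have hne : ∀ z ∈ Metric.closedBall (0 : ℂ) |r|, 1 - z * a ≠ 0 := by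
    intro z hz h
    have := hnorm z hz
    rw [← sub_eq_zero.1 h, norm_one] at this
    linarith
  have hd : DiffContOnCl ℂ (fun z => (1 + z * a) / (1 - z * a)) (Metric.ball 0 |r|) := by
    have : DifferentiableOn ℂ (fun z => (1 + z * a) / (1 - z * a)) (Metric.closedBall 0 |r|) := by
      refine DifferentiableOn.div (by fun_prop) (by fun_prop) hne
    rcases eq_or_ne r 0 with rfl | hr0
    · rw [abs_zero, Metric.ball_zero]
      exact ⟨differentiableOn_empty, by simp⟩
    · rw [← closure_ball _ (abs_ne_zero.2 hr0)] at this
      exact this.diffContOnCl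
  have h1 := hd.circleAverage
  simp only [zero_mul, add_zero, sub_zero, div_one] at h1
  have hci : CircleIntegrable (fun z => (1 + z * a) / (1 - z * a)) 0 r := by
    refine ContinuousOn.circleIntegrable' ?_
    refine ContinuousOn.div (by fun_prop) (by fun_prop) fun z hz => hne z ?_
    exact Metric.sphere_subset_closedBall hz
  have h2 := Complex.reCLM.circleAverage_comp_comm hci
  rw [h1] at h2
  have h3 : Real.circleAverage (Complex.reCLM ∘ fun z => (1 + z * a) / (1 - z * a)) 0 r =
      (1 - (r * ‖a‖) ^ 2) * Real.circleAverage (fun z => 1 / ‖1 - z * a‖ ^ 2) 0 r := by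
    rw [← smul_eq_mul, ← Real.circleAverage_fun_smul]
    refine Real.circleAverage_congr_sphere fun z hz => ?_
    have hz' : ‖z‖ = r := by simpa [abs_of_nonneg hr] using hz
    have hz2 := hne z (Metric.sphere_subset_closedBall hz)
    have hn : Complex.normSq (1 - z * a) ≠ 0 := by simpa using hz2
    simp only [Function.comp, Complex.reCLM_apply, smul_eq_mul]
    rw [← hz', ← norm_mul, ← Complex.normSq_eq_norm_sq, ← Complex.normSq_eq_norm_sq,
      Complex.div_re, mul_one_div, ← add_div]
    congr 1
    simp only [Complex.normSq_apply, Complex.sub_re, Complex.sub_im, Complex.add_re,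
      Complex.add_im, Complex.one_re, Complex.one_im]
    ring
  have h4 : 0 < 1 - (r * ‖a‖) ^ 2 := by
    have : 0 ≤ r * ‖a‖ := by positivity
    nlinarith
  rw [h3] at h2
  simp only [Complex.reCLM_apply, Complex.one_re] at h2
  rw [eq_div_iff h4.ne', mul_comm]
  exact h2

/-- Only the second power of |1 - z w̄| occurs, so the angular integral is explicit: it cancels the
factor 1 - |z||w| up to 1 + |z||w|. With x = 1 - |w| and y = 1 - r one has 1 - r|w| = x + y - xy,
and the radial integral is the one of `lintegral_powerType_le`. Kernels with higher powers of |1 - z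
w̄| are brought to this form by trading the surplus for powers of 1 - |z||w|. -/
theorem forelli_rudin {E Q : ℝ → ℝ} {e e' q q' h h' : ℝ} (hE : PowerType E e e')
    (hQ : PowerType Q q q') (hEQ : PowerType (fun t => E t * Q t) h' h) (he : -1 < e)
    (hh : h < -1) :
    ∃ C, 0 < C ∧ ∀ w ∈ disc,
      ∫⁻ z, ENNReal.ofReal (E (1 - ‖z‖) * ((1 - ‖z‖ * ‖w‖) * Q (1 - ‖z‖ * ‖w‖) *
          (1 / ‖1 - z * starRingEnd ℂ w‖ ^ 2))) ∂areaMeasure ≤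
        ENNReal.ofReal (C * ((1 - ‖w‖) * (E (1 - ‖w‖) * Q (1 - ‖w‖)))) := by
  obtain ⟨C, hC, hb⟩ := lintegral_powerType_le hE hQ hEQ he hh
  refine ⟨2 * C, by positivity, fun w hw => ?_⟩
  have hw1 : ‖w‖ < 1 := by simpa [disc] using hw
  have hw0 := norm_nonneg w
  have hm : Measurable fun z : ℂ => ENNReal.ofReal (E (1 - ‖z‖) * ((1 - ‖z‖ * ‖w‖) *
      Q (1 - ‖z‖ * ‖w‖) * (1 / ‖1 - z * starRingEnd ℂ w‖ ^ 2))) := by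
    have h1 := hE.measurable
    have h2 := hQ.measurable
    fun_prop
  rw [lintegral_areaMeasure, disc, lintegral_ball_polar hm]
  have key : ∀ r ∈ Ioo (0 : ℝ) 1, ENNReal.ofReal r * ∫⁻ θ in Ioo (-Real.pi) Real.pi,
      ENNReal.ofReal (E (1 - ‖circleMap 0 r θ‖) * ((1 - ‖circleMap 0 r θ‖ * ‖w‖) *
      Q (1 - ‖circleMap 0 r θ‖ * ‖w‖) * (1 / ‖1 - circleMap 0 r θ * starRingEnd ℂ w‖ ^ 2))) ≤
      ENNReal.ofReal (2 * Real.pi) * ENNReal.ofReal (E (1 - r) * Q (1 - r * ‖w‖)) := by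
    rintro r ⟨hr0, hr1⟩
    have hrw : r * ‖w‖ < 1 := by nlinarith
    have hrw0 : 0 ≤ r * ‖w‖ := by positivity
    have e1 : ∀ θ : ℝ, ‖circleMap 0 r θ‖ = r := fun θ => by simp [abs_of_pos hr0]
    simp_rw [e1]
    have pE := hE.pos (1 - r) (by linarith) (by linarith)
    have pQ := hQ.pos (1 - r * ‖w‖) (by linarith) (by linarith)
    have hcE : 0 ≤ E (1 - r) * ((1 - r * ‖w‖) * Q (1 - r * ‖w‖)) :=
      mul_nonneg pE.le (mul_nonneg (by linarith) pQ.le)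
    have e2 : ∀ θ : ℝ, E (1 - r) * ((1 - r * ‖w‖) * Q (1 - r * ‖w‖) *
        (1 / ‖1 - circleMap 0 r θ * starRingEnd ℂ w‖ ^ 2)) =
        E (1 - r) * ((1 - r * ‖w‖) * Q (1 - r * ‖w‖)) *
        (1 / ‖1 - circleMap 0 r θ * starRingEnd ℂ w‖ ^ 2) := fun θ => by ring
    simp_rw [e2, ENNReal.ofReal_mul hcE]
    rw [lintegral_const_mul _ (by unfold circleMap; fun_prop),
      lintegral_circle_eq_circleAverage
        (f := fun z => 1 / ‖1 - z * starRingEnd ℂ w‖ ^ 2) ?_ fun z _ => by positivity,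
      circleAverage_inv_normSq hr0.le (by simpa using hrw)]
    · rw [← ENNReal.ofReal_mul hcE, ← ENNReal.ofReal_mul hr0.le,
        ← ENNReal.ofReal_mul (by positivity)]
      apply ENNReal.ofReal_le_ofReal
      rw [RCLike.norm_conj]
      have : 1 - (r * ‖w‖) ^ 2 = (1 - r * ‖w‖) * (1 + r * ‖w‖) := by ring
      have hp : 0 < 1 - r * ‖w‖ := by linarith
      have hp2 : 0 < 1 + r * ‖w‖ := by linarith
      rw [this]
      have : r * (E (1 - r) * ((1 - r * ‖w‖) * Q (1 - r * ‖w‖)) *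
          (2 * Real.pi * (1 / ((1 - r * ‖w‖) * (1 + r * ‖w‖))))) =
          2 * Real.pi * (E (1 - r) * Q (1 - r * ‖w‖)) * (r / (1 + r * ‖w‖)) := by
        field_simp
      rw [this]
      refine mul_le_of_le_one_right (by positivity) ?_
      rw [div_le_one hp2]
      linarith
    · refine ContinuousOn.div (by fun_prop) (by fun_prop) fun z hz h => ?_
      have hz' : ‖z‖ = r := by simpa [abs_of_pos hr0] using hz
      have h1 : 1 - z * starRingEnd ℂ w = 0 := by simpa using h
      have h2 : ‖z * starRingEnd ℂ w‖ = 1 := by rw [← sub_eq_zero.1 h1, norm_one]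
      rw [norm_mul, RCLike.norm_conj, hz'] at h2
      linarith
  refine (mul_le_mul_right (setLIntegral_mono' measurableSet_Ioo key) _).trans ?_
  have hm2 : Measurable fun r : ℝ => ENNReal.ofReal (E (1 - r) * Q (1 - r * ‖w‖)) := by
    have h1 := hE.measurable
    have h2 := hQ.measurable
    fun_prop
  rw [lintegral_const_mul _ hm2, ← mul_assoc, ← ENNReal.ofReal_mul (by positivity),
    show Real.pi⁻¹ * (2 * Real.pi) = 2 by field_simp]
  have hsub : ∫⁻ r in Ioo 0 1, ENNReal.ofReal (E (1 - r) * Q (1 - r * ‖w‖)) =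
      ∫⁻ y in Ioo 0 1, ENNReal.ofReal (E y * Q ((1 - ‖w‖) + y - (1 - ‖w‖) * y)) := by
    rw [← lintegral_indicator measurableSet_Ioo, ← lintegral_indicator measurableSet_Ioo,
      ← lintegral_sub_left_eq_self _ 1]
    congr 1 with y
    by_cases hy : y ∈ Ioo (0 : ℝ) 1
    · rw [indicator_of_mem hy, indicator_of_mem (by constructor <;> linarith [hy.1, hy.2])]
      congr 3 <;> ring
    · rw [indicator_of_notMem hy, indicator_of_notMem]
      exact fun h => hy (by constructor <;> linarith [h.1, h.2])
  rw [hsub]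
  refine (mul_le_mul_right (hb (1 - ‖w‖) (by linarith) (by linarith)) _).trans ?_
  rw [← ENNReal.ofReal_mul (by positivity), mul_assoc]

/-! ### Subharmonicity of |f|^p and pointwise growth -/

/-- In Jensen's formula each zero in the closed disc contributes a non-negative term. -/
theorem log_norm_le_circleAverage {f : ℂ → ℂ} {c : ℂ} {R : ℝ} (hR : 0 < R)
    (hf : AnalyticOnNhd ℂ f (Metric.closedBall c R)) (h0 : f c ≠ 0) :
    Real.log ‖f c‖ ≤ Real.circleAverage (fun z => Real.log ‖f z‖) c R := by
  have hf' : AnalyticOnNhd ℂ f (Metric.closedBall c |R|) := by rwa [abs_of_pos hR]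
  rw [hf'.circleAverage_log_norm hR.ne' h0]
  refine le_add_of_nonneg_left (finsum_nonneg fun u => ?_)
  by_cases hu : u ∈ Metric.closedBall c |R|
  · refine mul_nonneg (mod_cast MeromorphicOn.AnalyticOnNhd.divisor_nonneg hf' u) ?_
    rcases eq_or_ne (c - u) 0 with h | h
    · simp [h]
    · refine Real.log_nonneg ?_
      have h1 : 0 < ‖c - u‖ := norm_pos_iff.2 h
      rw [← div_eq_mul_inv, le_div_iff₀ h1, one_mul]
      simpa [dist_eq_norm', abs_of_pos hR] using hu
  · simp [hu]

/-- The function |f|^p = exp(p log|f|) lies above its tangent at l = log|f(c)|, that is, above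
e^{pl}(1 + p(log|f| - l)). Averaging this and using `log_norm_le_circleAverage` gives the claim for
every p > 0. -/
theorem norm_rpow_le_circleAverage {f : ℂ → ℂ} {c : ℂ} {R p : ℝ} (hR : 0 < R) (hp : 0 < p)
    (hf : AnalyticOnNhd ℂ f (Metric.closedBall c R)) :
    ‖f c‖ ^ p ≤ Real.circleAverage (fun z => ‖f z‖ ^ p) c R := by
  have hs : Metric.sphere c |R| ⊆ Metric.closedBall c R := by
    rw [abs_of_pos hR]; exact Metric.sphere_subset_closedBall
  have hci : CircleIntegrable (fun z => ‖f z‖ ^ p) c R := by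
    refine ContinuousOn.circleIntegrable' ?_
    exact ((hf.continuousOn.mono hs).norm).rpow_const fun _ _ => Or.inr hp.le
  by_cases h0 : f c = 0
  · rw [h0, norm_zero, Real.zero_rpow hp.ne']
    exact Real.circleAverage_nonneg_of_nonneg fun z _ => Real.rpow_nonneg (norm_nonneg _) p
  set l := Real.log ‖f c‖ with hl
  have hlog := log_norm_le_circleAverage hR hf h0
  have hcl : CircleIntegrable (fun z => Real.log ‖f z‖) c R :=
    (hf.mono hs).meromorphicOn.circleIntegrable_log_norm
  -- At a zero of f the convention log 0 = 0 would break the tangent inequality. The value l - 1/p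
  -- makes the tangent line vanish there, and the change affects only a negligible set of the
  -- circle.
  set g : ℂ → ℝ := fun z => if f z = 0 then l - 1 / p else Real.log ‖f z‖ with hg
  have hcod : (fun z => Real.log ‖f z‖) =ᶠ[Filter.codiscreteWithin (Metric.sphere c |R|)] g := by
    have h1 : f ⁻¹' {0}ᶜ ∈ Filter.codiscreteWithin (Metric.closedBall c R) :=
      hf.preimage_zero_mem_codiscreteWithin h0 (Metric.mem_closedBall_self hR.le)
        ((convex_closedBall c R).isConnected ⟨c, Metric.mem_closedBall_self hR.le⟩)
    filter_upwards [Filter.codiscreteWithin_mono hs h1] with z hz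
    have : f z ≠ 0 := hz
    simp [hg, this]
  rw [Real.circleAverage_congr_codiscreteWithin hcod hR.ne'] at hlog
  have hcg : CircleIntegrable g c R := hcl.congr_codiscreteWithin hcod
  have hfc : ‖f c‖ ^ p = Real.exp (p * l) := by
    rw [hl, Real.rpow_def_of_pos (norm_pos_iff.2 h0), mul_comm]
  have hpt : ∀ z ∈ Metric.sphere c |R|,
      Real.exp (p * l) * p * g z + Real.exp (p * l) * (1 - p * l) ≤ ‖f z‖ ^ p := by
    intro z _
    by_cases hz : f z = 0
    · simp only [hg, hz, if_true, norm_zero, Real.zero_rpow hp.ne']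
      apply le_of_eq
      field_simp
      ring
    · simp only [hg, hz, if_false]
      rw [Real.rpow_def_of_pos (norm_pos_iff.2 hz)]
      have := Real.add_one_le_exp (p * (Real.log ‖f z‖ - l))
      calc _ = Real.exp (p * l) * (p * (Real.log ‖f z‖ - l) + 1) := by ring
        _ ≤ Real.exp (p * l) * Real.exp (p * (Real.log ‖f z‖ - l)) := by gcongr
        _ = _ := by rw [← Real.exp_add]; ring_nf
  have hcc : CircleIntegrable (fun _ : ℂ => Real.exp (p * l) * (1 - p * l)) c R :=
    circleIntegrable_const _ _ _
  have hcm : CircleIntegrable (fun z => Real.exp (p * l) * p * g z) c R := hcg.const_mul _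
  have h1 := Real.circleAverage_mono (hcm.add hcc) hci hpt
  have h2 : Real.circleAverage ((fun z => Real.exp (p * l) * p * g z) +
      fun _ : ℂ => Real.exp (p * l) * (1 - p * l)) c R =
      Real.exp (p * l) * p * Real.circleAverage g c R + Real.exp (p * l) * (1 - p * l) := by
    rw [Real.circleAverage_add hcm hcc, Real.circleAverage_const]
    congr 1
    exact Real.circleAverage_fun_smul (a := Real.exp (p * l) * p) (f := g)
  rw [hfc]
  refine le_trans ?_ (h2 ▸ h1)
  have : 0 < Real.exp (p * l) * p := by positivity
  nlinarith

theorem norm_rpow_mul_sq_le_lintegral {f : ℂ → ℂ} {c : ℂ} {R p : ℝ} (hR : 0 < R) (hp : 0 < p)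
    (hf : DifferentiableOn ℂ f (Metric.ball c R)) :
    ENNReal.ofReal (Real.pi * (‖f c‖ ^ p * R ^ 2)) ≤
      ∫⁻ z in Metric.ball c R, ENNReal.ofReal (‖f z‖ ^ p) := by
  classical
  have hcont : ContinuousOn (fun z => ‖f z‖ ^ p) (Metric.ball c R) :=
    hf.continuousOn.norm.rpow_const fun _ _ => Or.inr hp.le
  -- Nothing is known about f outside the ball, so it is cut off by zero to obtain a Borel function
  -- for polar coordinates.
  have hm : Measurable ((Metric.ball c R).piecewise (fun z => ‖f z‖ ^ p) 0) :=
    hcont.measurable_piecewise continuousOn_const Metric.isOpen_ball.measurableSet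
  have han : AnalyticOnNhd ℂ f (Metric.ball c R) := hf.analyticOnNhd Metric.isOpen_ball
  have h1 : ∫⁻ z in Metric.ball c R, ENNReal.ofReal (‖f z‖ ^ p) = ∫⁻ z in Metric.ball c R,
      ENNReal.ofReal ((Metric.ball c R).piecewise (fun z => ‖f z‖ ^ p) 0 z) := by
    refine setLIntegral_congr_fun Metric.isOpen_ball.measurableSet fun z hz => ?_
    simp only [piecewise_eq_of_mem _ _ _ hz]
  rw [h1, lintegral_ball_polar hm.ennreal_ofReal]
  have key : ∀ r ∈ Ioo (0 : ℝ) R, ENNReal.ofReal (2 * Real.pi * ‖f c‖ ^ p) * ENNReal.ofReal r ≤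
      ENNReal.ofReal r * ∫⁻ θ in Ioo (-Real.pi) Real.pi, ENNReal.ofReal
        ((Metric.ball c R).piecewise (fun z => ‖f z‖ ^ p) 0 (circleMap c r θ)) := by
    rintro r ⟨hr0, hrR⟩
    rw [mul_comm]
    have hsub : Metric.closedBall c r ⊆ Metric.ball c R := Metric.closedBall_subset_ball hrR
    have hs : Metric.sphere c |r| ⊆ Metric.ball c R := by
      rw [abs_of_pos hr0]; exact Metric.sphere_subset_closedBall.trans hsub
    have e1 : ∀ θ : ℝ, (Metric.ball c R).piecewise (fun z => ‖f z‖ ^ p) 0 (circleMap c r θ) =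
        ‖f (circleMap c r θ)‖ ^ p := fun θ => by
      rw [piecewise_eq_of_mem _ _ _ (hs (circleMap_mem_sphere' c r θ))]
    simp_rw [e1]
    rw [lintegral_circle_eq_circleAverage (f := fun z => ‖f z‖ ^ p) (hcont.mono hs)
      fun z _ => Real.rpow_nonneg (norm_nonneg _) p]
    have := norm_rpow_le_circleAverage hr0 hp (han.mono hsub)
    gcongr
  refine le_trans ?_ (setLIntegral_mono' measurableSet_Ioo key)
  rw [lintegral_const_mul _ ENNReal.measurable_ofReal]
  have h2 : ∫⁻ r in Ioo 0 R, ENNReal.ofReal r = ENNReal.ofReal (R ^ 2 / 2) := by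
    rw [← ofReal_integral_eq_lintegral_ofReal]
    · rw [← integral_Ioc_eq_integral_Ioo, ← intervalIntegral.integral_of_le hR.le, integral_id]
      simp
    · exact (continuous_id.integrableOn_Icc (a := 0) (b := R)).mono_set Ioo_subset_Icc_self
    · filter_upwards [ae_restrict_mem measurableSet_Ioo] with r hr using hr.1.le
  rw [h2, ← ENNReal.ofReal_mul (by positivity)]
  apply ENNReal.ofReal_le_ofReal
  apply le_of_eq
  ring

theorem one_sub_norm_mem_of_mem_ball {w z : ℂ}
    (hz : z ∈ Metric.ball w ((1 - ‖w‖) / 2)) :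
    (1 - ‖w‖) / 2 ≤ 1 - ‖z‖ ∧ 1 - ‖z‖ ≤ 3 / 2 * (1 - ‖w‖) := by
  rw [Metric.mem_ball, dist_eq_norm] at hz
  have h1 := norm_sub_norm_le z w
  have h2 := norm_sub_norm_le w z
  rw [norm_sub_rev] at h2
  constructor <;> linarith

/-- On the ball about w of radius (1 - |w|)/2 the weight V(1 - |z|) is comparable to V(1 - |w|), so
the area sub-mean-value inequality carries the weight along. -/
theorem norm_rpow_mul_le_lintegral {V : ℝ → ℝ} {a b p : ℝ} (hV : PowerType V a b) (hp : 0 < p) :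
    ∃ C, 0 < C ∧ ∀ G : ℂ → ℂ, IsAnalytic G → ∀ w ∈ disc,
      ENNReal.ofReal (‖G w‖ ^ p * V (1 - ‖w‖) * (1 - ‖w‖) ^ 2) ≤
        ENNReal.ofReal C * ∫⁻ z, ENNReal.ofReal (‖G z‖ ^ p * V (1 - ‖z‖)) ∂areaMeasure := by
  obtain ⟨C₁, hC₁, h₁⟩ := hV.le_of_le_two_mul
  obtain ⟨C₂, hC₂, h₂⟩ := hV.inv.le_of_le_two_mul
  -- The 4 comes from the squared radius (1 - |w|)^2/4. The maximum covers both cases, |z| above or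
  -- below |w|.
  refine ⟨4 * max C₁ C₂, by positivity, fun G hG w hw => ?_⟩
  have hw1 : ‖w‖ < 1 := by simpa [disc] using hw
  have hw0 := norm_nonneg w
  have hx : 0 < 1 - ‖w‖ := by linarith
  set R := (1 - ‖w‖) / 2 with hRdef
  have hR : 0 < R := by positivity
  have hsub : Metric.ball w R ⊆ disc := by
    intro z hz
    have := (one_sub_norm_mem_of_mem_ball hz).1
    simp only [disc, mem_ball_zero_iff]
    linarith
  have hcomp : ∀ z ∈ Metric.ball w R, V (1 - ‖w‖) ≤ max C₁ C₂ * V (1 - ‖z‖) := by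
    intro z hz
    obtain ⟨z1, z2⟩ := one_sub_norm_mem_of_mem_ball hz
    have hz0 := norm_nonneg z
    have hVz := hV.pos (1 - ‖z‖) (by linarith) (by linarith)
    have hVw := hV.pos (1 - ‖w‖) (by linarith) (by linarith)
    rcases le_total (1 - ‖z‖) (1 - ‖w‖) with h | h
    · refine (h₁ _ _ (by linarith) h (by linarith) (by linarith)).trans ?_
      gcongr
      exact le_max_left _ _
    · have := h₂ _ _ (by linarith) h (by linarith) (by linarith)
      rw [inv_le_iff_one_le_mul₀ hVz, mul_assoc, mul_comm _ (V (1 - ‖z‖)), ← mul_assoc,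
        ← div_eq_mul_inv, le_div_iff₀ hVw, one_mul] at this
      refine this.trans ?_
      gcongr
      exact le_max_right _ _
  have h3 := norm_rpow_mul_sq_le_lintegral hR hp (hG.mono hsub)
  have hVw := hV.pos (1 - ‖w‖) (by linarith) (by linarith)
  have hpi := Real.pi_pos
  calc ENNReal.ofReal (‖G w‖ ^ p * V (1 - ‖w‖) * (1 - ‖w‖) ^ 2)
      = ENNReal.ofReal (4 * Real.pi⁻¹ * V (1 - ‖w‖)) *
          ENNReal.ofReal (Real.pi * (‖G w‖ ^ p * R ^ 2)) := by
        rw [← ENNReal.ofReal_mul (by positivity), hRdef]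
        congr 1
        field_simp
        norm_num
    _ ≤ ENNReal.ofReal (4 * Real.pi⁻¹ * V (1 - ‖w‖)) *
          ∫⁻ z in Metric.ball w R, ENNReal.ofReal (‖G z‖ ^ p) := by gcongr
    _ = ENNReal.ofReal (4 * Real.pi⁻¹) *
          ∫⁻ z in Metric.ball w R, ENNReal.ofReal (‖G z‖ ^ p * V (1 - ‖w‖)) := by
        simp_rw [ENNReal.ofReal_mul (Real.rpow_nonneg (norm_nonneg _) p)]
        rw [lintegral_mul_const' _ _ ENNReal.ofReal_ne_top, mul_comm (∫⁻ _ in _, _), ← mul_assoc,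
          ← ENNReal.ofReal_mul (by positivity)]
    _ ≤ ENNReal.ofReal (4 * Real.pi⁻¹) * ∫⁻ z in Metric.ball w R,
          ENNReal.ofReal (max C₁ C₂) * ENNReal.ofReal (‖G z‖ ^ p * V (1 - ‖z‖)) := by
        gcongr 1
        refine setLIntegral_mono' Metric.isOpen_ball.measurableSet fun z hz => ?_
        rw [← ENNReal.ofReal_mul (by positivity)]
        apply ENNReal.ofReal_le_ofReal
        have := hcomp z hz
        have h0 := Real.rpow_nonneg (norm_nonneg (G z)) p
        nlinarith
    _ ≤ ENNReal.ofReal (4 * Real.pi⁻¹) * ∫⁻ z in disc,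
          ENNReal.ofReal (max C₁ C₂) * ENNReal.ofReal (‖G z‖ ^ p * V (1 - ‖z‖)) := by
        gcongr 1
        exact lintegral_mono_set hsub
    _ = _ := by
        rw [lintegral_const_mul' _ _ ENNReal.ofReal_ne_top, lintegral_areaMeasure, ← mul_assoc,
          ← mul_assoc, ← ENNReal.ofReal_mul (by positivity), ← ENNReal.ofReal_mul (by positivity)]
        congr 2
        ring

theorem ae_areaMeasure_mem : ∀ᵐ z ∂areaMeasure, z ∈ disc :=
  Measure.ae_smul_measure (ae_restrict_mem Metric.isOpen_ball.measurableSet) _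

/-- In the splitting |G| = |G|^{1-p} |G|^p the first factor is bounded pointwise by a power of the
right-hand integral, through `norm_rpow_mul_le_lintegral`. This replaces Hölder's inequality when p
≤ 1. -/
theorem lintegral_norm_le_of_le_one {p b : ℝ} (hp : 0 < p) (hp1 : p ≤ 1) :
    ∃ C, 0 < C ∧ ∀ G : ℂ → ℂ, IsAnalytic G →
      (∫⁻ z, ENNReal.ofReal (‖G z‖ * (1 - ‖z‖) ^ b) ∂areaMeasure) ^ p ≤
        ENNReal.ofReal C *
          ∫⁻ z, ENNReal.ofReal (‖G z‖ ^ p * (1 - ‖z‖) ^ ((b + 2) * p - 2)) ∂areaMeasure := by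
  obtain ⟨C, hC, h⟩ := norm_rpow_mul_le_lintegral (PowerType.rpow_id ((b + 2) * p - 2)) hp
  refine ⟨C ^ (1 - p), by positivity, fun G hG => ?_⟩
  set I := ∫⁻ z, ENNReal.ofReal (‖G z‖ ^ p * (1 - ‖z‖) ^ ((b + 2) * p - 2)) ∂areaMeasure with hI
  rcases eq_or_ne I ⊤ with htop | htop
  · rw [htop, ENNReal.mul_top (by positivity)]
    exact le_top
  set J := I.toReal with hJ
  have hIJ : I = ENNReal.ofReal J := (ENNReal.ofReal_toReal htop).symm
  have hJ0 : 0 ≤ J := ENNReal.toReal_nonneg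
  have hpt : ∀ z ∈ disc, ENNReal.ofReal (‖G z‖ * (1 - ‖z‖) ^ b) ≤
      ENNReal.ofReal ((C * J) ^ ((1 - p) / p)) *
        ENNReal.ofReal (‖G z‖ ^ p * (1 - ‖z‖) ^ ((b + 2) * p - 2)) := by
    intro z hz
    have hz1 : ‖z‖ < 1 := by simpa [disc] using hz
    have hx : 0 < 1 - ‖z‖ := by linarith
    have h1 := h G hG z hz
    rw [← hI, hIJ, ← ENNReal.ofReal_mul hC.le, ENNReal.ofReal_le_ofReal_iff (by positivity)] at h1
    rw [← ENNReal.ofReal_mul (by positivity)]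
    apply ENNReal.ofReal_le_ofReal
    set x := 1 - ‖z‖
    set N := ‖G z‖ with hN
    have hN0 : 0 ≤ N := norm_nonneg _
    have h2 : N ^ p * x ^ ((b + 2) * p) ≤ C * J := by
      refine le_trans (le_of_eq ?_) h1
      rw [mul_assoc, ← Real.rpow_natCast x 2, ← Real.rpow_add hx]
      norm_num
    have h3 : N ^ (1 - p) * x ^ ((b + 2) * (1 - p)) ≤ (C * J) ^ ((1 - p) / p) := by
      have := Real.rpow_le_rpow (by positivity) h2 (div_nonneg (sub_nonneg.2 hp1) hp.le)
      refine le_trans (le_of_eq ?_) this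
      rw [Real.mul_rpow (by positivity) (by positivity), ← Real.rpow_mul hN0, ← Real.rpow_mul hx.le]
      congr 2 <;> field_simp
    have h4 : N = N ^ (1 - p) * N ^ p := by
      rcases hN0.eq_or_lt with h | h
      · rw [← h, Real.zero_rpow hp.ne', mul_zero]
      · rw [← Real.rpow_add h]; simp
    have h5 : x ^ b = x ^ ((b + 2) * (1 - p)) * x ^ ((b + 2) * p - 2) := by
      rw [← Real.rpow_add hx]; congr 1; ring
    calc N * x ^ b = (N ^ (1 - p) * x ^ ((b + 2) * (1 - p))) *
          (N ^ p * x ^ ((b + 2) * p - 2)) := by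
          rw [h5]; nth_rewrite 1 [h4]; ring
      _ ≤ _ := by gcongr
  have h6 : ∫⁻ z, ENNReal.ofReal (‖G z‖ * (1 - ‖z‖) ^ b) ∂areaMeasure ≤
      ENNReal.ofReal ((C * J) ^ ((1 - p) / p)) * I := by
    rw [hI, ← lintegral_const_mul' _ _ ENNReal.ofReal_ne_top]
    exact lintegral_mono_ae (ae_areaMeasure_mem.mono hpt)
  refine (ENNReal.rpow_le_rpow h6 hp.le).trans (le_of_eq ?_)
  rw [hIJ, ← ENNReal.ofReal_mul (by positivity), ENNReal.ofReal_rpow_of_nonneg (by positivity) hp.le,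
    ← ENNReal.ofReal_mul (by positivity), Real.mul_rpow (by positivity) hJ0,
    ← Real.rpow_mul (by positivity), div_mul_cancel₀ _ hp.ne', Real.mul_rpow hC.le hJ0, mul_assoc]
  congr 2
  rcases hJ0.eq_or_lt with h | h
  · rw [← h, Real.zero_rpow hp.ne', mul_zero]
  · rw [← Real.rpow_add h]; simp

/-! ### Symbol classes of sequences -/

/-- Real sequences whose differences up to order `j` satisfy `|Δⁱ S n| ≲ W n / (n + 1) ^ i`. -/
def SymbolClass : ℕ → (ℕ → ℝ) → (ℕ → ℝ) → Prop
  | 0, W, S => ∃ C, 0 < C ∧ ∀ n, |S n| ≤ C * W n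
  | j + 1, W, S => (∃ C, 0 < C ∧ ∀ n, |S n| ≤ C * W n) ∧
      SymbolClass j (fun n => W n / (n + 1)) (fun n => S (n + 1) - S n)

/-- Positive sequences with comparable consecutive terms. -/
structure RegularSeq (W : ℕ → ℝ) : Prop where
  pos : ∀ n, 0 < W n
  succ_le : ∃ C, 0 < C ∧ ∀ n, W (n + 1) ≤ C * W n
  le_succ : ∃ C, 0 < C ∧ ∀ n, W n ≤ C * W (n + 1)

theorem RegularSeq.mul {W V : ℕ → ℝ} (hW : RegularSeq W) (hV : RegularSeq V) :
    RegularSeq fun n => W n * V n := by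
  obtain ⟨C, hC, h⟩ := hW.succ_le
  obtain ⟨D, hD, h'⟩ := hV.succ_le
  obtain ⟨E, hE, k⟩ := hW.le_succ
  obtain ⟨F, hF, k'⟩ := hV.le_succ
  refine ⟨fun n => mul_pos (hW.pos n) (hV.pos n), ⟨C * D, by positivity, fun n => ?_⟩,
    ⟨E * F, by positivity, fun n => ?_⟩⟩
  · have := mul_le_mul (h n) (h' n) (hV.pos _).le (mul_pos hC (hW.pos _)).le
    linarith
  · have := mul_le_mul (k n) (k' n) (hV.pos _).le (mul_pos hE (hW.pos _)).le
    linarith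

theorem RegularSeq.inv {W : ℕ → ℝ} (hW : RegularSeq W) : RegularSeq fun n => (W n)⁻¹ := by
  obtain ⟨C, hC, h⟩ := hW.succ_le
  obtain ⟨E, hE, k⟩ := hW.le_succ
  have key : ∀ a b K : ℝ, 0 < a → 0 < b → a ≤ K * b → b⁻¹ ≤ K * a⁻¹ := by
    intro a b K ha hb h
    rw [← div_eq_mul_inv, le_div_iff₀ ha, inv_mul_le_iff₀ hb, mul_comm]
    linarith
  exact ⟨fun n => inv_pos.2 (hW.pos n), ⟨E, hE, fun n => key _ _ _ (hW.pos _) (hW.pos _) (k n)⟩,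
    ⟨C, hC, fun n => key _ _ _ (hW.pos _) (hW.pos _) (h n)⟩⟩

theorem RegularSeq.succ : RegularSeq fun n => (n : ℝ) + 1 :=
  ⟨fun n => by positivity,
    ⟨2, by norm_num, fun n => by push_cast; have : (0 : ℝ) ≤ n := n.cast_nonneg; linarith⟩,
    ⟨1, by norm_num, fun n => by push_cast; linarith⟩⟩

theorem RegularSeq.div_succ {W : ℕ → ℝ} (hW : RegularSeq W) :
    RegularSeq fun n => W n / (n + 1) := by
  simpa only [div_eq_mul_inv] using hW.mul RegularSeq.succ.inv

namespace SymbolClass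

theorem bound {j : ℕ} {W S : ℕ → ℝ} (h : SymbolClass j W S) :
    ∃ C, 0 < C ∧ ∀ n, |S n| ≤ C * W n := by
  cases j with
  | zero => exact h
  | succ j => exact h.1

theorem mono {j : ℕ} {W V S : ℕ → ℝ} (h : SymbolClass j W S)
    (hWV : ∃ C, 0 < C ∧ ∀ n, W n ≤ C * V n) : SymbolClass j V S := by
  induction j generalizing W V S with
  | zero =>
    obtain ⟨C, hC, h⟩ := h
    obtain ⟨D, hD, h'⟩ := hWV
    exact ⟨C * D, by positivity, fun n => (h n).trans (by
      rw [mul_assoc]; exact mul_le_mul_of_nonneg_left (h' n) hC.le)⟩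
  | succ j ih =>
    obtain ⟨⟨C, hC, h⟩, h2⟩ := h
    obtain ⟨D, hD, h'⟩ := hWV
    refine ⟨⟨C * D, by positivity, fun n => (h n).trans (by
      rw [mul_assoc]; exact mul_le_mul_of_nonneg_left (h' n) hC.le)⟩,
      ih h2 ⟨D, hD, fun n => ?_⟩⟩
    rw [← mul_div_assoc]
    exact div_le_div_of_nonneg_right (h' n) (by positivity)

theorem of_succ {j : ℕ} {W S : ℕ → ℝ} (h : SymbolClass (j + 1) W S) : SymbolClass j W S := by
  induction j generalizing W S with
  | zero => exact h.1
  | succ j ih => exact ⟨h.1, ih h.2⟩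

theorem zero (j : ℕ) {W : ℕ → ℝ} (hW : ∀ n, 0 < W n) : SymbolClass j W fun _ => 0 := by
  induction j generalizing W with
  | zero => exact ⟨1, one_pos, fun n => by simpa using (hW n).le⟩
  | succ j ih =>
    refine ⟨⟨1, one_pos, fun n => by simpa using (hW n).le⟩, ?_⟩
    simp only [sub_self]
    exact ih fun n => div_pos (hW n) (by positivity)

theorem add {j : ℕ} {W S T : ℕ → ℝ} (hS : SymbolClass j W S) (hT : SymbolClass j W T) :
    SymbolClass j W fun n => S n + T n := by
  induction j generalizing W S T with
  | zero =>
    obtain ⟨C, hC, h⟩ := hS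
    obtain ⟨D, hD, h'⟩ := hT
    exact ⟨C + D, by positivity, fun n => (abs_add_le _ _).trans (by
      rw [add_mul]; exact add_le_add (h n) (h' n))⟩
  | succ j ih =>
    obtain ⟨⟨C, hC, h⟩, h2⟩ := hS
    obtain ⟨⟨D, hD, h'⟩, h2'⟩ := hT
    refine ⟨⟨C + D, by positivity, fun n => (abs_add_le _ _).trans (by
      rw [add_mul]; exact add_le_add (h n) (h' n))⟩, ?_⟩
    convert ih h2 h2' using 2
    ring

theorem const_mul {j : ℕ} {W S : ℕ → ℝ} (hS : SymbolClass j W S) (c : ℝ) :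
    SymbolClass j W fun n => c * S n := by
  have key : ∀ {W S : ℕ → ℝ}, (∃ C, 0 < C ∧ ∀ n, |S n| ≤ C * W n) →
      ∃ C, 0 < C ∧ ∀ n, |c * S n| ≤ C * W n := by
    rintro W S ⟨C, hC, h⟩
    refine ⟨(|c| + 1) * C, by positivity, fun n => ?_⟩
    rw [abs_mul, mul_assoc]
    exact mul_le_mul (by linarith) (h n) (abs_nonneg _) (by positivity)
  induction j generalizing W S with
  | zero => exact key hS
  | succ j ih =>
    refine ⟨key hS.1, ?_⟩
    convert ih hS.2 using 2
    ring

theorem shift {j : ℕ} {W S : ℕ → ℝ} (hW : RegularSeq W) (hS : SymbolClass j W S) :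
    SymbolClass j W fun n => S (n + 1) := by
  have key : ∀ {W S : ℕ → ℝ}, RegularSeq W → (∃ C, 0 < C ∧ ∀ n, |S n| ≤ C * W n) →
      ∃ C, 0 < C ∧ ∀ n, |S (n + 1)| ≤ C * W n := by
    rintro W S hW ⟨C, hC, h⟩
    obtain ⟨D, hD, h'⟩ := hW.succ_le
    refine ⟨C * D, by positivity, fun n => (h _).trans ?_⟩
    rw [mul_assoc]
    exact mul_le_mul_of_nonneg_left (h' n) hC.le
  induction j generalizing W S with
  | zero => exact key hW hS
  | succ j ih => exact ⟨key hW hS.1, ih hW.div_succ hS.2⟩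

theorem shift_add {j : ℕ} {W S : ℕ → ℝ} (hW : RegularSeq W) (hS : SymbolClass j W S) (k : ℕ) :
    SymbolClass j W fun n => S (n + k) := by
  induction k with
  | zero => exact hS
  | succ k ih =>
    have h := ih.shift hW
    simp only [add_right_comm _ 1 k] at h
    exact h

/-- Discrete Leibniz rule: Δ(ST)(n) = ΔS(n) T(n+1) + S(n) ΔT(n), with induction on the order. -/
theorem mul {j : ℕ} {W V S T : ℕ → ℝ} (hW : RegularSeq W) (hV : RegularSeq V)
    (hS : SymbolClass j W S) (hT : SymbolClass j V T) :
    SymbolClass j (fun n => W n * V n) fun n => S n * T n := by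
  have key : ∀ {W V S T : ℕ → ℝ}, (∃ C, 0 < C ∧ ∀ n, |S n| ≤ C * W n) →
      (∃ C, 0 < C ∧ ∀ n, |T n| ≤ C * V n) →
      ∃ C, 0 < C ∧ ∀ n, |S n * T n| ≤ C * (W n * V n) := by
    rintro W V S T ⟨C, hC, h⟩ ⟨D, hD, h'⟩
    refine ⟨C * D, by positivity, fun n => ?_⟩
    rw [abs_mul]
    calc |S n| * |T n| ≤ (C * W n) * (D * V n) :=
          mul_le_mul (h n) (h' n) (abs_nonneg _) ((abs_nonneg _).trans (h n))
      _ = _ := by ring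
  induction j generalizing W V S T with
  | zero => exact key hS hT
  | succ j ih =>
    refine ⟨key hS.1 hT.1, ?_⟩
    have h1 := ih hW.div_succ hV hS.2 (hT.of_succ.shift hV)
    have h2 := ih hW hV.div_succ hS.of_succ hT.2
    have e1 : (fun n : ℕ => W n / (n + 1) * V n) = fun n : ℕ => W n * V n / (n + 1) := by
      ext n; ring
    have e2 : (fun n : ℕ => W n * (V n / (n + 1))) = fun n : ℕ => W n * V n / (n + 1) := by
      ext n; ring
    rw [e1] at h1
    rw [e2] at h2
    convert h1.add h2 using 2
    ring

/-- One difference gives Δ(1/S)(n) = -ΔS(n) / (S(n) S(n+1)). By induction 1/S already has order j,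
so the product rule applies to the right side. The lower bound on S is what makes 1/S of size 1/W.
-/
theorem inv {j : ℕ} {W S : ℕ → ℝ} (hW : RegularSeq W) (hS : SymbolClass j W S)
    (hlow : ∃ c, 0 < c ∧ ∀ n, c * W n ≤ S n) :
    SymbolClass j (fun n => (W n)⁻¹) fun n => (S n)⁻¹ := by
  obtain ⟨c, hc, hl⟩ := hlow
  have hpos : ∀ n, 0 < S n := fun n => (mul_pos hc (hW.pos n)).trans_le (hl n)
  have key : ∃ C, 0 < C ∧ ∀ n, |(S n)⁻¹| ≤ C * (W n)⁻¹ := by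
    refine ⟨c⁻¹, by positivity, fun n => ?_⟩
    rw [abs_of_pos (inv_pos.2 (hpos n)), ← mul_inv]
    exact inv_anti₀ (mul_pos hc (hW.pos n)) (hl n)
  induction j with
  | zero => exact key
  | succ j ih =>
    refine ⟨key, ?_⟩
    have h1 := ih hS.of_succ
    have h2 := (hS.2.const_mul (-1)).mul hW.div_succ (hW.inv.mul hW.inv)
      (h1.mul hW.inv hW.inv (h1.shift hW.inv))
    have e1 : (fun n : ℕ => W n / (n + 1) * ((W n)⁻¹ * (W n)⁻¹)) =
        fun n : ℕ => (W n)⁻¹ / (n + 1) := by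
      ext n
      have := (hW.pos n).ne'
      field_simp
    rw [e1] at h2
    convert h2 using 2 with n
    have a1 := (hpos n).ne'
    have a2 := (hpos (n + 1)).ne'
    field_simp
    ring

theorem const (j : ℕ) (c : ℝ) : SymbolClass j (fun _ => 1) fun _ => c := by
  cases j with
  | zero => exact ⟨|c| + 1, by positivity, fun n => by linarith⟩
  | succ j =>
    refine ⟨⟨|c| + 1, by positivity, fun n => by linarith⟩, ?_⟩
    simp only [sub_self]
    exact zero j fun n => by positivity

theorem add_const (j : ℕ) (c : ℝ) : SymbolClass j (fun n => (n : ℝ) + 1) fun n => (n : ℝ) + c := by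
  have key : ∃ C, 0 < C ∧ ∀ n : ℕ, |(n : ℝ) + c| ≤ C * ((n : ℝ) + 1) := by
    refine ⟨|c| + 1, by positivity, fun n => ?_⟩
    have h0 : (0 : ℝ) ≤ n := n.cast_nonneg
    have := abs_add_le (n : ℝ) c
    rw [abs_of_nonneg h0] at this
    nlinarith [abs_nonneg c]
  cases j with
  | zero => exact key
  | succ j =>
    refine ⟨key, ?_⟩
    have e1 : (fun n : ℕ => ((n : ℝ) + 1) / (n + 1)) = fun _ => 1 := by
      ext n
      rw [div_self]
      positivity
    rw [e1]
    simpa using const j 1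

end SymbolClass

theorem RegularSeq.const_one : RegularSeq fun _ => 1 :=
  ⟨fun _ => one_pos, ⟨1, one_pos, fun _ => by norm_num⟩, ⟨1, one_pos, fun _ => by norm_num⟩⟩

theorem RegularSeq.pow {W : ℕ → ℝ} (hW : RegularSeq W) (m : ℕ) : RegularSeq fun n => W n ^ m := by
  induction m with
  | zero => simpa using RegularSeq.const_one
  | succ m ih => simpa only [pow_succ] using ih.mul hW

/-- The symbol `∏ i < m, (n + c i)` has order `m`. -/
theorem SymbolClass.prod_add_const (j m : ℕ) (c : ℕ → ℝ) :
    SymbolClass j (fun n => ((n : ℝ) + 1) ^ m) fun n => ∏ i ∈ Finset.range m, ((n : ℝ) + c i) := by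
  induction m with
  | zero => simpa using SymbolClass.const j 1
  | succ m ih =>
    simp only [pow_succ, Finset.prod_range_succ]
    exact ih.mul (RegularSeq.succ.pow m) RegularSeq.succ (SymbolClass.add_const j (c m))

/-! ### Kernel estimates by summation by parts -/

/-- Each multiplication by 1 - ζ is a summation by parts: (1 - ζ) Σ S(n) ζ^n = S(0) + ζ Σ ΔS(n) ζ^n.
After j of them the terms have size W(n)/(n+1)^j, and the summand 1 on the right pays for the
boundary terms. -/
theorem SymbolClass.norm_tsum_le {j : ℕ} {W S : ℕ → ℝ} (hS : SymbolClass j W S)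
    (hs : ∀ r : ℝ, 0 ≤ r → r < 1 → Summable fun n => W n * r ^ n) :
    ∃ C, 0 < C ∧ ∀ ζ : ℂ, ‖ζ‖ < 1 → ‖1 - ζ‖ ^ j * ‖∑' n, (S n : ℂ) * ζ ^ n‖ ≤
      C * (1 + ∑' n : ℕ, W n / ((n : ℝ) + 1) ^ j * ‖ζ‖ ^ n) := by
  have hsumm : ∀ {W S : ℕ → ℝ}, (∃ C, 0 < C ∧ ∀ n, |S n| ≤ C * W n) →
      (∀ r : ℝ, 0 ≤ r → r < 1 → Summable fun n => W n * r ^ n) → ∀ ζ : ℂ, ‖ζ‖ < 1 →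
      Summable fun n => (S n : ℂ) * ζ ^ n := by
    rintro W S ⟨C, hC, h⟩ hs ζ hζ
    refine Summable.of_norm_bounded ((hs _ (norm_nonneg ζ) hζ).mul_left C) fun n => ?_
    rw [norm_mul, norm_pow, Complex.norm_real, Real.norm_eq_abs, ← mul_assoc]
    exact mul_le_mul_of_nonneg_right (h n) (by positivity)
  induction j generalizing W S with
  | zero =>
    obtain ⟨C, hC, h⟩ := hS
    refine ⟨C, hC, fun ζ hζ => ?_⟩
    have := tsum_of_norm_bounded ((hs _ (norm_nonneg ζ) hζ).mul_left C).hasSum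
      (f := fun n => (S n : ℂ) * ζ ^ n) fun n => by
        rw [norm_mul, norm_pow, Complex.norm_real, Real.norm_eq_abs, ← mul_assoc]
        exact mul_le_mul_of_nonneg_right (h n) (by positivity)
    rw [tsum_mul_left] at this
    simp only [pow_zero, one_mul, div_one, mul_add, mul_one]
    linarith
  | succ j ih =>
    have hs' : ∀ r : ℝ, 0 ≤ r → r < 1 → Summable fun n : ℕ => W n / ((n : ℝ) + 1) * r ^ n := by
      intro r hr hr1
      have hW : ∀ n, 0 ≤ W n := fun n => by
        obtain ⟨C, hC, h⟩ := hS.1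
        exact nonneg_of_mul_nonneg_right ((abs_nonneg _).trans (h n)) hC
      refine Summable.of_nonneg_of_le (fun n => ?_) (fun n => ?_) (hs r hr hr1)
      · have := hW n; positivity
      · refine mul_le_mul_of_nonneg_right (div_le_self (hW n) ?_) (by positivity)
        linarith [(n.cast_nonneg : (0 : ℝ) ≤ n)]
    obtain ⟨C, hC, h⟩ := ih hS.2 hs'
    refine ⟨2 ^ j * |S 0| + C, by positivity, fun ζ hζ => ?_⟩
    have h1 := hsumm hS.1 hs ζ hζ
    have h2 := hsumm hS.2.bound hs' ζ hζ
    have h3 : (1 - ζ) * ∑' n, (S n : ℂ) * ζ ^ n =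
        S 0 + ζ * ∑' n, ((S (n + 1) - S n : ℝ) : ℂ) * ζ ^ n := by
      have e1 : ∑' n, (S n : ℂ) * ζ ^ n = S 0 + ∑' n, (S (n + 1) : ℂ) * ζ ^ (n + 1) := by
        simpa using h1.tsum_eq_zero_add
      have e2 : ∑' n, (S (n + 1) : ℂ) * ζ ^ (n + 1) = ∑' n, ζ * ((S n : ℂ) * ζ ^ n) +
          ∑' n, ζ * (((S (n + 1) - S n : ℝ) : ℂ) * ζ ^ n) := by
        rw [← (h1.mul_left ζ).tsum_add (h2.mul_left ζ)]
        congr 1 with n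
        push_cast
        ring
      rw [tsum_mul_left, tsum_mul_left] at e2
      rw [sub_mul, one_mul]
      linear_combination e1 + e2
    have h4 := h ζ hζ
    have e3 : ∀ n : ℕ, W n / ((n : ℝ) + 1) / ((n : ℝ) + 1) ^ j * ‖ζ‖ ^ n =
        W n / ((n : ℝ) + 1) ^ (j + 1) * ‖ζ‖ ^ n := fun n => by
      rw [div_div, pow_succ']
    simp_rw [e3] at h4
    set T := ∑' n : ℕ, W n / ((n : ℝ) + 1) ^ (j + 1) * ‖ζ‖ ^ n with hT
    have hT0 : 0 ≤ T := by
      refine tsum_nonneg fun n => ?_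
      obtain ⟨C, hC, h⟩ := hS.1
      have : 0 ≤ W n := nonneg_of_mul_nonneg_right ((abs_nonneg _).trans (h n)) hC
      positivity
    have h5 : ‖1 - ζ‖ ≤ 2 := (norm_sub_le _ _).trans (by rw [norm_one]; linarith)
    calc ‖1 - ζ‖ ^ (j + 1) * ‖∑' n, (S n : ℂ) * ζ ^ n‖
        = ‖1 - ζ‖ ^ j * ‖S 0 + ζ * ∑' n, ((S (n + 1) - S n : ℝ) : ℂ) * ζ ^ n‖ := by
          rw [← h3, norm_mul]; ring
      _ ≤ ‖1 - ζ‖ ^ j * (|S 0| + ‖∑' n, ((S (n + 1) - S n : ℝ) : ℂ) * ζ ^ n‖) := by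
          gcongr
          refine (norm_add_le _ _).trans ?_
          rw [Complex.norm_real, Real.norm_eq_abs, norm_mul]
          gcongr
          exact mul_le_of_le_one_left (norm_nonneg _) hζ.le
      _ ≤ 2 ^ j * |S 0| + C * (1 + T) := by
          rw [mul_add]
          gcongr
      _ ≤ _ := by
          have : 0 ≤ 2 ^ j * |S 0| * T := by positivity
          linarith

/-- Termwise comparison with the binomial series, since (n+1)^m is at most m! times the binomial
coefficient of n + m over m. -/
theorem summable_succ_pow_mul (m : ℕ) {r : ℝ} (hr : 0 ≤ r) (hr1 : r < 1) :
    Summable (fun n : ℕ => ((n : ℝ) + 1) ^ m * r ^ n) ∧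
      ∑' n : ℕ, ((n : ℝ) + 1) ^ m * r ^ n ≤ m.factorial * ((1 - r) ^ (m + 1))⁻¹ := by
  have hn : ‖r‖ < 1 := by rwa [Real.norm_eq_abs, abs_of_nonneg hr]
  have h1 := (hasSum_choose_mul_geometric_of_norm_lt_one m hn).mul_left (m.factorial : ℝ)
  have hle : ∀ n : ℕ, ((n : ℝ) + 1) ^ m * r ^ n ≤
      m.factorial * (((n + m).choose m : ℕ) * r ^ n) := by
    intro n
    rw [← mul_assoc]
    gcongr
    have h2 := Nat.pow_succ_le_ascFactorial (n + 1) m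
    rw [Nat.ascFactorial_eq_factorial_mul_choose] at h2
    exact_mod_cast h2
  have hs := Summable.of_nonneg_of_le (fun n => by positivity) hle h1.summable
  refine ⟨hs, ?_⟩
  have := hs.tsum_le_tsum hle h1.summable
  rwa [h1.tsum_eq, one_div] at this

/-- Preparation for summing over n at scale τ. Where (n+1)τ ≤ 1, the hypothesis r' ≤ e makes the
ratio of the two sides bounded. Where (n+1)τ ≥ 1, it grows at most like a power of (n+1)τ. -/
theorem PowerType.succ_pow_mul_le {R : ℝ → ℝ} {r r' : ℝ} (hR : PowerType R r r') {e : ℕ}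
    (he : r' ≤ e) : ∃ C, 0 < C ∧ ∃ m : ℕ, ∀ n : ℕ, ∀ τ : ℝ, 0 < τ → τ ≤ 1 →
      ((n : ℝ) + 1) ^ e * R (1 / ((n : ℝ) + 1)) ≤
        C * ((τ ^ e)⁻¹ * R τ * (1 + (((n : ℝ) + 1) * τ) ^ m)) := by
  obtain ⟨C, hC, h⟩ := hR.bound
  -- Rounding the exponent up to an integer lets the later sum be a binomial series.
  obtain ⟨m, hm⟩ := exists_nat_ge (e - r)
  refine ⟨C, hC, m, fun n τ hτ hτ1 => ?_⟩
  set N : ℝ := (n : ℝ) + 1 with hN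
  have hN1 : 1 ≤ N := by simp [hN]
  have hN0 : 0 < N := by linarith
  have hRτ := hR.pos τ hτ hτ1
  have hNe : N ^ e = (τ ^ e)⁻¹ * (N * τ) ^ (e : ℝ) := by
    rw [Real.rpow_natCast, mul_pow]
    field_simp
  have hNτ : 0 < N * τ := by positivity
  rcases le_total τ (1 / N) with hc | hc
  · have h1 := (h (1 / N) τ hτ hc (by rw [div_le_one hN0]; exact hN1)).1
    have h2 : N * τ ≤ 1 := by rw [le_div_iff₀ hN0] at hc; linarith
    have e1 : (1 / N / τ) ^ r' = (N * τ) ^ (-r') := by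
      rw [Real.rpow_neg hNτ.le, ← Real.inv_rpow hNτ.le]
      congr 1
      field_simp
    rw [e1] at h1
    calc N ^ e * R (1 / N) ≤ N ^ e * (C * (N * τ) ^ (-r') * R τ) := by gcongr
      _ = C * ((τ ^ e)⁻¹ * R τ * (N * τ) ^ ((e : ℝ) - r')) := by
          rw [hNe, sub_eq_add_neg, Real.rpow_add hNτ]; ring
      _ ≤ C * ((τ ^ e)⁻¹ * R τ * (1 + (N * τ) ^ m)) := by
          gcongr
          have := Real.rpow_le_one hNτ.le h2 (sub_nonneg.2 he)
          have : 0 ≤ (N * τ) ^ m := by positivity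
          linarith
  · have h1 := (h τ (1 / N) (by positivity) hc hτ1).2
    have h2 : 1 ≤ N * τ := by rw [div_le_iff₀ hN0] at hc; linarith
    have e1 : (1 / N / τ) ^ r = (N * τ) ^ (-r) := by
      rw [Real.rpow_neg hNτ.le, ← Real.inv_rpow hNτ.le]
      congr 1
      field_simp
    rw [e1] at h1
    calc N ^ e * R (1 / N) ≤ N ^ e * (C * (N * τ) ^ (-r) * R τ) := by gcongr
      _ = C * ((τ ^ e)⁻¹ * R τ * (N * τ) ^ ((e : ℝ) - r)) := by
          rw [hNe, sub_eq_add_neg, Real.rpow_add hNτ]; ring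
      _ ≤ C * ((τ ^ e)⁻¹ * R τ * (1 + (N * τ) ^ m)) := by
          gcongr
          have := Real.rpow_le_rpow_of_exponent_le h2 hm
          rw [Real.rpow_natCast] at this
          linarith

/-- `PowerType.succ_pow_mul_le` at the scale τ = 1 - ρ reduces the sum to Σ ρ^n and Σ ((n+1)τ)^m
ρ^n, both of order 1/τ. -/
theorem PowerType.tsum_le {R : ℝ → ℝ} {r r' : ℝ} (hR : PowerType R r r') {e : ℕ}
    (he : r' ≤ e) : ∃ C, 0 < C ∧ ∀ ρ : ℝ, 0 ≤ ρ → ρ < 1 →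
      Summable (fun n : ℕ => ((n : ℝ) + 1) ^ e * R (1 / ((n : ℝ) + 1)) * ρ ^ n) ∧
      ∑' n : ℕ, ((n : ℝ) + 1) ^ e * R (1 / ((n : ℝ) + 1)) * ρ ^ n ≤
        C * (((1 - ρ) ^ (e + 1))⁻¹ * R (1 - ρ)) := by
  obtain ⟨C, hC, m, h⟩ := hR.succ_pow_mul_le he
  refine ⟨C * (1 + m.factorial), by positivity, fun ρ hρ hρ1 => ?_⟩
  set τ := 1 - ρ with hτ
  have hτ0 : 0 < τ := by linarith
  have hτ1 : τ ≤ 1 := by linarith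
  have hRτ := hR.pos τ hτ0 hτ1
  obtain ⟨s0, b0⟩ := summable_succ_pow_mul 0 hρ hρ1
  obtain ⟨s1, b1⟩ := summable_succ_pow_mul m hρ hρ1
  simp only [pow_zero, one_mul, Nat.factorial_zero, Nat.cast_one, zero_add, pow_one] at s0 b0
  have hle : ∀ n : ℕ, ((n : ℝ) + 1) ^ e * R (1 / ((n : ℝ) + 1)) * ρ ^ n ≤
      C * ((τ ^ e)⁻¹ * R τ) * (ρ ^ n + τ ^ m * (((n : ℝ) + 1) ^ m * ρ ^ n)) := by
    intro n
    refine (mul_le_mul_of_nonneg_right (h n τ hτ0 hτ1) (by positivity)).trans (le_of_eq ?_)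
    rw [mul_pow]
    ring
  have hsum : Summable fun n : ℕ =>
      C * ((τ ^ e)⁻¹ * R τ) * (ρ ^ n + τ ^ m * (((n : ℝ) + 1) ^ m * ρ ^ n)) :=
    (s0.add (s1.mul_left _)).mul_left _
  have hnn : ∀ n : ℕ, 0 ≤ ((n : ℝ) + 1) ^ e * R (1 / ((n : ℝ) + 1)) * ρ ^ n := by
    intro n
    have := hR.pos (1 / ((n : ℝ) + 1)) (by positivity) (by
      rw [div_le_one (by positivity)]; linarith [(n.cast_nonneg : (0 : ℝ) ≤ n)])
    positivity
  have hs := Summable.of_nonneg_of_le hnn hle hsum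
  refine ⟨hs, (hs.tsum_le_tsum hle hsum).trans ?_⟩
  rw [tsum_mul_left, s0.tsum_add (s1.mul_left _), tsum_mul_left]
  calc C * ((τ ^ e)⁻¹ * R τ) * (∑' n : ℕ, ρ ^ n + τ ^ m * ∑' n : ℕ, ((n : ℝ) + 1) ^ m * ρ ^ n)
      ≤ C * ((τ ^ e)⁻¹ * R τ) * (τ⁻¹ + τ ^ m * (m.factorial * (τ ^ (m + 1))⁻¹)) := by gcongr
    _ = _ := by
      rw [pow_succ τ m, pow_succ τ e]
      field_simp

theorem SymbolClass.norm_kernel_le {R : ℝ → ℝ} {r r' : ℝ} (hR : PowerType R r r') {N e : ℕ}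
    (he : r' ≤ e) {S : ℕ → ℝ}
    (hS : SymbolClass N (fun n => ((n : ℝ) + 1) ^ (N + e) * R (1 / ((n : ℝ) + 1))) S) :
    ∃ C, 0 < C ∧ ∀ ζ : ℂ, ‖ζ‖ < 1 → ‖1 - ζ‖ ^ N * ‖∑' n, (S n : ℂ) * ζ ^ n‖ ≤
      C * (((1 - ‖ζ‖) ^ (e + 1))⁻¹ * R (1 - ‖ζ‖)) := by
  have he' : r' ≤ ((N + e : ℕ) : ℝ) := by
    push_cast
    linarith [(N.cast_nonneg : (0 : ℝ) ≤ N)]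
  obtain ⟨_, _, hsum⟩ := hR.tsum_le he'
  obtain ⟨C, hC, h⟩ := hS.norm_tsum_le fun ρ h0 h1 => (hsum ρ h0 h1).1
  obtain ⟨D, hD, hb⟩ := hR.tsum_le he
  have hR1 := hR.pos 1 one_pos le_rfl
  refine ⟨C * ((R 1)⁻¹ + 1) * D, by positivity, fun ζ hζ => (h ζ hζ).trans ?_⟩
  have e1 : ∀ n : ℕ, ((n : ℝ) + 1) ^ (N + e) * R (1 / ((n : ℝ) + 1)) / ((n : ℝ) + 1) ^ N *
      ‖ζ‖ ^ n = ((n : ℝ) + 1) ^ e * R (1 / ((n : ℝ) + 1)) * ‖ζ‖ ^ n := by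
    intro n
    have : ((n : ℝ) + 1) ≠ 0 := by positivity
    rw [pow_add]
    field_simp
  simp_rw [e1]
  obtain ⟨s, b⟩ := hb ‖ζ‖ (norm_nonneg ζ) hζ
  -- The term n = 0 is R(1), so the additive 1 from summation by parts is absorbed in the sum.
  have h1 : R 1 ≤ ∑' n : ℕ, ((n : ℝ) + 1) ^ e * R (1 / ((n : ℝ) + 1)) * ‖ζ‖ ^ n := by
    have := s.le_tsum 0 fun n _ => by
      have := hR.pos (1 / ((n : ℝ) + 1)) (by positivity) (by
        rw [div_le_one (by positivity)]; linarith [(n.cast_nonneg : (0 : ℝ) ≤ n)])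
      positivity
    simpa using this
  set T := ∑' n : ℕ, ((n : ℝ) + 1) ^ e * R (1 / ((n : ℝ) + 1)) * ‖ζ‖ ^ n
  have h2 : 1 ≤ (R 1)⁻¹ * T := by
    rw [inv_mul_eq_div, le_div_iff₀ hR1, one_mul]; exact h1
  calc C * (1 + T) ≤ C * ((R 1)⁻¹ * T + T) := by gcongr
    _ = C * ((R 1)⁻¹ + 1) * T := by ring
    _ ≤ C * ((R 1)⁻¹ + 1) * (D * (((1 - ‖ζ‖) ^ (e + 1))⁻¹ * R (1 - ‖ζ‖))) := by gcongr
    _ = _ := by ring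

/-! ### Taylor coefficients and the Bergman reproducing formula -/

theorem mem_disc {z : ℂ} : z ∈ disc ↔ ‖z‖ < 1 := by simp [disc]

theorem isOpen_disc : IsOpen disc := Metric.isOpen_ball

theorem IsAnalytic.hasSum {f : ℂ → ℂ} (hf : IsAnalytic f) {z : ℂ} (hz : z ∈ disc) :
    HasSum (fun n => coeff f n * z ^ n) (f z) := by
  have h := Complex.hasSum_taylorSeries_on_ball (c := 0) (r := 1) hf hz
  refine h.congr_fun fun n => ?_
  simp only [coeff, sub_zero, smul_eq_mul]
  ring

theorem hasFPowerSeriesAt_of_hasSum {f : ℂ → ℂ} {a : ℕ → ℂ}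
    (h : ∀ z ∈ disc, HasSum (fun n => a n * z ^ n) (f z)) :
    HasFPowerSeriesAt f (FormalMultilinearSeries.ofScalars ℂ a) 0 := by
  rw [hasFPowerSeriesAt_iff]
  filter_upwards [isOpen_disc.mem_nhds (show (0 : ℂ) ∈ disc by simp [disc])] with z hz
  simpa [mul_comm] using h z hz

theorem coeff_of_hasSum {f : ℂ → ℂ} {a : ℕ → ℂ}
    (h : ∀ z ∈ disc, HasSum (fun n => a n * z ^ n) (f z)) (n : ℕ) : coeff f n = a n := by
  have h1 := hasFPowerSeriesAt_of_hasSum h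
  have h2 := h1.analyticAt.hasFPowerSeriesAt
  have := congr_arg (FormalMultilinearSeries.coeff · n) (h2.eq_formalMultilinearSeries h1)
  simpa [coeff] using this

theorem isAnalytic_tsum {a : ℕ → ℂ}
    (h : ∀ r : ℝ, 0 ≤ r → r < 1 → Summable fun n => ‖a n‖ * r ^ n) :
    IsAnalytic fun z => ∑' n, a n * z ^ n := by
  intro z hz
  obtain ⟨r, hr, hr1⟩ := exists_between (mem_disc.1 hz)
  have h1 : DifferentiableOn ℂ (fun z => ∑' n, a n * z ^ n) (Metric.ball 0 r) := by
    refine Complex.differentiableOn_tsum_of_summable_norm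
      (h r ((norm_nonneg z).trans hr.le) hr1) (fun n => by fun_prop) Metric.isOpen_ball
      fun n w hw => ?_
    rw [norm_mul, norm_pow]
    have : ‖w‖ ≤ r := by simpa using (mem_ball_zero_iff.1 hw).le
    gcongr
  exact (h1.differentiableAt (Metric.isOpen_ball.mem_nhds
    (by simpa using hr))).differentiableWithinAt

theorem IsAnalytic.iteratedDeriv {f : ℂ → ℂ} (hf : IsAnalytic f) (k : ℕ) :
    IsAnalytic (iteratedDeriv k f) := by
  rw [iteratedDeriv_eq_iterate]
  exact ((DifferentiableOn.analyticOnNhd hf isOpen_disc).iterated_deriv k).differentiableOn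

theorem coeff_iteratedDeriv (f : ℂ → ℂ) (k n : ℕ) :
    coeff (iteratedDeriv k f) n = ((n + k).factorial / n.factorial : ℝ) * coeff f (n + k) := by
  have h : iteratedDeriv n (iteratedDeriv k f) = iteratedDeriv (n + k) f := by
    rw [iteratedDeriv_eq_iterate, iteratedDeriv_eq_iterate, iteratedDeriv_eq_iterate,
      Function.iterate_add_apply]
  rw [coeff, coeff, h]
  push_cast
  have h1 : ((n + k).factorial : ℂ) ≠ 0 := by exact_mod_cast (n + k).factorial_ne_zero
  field_simp

instance : IsFiniteMeasure areaMeasure := by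
  have : IsFiniteMeasure (volume.restrict disc) :=
    ⟨by rw [Measure.restrict_apply_univ]; exact measure_ball_lt_top⟩
  exact Measure.smul_finite _ ENNReal.ofReal_ne_top

theorem integral_areaMeasure_polar (f : ℂ → ℂ) :
    ∫ z, f z ∂areaMeasure = Real.pi⁻¹ • ∫ p in Ioo (0 : ℝ) 1 ×ˢ Ioo (-Real.pi) Real.pi,
      p.1 • f (circleMap 0 p.1 p.2) := by
  rw [areaMeasure, integral_smul_measure, ENNReal.toReal_ofReal (by positivity),
    ← integral_indicator isOpen_disc.measurableSet, ← Complex.integral_comp_polarCoord_symm]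
  congr 1
  have h1 : Ioo (0 : ℝ) 1 ×ˢ Ioo (-Real.pi) Real.pi =
      polarCoord.target ∩ (Iio (1 : ℝ) ×ˢ univ) := by
    ext p
    simp only [mem_prod, mem_Ioo, polarCoord, mem_inter_iff, mem_Ioi, mem_Iio, mem_univ]
    tauto
  rw [h1, ← setIntegral_indicator (measurableSet_Iio.prod MeasurableSet.univ)]
  refine setIntegral_congr_fun polarCoord.open_target.measurableSet fun p hp => ?_
  have hp0 : 0 < p.1 := hp.1
  simp only [polarCoord_symm_eq_circleMap]
  by_cases h : p.1 < 1
  · rw [indicator_of_mem, indicator_of_mem]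
    · exact ⟨h, mem_univ _⟩
    · simp [disc, abs_of_pos hp0, h]
  · rw [indicator_of_notMem, indicator_of_notMem, smul_zero]
    · exact fun h' => h h'.1
    · simpa [disc, abs_of_pos hp0] using not_lt.1 h

/-- On the circle the conjugate of z is r^2/z, so the average is a Cauchy integral for the n-th
Taylor coefficient. -/
theorem circleAverage_mul_conj_pow {G : ℂ → ℂ} (hG : IsAnalytic G) {r : ℝ} (hr : 0 < r)
    (hr1 : r < 1) (n : ℕ) :
    Real.circleAverage (fun z => G z * starRingEnd ℂ z ^ n) 0 r = (r ^ (2 * n) : ℝ) * coeff G n := by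
  have hd : DifferentiableOn ℂ G (Metric.closedBall 0 r) :=
    hG.mono (Metric.closedBall_subset_ball hr1)
  have h1 := hd.circleIntegral_one_div_sub_center_pow_smul hr n
  rw [Real.circleAverage_eq_circleIntegral hr.ne']
  have h2 : (∮ z in C(0, r), (z - 0)⁻¹ • (G z * starRingEnd ℂ z ^ n)) =
      ∮ z in C(0, r), ((r ^ (2 * n) : ℝ) : ℂ) • ((1 / (z - 0) ^ (n + 1)) • G z) := by
    refine circleIntegral.integral_congr hr.le fun z hz => ?_
    have hz' : ‖z‖ = r := by simpa using hz
    have hz0 : z ≠ 0 := by rw [← norm_pos_iff, hz']; exact hr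
    have h3 : starRingEnd ℂ z = (r ^ 2 : ℝ) / z := by
      rw [eq_div_iff hz0, mul_comm, Complex.mul_conj, Complex.normSq_eq_norm_sq, hz']
    simp only [smul_eq_mul, sub_zero]
    rw [h3, pow_mul, div_pow]
    push_cast
    field_simp
    ring
  rw [h2, circleIntegral.integral_smul, h1, coeff]
  have hpi : (Real.pi : ℂ) ≠ 0 := by exact_mod_cast Real.pi_ne_zero
  simp only [smul_eq_mul]
  have := Complex.I_ne_zero
  field_simp

/-- The moments `∫₀¹ 2 r ^ (2 n + 1) (1 - r ^ 2) ^ b dr`. -/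
noncomputable def betaMoment (b n : ℕ) : ℝ :=
  b.factorial / ∏ i ∈ Finset.range (b + 1), ((n : ℝ) + (1 + i))

theorem prod_range_add_pos (m n : ℕ) : 0 < ∏ i ∈ Finset.range m, ((n : ℝ) + (1 + i)) :=
  Finset.prod_pos fun i _ => by positivity

/-- Induction on b through (1 - r^2)^{b+1} = (1 - r^2)^b - r^2 (1 - r^2)^b, which expresses the
moment of order b + 1 as a difference of consecutive moments of order b. -/
theorem integral_eq_betaMoment (b n : ℕ) :
    ∫ r in Ioo (0 : ℝ) 1, 2 * r ^ (2 * n + 1) * (1 - r ^ 2) ^ b = betaMoment b n := by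
  have hI : ∀ b n : ℕ,
      IntegrableOn (fun r : ℝ => 2 * r ^ (2 * n + 1) * (1 - r ^ 2) ^ b) (Ioo 0 1) := fun b n =>
    ((Continuous.integrableOn_Icc (by fun_prop) (a := 0) (b := 1))).mono_set Ioo_subset_Icc_self
  induction b generalizing n with
  | zero =>
    simp only [pow_zero, mul_one, betaMoment, Nat.factorial_zero, Nat.cast_one, zero_add,
      Finset.range_one, Finset.prod_singleton, Nat.cast_zero, add_zero]
    rw [integral_const_mul, ← integral_Ioc_eq_integral_Ioo,
      ← intervalIntegral.integral_of_le zero_le_one, integral_pow]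
    push_cast
    field_simp
    ring
  | succ b ih =>
    have h1 : ∀ r : ℝ, 2 * r ^ (2 * n + 1) * (1 - r ^ 2) ^ (b + 1) =
        2 * r ^ (2 * n + 1) * (1 - r ^ 2) ^ b - 2 * r ^ (2 * (n + 1) + 1) * (1 - r ^ 2) ^ b := by
      intro r; ring
    simp_rw [h1]
    rw [integral_sub (hI b n) (hI b (n + 1)), ih, ih, betaMoment, betaMoment, betaMoment]
    have e0 := prod_range_add_pos (b + 1) n
    have e0' := prod_range_add_pos (b + 1) (n + 1)
    have e0'' := prod_range_add_pos (b + 2) n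
    have e1 : ∏ i ∈ Finset.range (b + 2), ((n : ℝ) + (1 + i)) =
        (∏ i ∈ Finset.range (b + 1), ((n : ℝ) + (1 + i))) * (n + b + 2) := by
      rw [Finset.prod_range_succ]; push_cast; ring
    have e2 : ∏ i ∈ Finset.range (b + 2), ((n : ℝ) + (1 + i)) =
        (∏ i ∈ Finset.range (b + 1), (((n + 1 : ℕ) : ℝ) + (1 + i))) * (n + 1) := by
      rw [Finset.prod_range_succ']
      push_cast
      congr 1
      · exact Finset.prod_congr rfl fun i _ => by ring
      · ring
    have p1 : (b.factorial : ℝ) / ∏ i ∈ Finset.range (b + 1), ((n : ℝ) + (1 + i)) =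
        b.factorial * (n + b + 2) / ∏ i ∈ Finset.range (b + 2), ((n : ℝ) + (1 + i)) := by
      rw [div_eq_div_iff e0.ne' e0''.ne', e1]; ring
    have p2 : (b.factorial : ℝ) / ∏ i ∈ Finset.range (b + 1), (((n + 1 : ℕ) : ℝ) + (1 + i)) =
        b.factorial * (n + 1) / ∏ i ∈ Finset.range (b + 2), ((n : ℝ) + (1 + i)) := by
      rw [div_eq_div_iff e0'.ne' e0''.ne', e2]; ring
    rw [p1, p2, ← sub_div, Nat.factorial_succ]
    push_cast
    congr 1
    ring

theorem one_sub_sq_pow_le {r : ℝ} (hr : 0 ≤ r) (hr1 : r ≤ 1) (b : ℕ) :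
    (1 - r ^ 2) ^ b ≤ 2 ^ b * (1 - r) ^ b := by
  rw [← mul_pow]
  refine pow_le_pow_left₀ (by nlinarith) (by nlinarith) b

/-- Integration over circles isolates the n-th coefficient of G, and the radial integral is
`betaMoment b n`. The growth bound on G makes the integrand bounded, so that Fubini applies. -/
theorem integral_mul_conj_pow {G : ℂ → ℂ} (hG : IsAnalytic G) {b : ℕ} {M : ℝ}
    (hM : ∀ w ∈ disc, ‖G w‖ * (1 - ‖w‖) ^ b ≤ M) (n : ℕ) :
    ∫ w, G w * starRingEnd ℂ w ^ n * ((1 - ‖w‖ ^ 2) ^ b : ℝ) ∂areaMeasure =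
      betaMoment b n * coeff G n := by
  have hmem : ∀ p ∈ Ioo (0 : ℝ) 1 ×ˢ Ioo (-Real.pi) Real.pi, circleMap 0 p.1 p.2 ∈ disc := by
    rintro p ⟨hp, -⟩
    rw [mem_disc]
    simpa [abs_of_pos hp.1] using hp.2
  have hint : IntegrableOn (fun p : ℝ × ℝ => p.1 • (G (circleMap 0 p.1 p.2) *
      starRingEnd ℂ (circleMap 0 p.1 p.2) ^ n * ((1 - ‖circleMap 0 p.1 p.2‖ ^ 2) ^ b : ℝ)))
      (Ioo (0 : ℝ) 1 ×ˢ Ioo (-Real.pi) Real.pi) (volume.prod volume) := by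
    have hms : MeasurableSet (Ioo (0 : ℝ) 1 ×ˢ Ioo (-Real.pi) Real.pi) :=
      measurableSet_Ioo.prod measurableSet_Ioo
    refine IntegrableOn.of_bound ?_ ?_ (2 ^ b * M) ?_
    · rw [Measure.prod_prod]
      exact ENNReal.mul_lt_top measure_Ioo_lt_top measure_Ioo_lt_top
    · refine ContinuousOn.aestronglyMeasurable ?_ hms
      have hc : Continuous fun p : ℝ × ℝ => circleMap 0 p.1 p.2 := by
        unfold circleMap; fun_prop
      have h1 : ContinuousOn (fun p : ℝ × ℝ => G (circleMap 0 p.1 p.2))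
          (Ioo (0 : ℝ) 1 ×ˢ Ioo (-Real.pi) Real.pi) :=
        (DifferentiableOn.continuousOn hG).comp hc.continuousOn hmem
      have hc2 : Continuous fun p : ℝ × ℝ => starRingEnd ℂ (circleMap 0 p.1 p.2) :=
        Complex.continuous_conj.comp hc
      have hc3 : Continuous fun p : ℝ × ℝ =>
          (((1 - ‖circleMap 0 p.1 p.2‖ ^ 2) ^ b : ℝ) : ℂ) := by fun_prop
      exact continuous_fst.continuousOn.smul
        ((h1.mul (hc2.pow n).continuousOn).mul hc3.continuousOn)
    · filter_upwards [ae_restrict_mem hms] with p hp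
      have hz := hmem p hp
      have hz1 := mem_disc.1 hz
      set z := circleMap 0 p.1 p.2
      have h0 := norm_nonneg z
      have h1 : 0 ≤ 1 - ‖z‖ ^ 2 := by nlinarith
      rw [norm_smul, norm_mul, norm_mul, norm_pow, RCLike.norm_conj, Complex.norm_real,
        Real.norm_of_nonneg hp.1.1.le, Real.norm_of_nonneg (by positivity)]
      calc p.1 * (‖G z‖ * ‖z‖ ^ n * (1 - ‖z‖ ^ 2) ^ b)
          ≤ 1 * (‖G z‖ * 1 * (2 ^ b * (1 - ‖z‖) ^ b)) := by
            gcongr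
            · exact hp.1.2.le
            · exact pow_le_one₀ h0 hz1.le
            · exact one_sub_sq_pow_le h0 hz1.le b
        _ = 2 ^ b * (‖G z‖ * (1 - ‖z‖) ^ b) := by ring
        _ ≤ 2 ^ b * M := by gcongr; exact hM z hz
  rw [integral_areaMeasure_polar, Measure.volume_eq_prod, setIntegral_prod _ hint]
  have key : ∀ r ∈ Ioo (0 : ℝ) 1, ∫ θ in Ioo (-Real.pi) Real.pi, r • (G (circleMap 0 r θ) *
      starRingEnd ℂ (circleMap 0 r θ) ^ n * ((1 - ‖circleMap 0 r θ‖ ^ 2) ^ b : ℝ)) =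
      ((2 * r ^ (2 * n + 1) * (1 - r ^ 2) ^ b : ℝ) : ℂ) * (Real.pi * coeff G n) := by
    intro r hr
    have h1 := circleAverage_mul_conj_pow hG hr.1 hr.2 n
    rw [circleAverage_eq_setIntegral, Complex.real_smul] at h1
    have h2 : ∫ θ in Ioo (-Real.pi) Real.pi, G (circleMap 0 r θ) *
        starRingEnd ℂ (circleMap 0 r θ) ^ n =
        (2 * Real.pi : ℝ) * ((r ^ (2 * n) : ℝ) * coeff G n) := by
      rw [← h1, ← mul_assoc, ← Complex.ofReal_mul, mul_inv_cancel₀ (by positivity),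
        Complex.ofReal_one, one_mul]
    have e1 : ∀ θ : ℝ, ‖circleMap 0 r θ‖ = r := fun θ => by simp [abs_of_pos hr.1]
    simp_rw [e1]
    rw [integral_smul, integral_mul_const, h2, Complex.real_smul]
    push_cast
    ring
  simp only
  rw [setIntegral_congr_fun measurableSet_Ioo key, integral_mul_const, integral_complex_ofReal,
    integral_eq_betaMoment, Complex.real_smul]
  have hpi : (Real.pi : ℂ) ≠ 0 := by exact_mod_cast Real.pi_ne_zero
  push_cast
  field_simp

theorem IsAnalytic.aestronglyMeasurable {G : ℂ → ℂ} (hG : IsAnalytic G) :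
    AEStronglyMeasurable G areaMeasure := by
  have h := (DifferentiableOn.continuousOn hG).aestronglyMeasurable (μ := volume)
    isOpen_disc.measurableSet
  exact h.mono_ac (Measure.smul_absolutelyContinuous)

/-- This turns a coefficient multiplier into an integral operator with kernel Σ S(n) (z w̄)^n, by
integrating term by term. The factor w̄^j lets the operator discard the first j coefficients of G.
-/
theorem tsum_mul_coeff_eq_integral {G : ℂ → ℂ} (hG : IsAnalytic G) {b : ℕ} {M : ℝ}
    (hM : ∀ w ∈ disc, ‖G w‖ * (1 - ‖w‖) ^ b ≤ M) (j : ℕ) {S : ℕ → ℝ}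
    (hS : ∀ r : ℝ, 0 ≤ r → r < 1 → Summable fun n => |S n| * r ^ n) {z : ℂ} (hz : z ∈ disc) :
    ∑' n, (S n * betaMoment b (n + j) : ℝ) * coeff G (n + j) * z ^ n =
      ∫ w, G w * starRingEnd ℂ w ^ j * ((1 - ‖w‖ ^ 2) ^ b : ℝ) *
        ∑' n, (S n : ℂ) * (z * starRingEnd ℂ w) ^ n ∂areaMeasure := by
  have hz1 := mem_disc.1 hz
  set F : ℕ → ℂ → ℂ := fun n w => (S n : ℂ) * z ^ n *
    (G w * starRingEnd ℂ w ^ (n + j) * ((1 - ‖w‖ ^ 2) ^ b : ℝ)) with hF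
  have hbound : ∀ n, ∀ w ∈ disc, ‖F n w‖ ≤ |S n| * ‖z‖ ^ n * (2 ^ b * M) := by
    intro n w hw
    have hw1 := mem_disc.1 hw
    have h0 := norm_nonneg w
    have h1 : 0 ≤ 1 - ‖w‖ ^ 2 := by nlinarith
    rw [hF]
    simp only
    rw [norm_mul, norm_mul, norm_mul, norm_mul, norm_pow, norm_pow, RCLike.norm_conj,
      Complex.norm_real, Complex.norm_real, Real.norm_eq_abs, Real.norm_of_nonneg (by positivity)]
    refine mul_le_mul_of_nonneg_left ?_ (by positivity)
    calc ‖G w‖ * ‖w‖ ^ (n + j) * (1 - ‖w‖ ^ 2) ^ b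
        ≤ ‖G w‖ * 1 * (2 ^ b * (1 - ‖w‖) ^ b) := by
          gcongr
          · exact pow_le_one₀ h0 hw1.le
          · exact one_sub_sq_pow_le h0 hw1.le b
      _ = 2 ^ b * (‖G w‖ * (1 - ‖w‖) ^ b) := by ring
      _ ≤ 2 ^ b * M := by gcongr; exact hM w hw
  have hint : ∀ n, Integrable (F n) areaMeasure := by
    intro n
    refine Integrable.of_bound ?_ (|S n| * ‖z‖ ^ n * (2 ^ b * M))
      (ae_areaMeasure_mem.mono (hbound n))
    have h1 := hG.aestronglyMeasurable
    have h2 : Continuous fun w : ℂ => starRingEnd ℂ w ^ (n + j) *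
        ((1 - ‖w‖ ^ 2) ^ b : ℝ) := by
      have := Complex.continuous_conj
      fun_prop
    have h3 := (h1.mul h2.aestronglyMeasurable).const_mul ((S n : ℂ) * z ^ n)
    refine h3.congr (Filter.Eventually.of_forall fun w => ?_)
    simp only [hF, Pi.mul_apply]
    ring
  have hsum : Summable fun n => ∫ w, ‖F n w‖ ∂areaMeasure := by
    refine Summable.of_nonneg_of_le (fun n => integral_nonneg fun _ => norm_nonneg _) (fun n => ?_)
      ((hS ‖z‖ (norm_nonneg z) hz1).mul_right (2 ^ b * M * areaMeasure.real univ))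
    have := integral_mono_ae (hint n).norm (integrable_const _)
      (ae_areaMeasure_mem.mono (hbound n))
    refine this.trans (le_of_eq ?_)
    rw [integral_const, smul_eq_mul]
    ring
  have h := (hasSum_integral_of_summable_integral_norm hint hsum).tsum_eq
  have e1 : ∀ w, ∑' n, F n w = G w * starRingEnd ℂ w ^ j * ((1 - ‖w‖ ^ 2) ^ b : ℝ) *
      ∑' n, (S n : ℂ) * (z * starRingEnd ℂ w) ^ n := by
    intro w
    rw [← tsum_mul_left]
    congr 1 with n
    simp only [hF]
    ring
  simp_rw [e1] at h
  rw [← h]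
  congr 1 with n
  simp only [hF]
  rw [integral_const_mul, integral_mul_conj_pow hG hM]
  push_cast
  ring

/-! ### Integral operators between weighted spaces -/

theorem one_sub_norm_le_norm_one_sub (ζ : ℂ) : 1 - ‖ζ‖ ≤ ‖1 - ζ‖ := by
  have := norm_sub_norm_le 1 ζ
  rwa [norm_one] at this

/-- Puts the kernel bound into the shape required by `forelli_rudin`: of the power |1 - ζ|^{Nq} in
the denominator two factors are kept, and the surplus is estimated by |1 - ζ| ≥ 1 - |ζ|. This is
where Nq ≥ 2 enters. -/
theorem SymbolClass.norm_kernel_rpow_le {R : ℝ → ℝ} {r r' q : ℝ} (hR : PowerType R r r')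
    {N e : ℕ} (he : r' ≤ e) (hq : 0 < q) (hNq : 2 ≤ N * q) {S : ℕ → ℝ}
    (hS : SymbolClass N (fun n => ((n : ℝ) + 1) ^ (N + e) * R (1 / ((n : ℝ) + 1))) S) :
    ∃ C, 0 < C ∧ ∀ ζ : ℂ, ‖ζ‖ < 1 → ‖∑' n, (S n : ℂ) * ζ ^ n‖ ^ q ≤
      C * ((1 - ‖ζ‖) * ((1 - ‖ζ‖) ^ (1 - ((N + e : ℕ) + 1) * q) * R (1 - ‖ζ‖) ^ q) *
        (1 / ‖1 - ζ‖ ^ 2)) := by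
  obtain ⟨C, hC, h⟩ := hS.norm_kernel_le hR he
  refine ⟨C ^ q, by positivity, fun ζ hζ => ?_⟩
  have h1 := h ζ hζ
  have hd := one_sub_norm_le_norm_one_sub ζ
  have hτ : 0 < 1 - ‖ζ‖ := by linarith
  have hR0 := hR.pos (1 - ‖ζ‖) hτ (by linarith [norm_nonneg ζ])
  set τ := 1 - ‖ζ‖
  set D := ‖1 - ζ‖
  set k := ‖∑' n, (S n : ℂ) * ζ ^ n‖ with hk
  have hk0 : 0 ≤ k := norm_nonneg _
  have hD : 0 < D := hτ.trans_le hd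
  have h2 := Real.rpow_le_rpow (by positivity) h1 hq.le
  rw [Real.mul_rpow (by positivity) hk0, Real.mul_rpow hC.le (by positivity),
    Real.mul_rpow (by positivity) hR0.le] at h2
  have e1 : (D ^ N) ^ q = D ^ (N * q) := by rw [← Real.rpow_natCast, ← Real.rpow_mul hD.le]
  have e2 : ((τ ^ (e + 1))⁻¹) ^ q = τ ^ (-((e + 1) * q)) := by
    rw [← Real.rpow_natCast, ← Real.rpow_neg hτ.le, ← Real.rpow_mul hτ.le]
    push_cast
    ring_nf
  rw [e1, e2] at h2
  have h3 : τ ^ (N * q - 2) ≤ D ^ (N * q - 2) := Real.rpow_le_rpow hτ.le hd (by linarith)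
  have e3 : D ^ (N * q) = D ^ (N * q - 2) * D ^ 2 := by
    rw [← Real.rpow_natCast D 2, ← Real.rpow_add hD]; norm_num
  have hDp : 0 < D ^ (N * q - 2) := by positivity
  have e4 : τ * (τ ^ (1 - (((N + e : ℕ) : ℝ) + 1) * q) * R τ ^ q) * τ ^ (N * q - 2) =
      τ ^ (-((e + 1) * q)) * R τ ^ q := by
    have : τ * τ ^ (1 - (((N + e : ℕ) : ℝ) + 1) * q) * τ ^ (N * q - 2) =
        τ ^ (-((e + 1) * q)) := by
      nth_rewrite 1 [← Real.rpow_one τ]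
      rw [← Real.rpow_add hτ, ← Real.rpow_add hτ]
      push_cast
      ring_nf
    rw [← this]; ring
  rw [mul_one_div, ← mul_div_assoc, le_div_iff₀ (by positivity)]
  rw [e3, ← e4] at h2
  set X := τ * (τ ^ (1 - (((N + e : ℕ) : ℝ) + 1) * q) * R τ ^ q) with hX
  have hX0 : 0 < X := by positivity
  refine le_of_mul_le_mul_left ?_ hDp
  calc D ^ (N * q - 2) * (k ^ q * D ^ 2) = D ^ (N * q - 2) * D ^ 2 * k ^ q := by ring
    _ ≤ C ^ q * (X * τ ^ (N * q - 2)) := h2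
    _ ≤ C ^ q * (X * D ^ (N * q - 2)) := by gcongr
    _ = _ := by ring

theorem lintegral_lintegral_mul_le {g v : ℂ → ENNReal} {k : ℂ → ℂ → ENNReal}
    (hg : AEMeasurable g areaMeasure) (hk : Measurable (Function.uncurry k))
    (h : ∀ w ∈ disc, ∫⁻ z, k z w ∂areaMeasure ≤ v w) :
    ∫⁻ z, ∫⁻ w, g w * k z w ∂areaMeasure ∂areaMeasure ≤ ∫⁻ w, g w * v w ∂areaMeasure := by
  rw [lintegral_lintegral_swap]
  · refine lintegral_mono_ae (ae_areaMeasure_mem.mono fun w hw => ?_)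
    have : Measurable fun z => k z w := hk.comp (measurable_id.prodMk measurable_const)
    rw [lintegral_const_mul _ this]
    gcongr
    exact h w hw
  · exact (hg.comp_snd).mul hk.aemeasurable

theorem norm_one_sub_mul_conj_comm (z w : ℂ) :
    ‖1 - z * starRingEnd ℂ w‖ = ‖1 - w * starRingEnd ℂ z‖ := by
  rw [← RCLike.norm_conj (1 - z * starRingEnd ℂ w)]
  simp [mul_comm]

/-- For fixed z the function w ↦ G(w) K(z̄ w) is analytic, so `lintegral_norm_le_of_le_one` moves
the power p inside the integral. Tonelli's theorem and `forelli_rudin` in the variable z then give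
the estimate. The symmetry of K under conjugation replaces |K(z w̄)| by |K(z̄ w)|. -/
theorem lintegral_operator_le_of_le_one {A B : ℝ → ℝ} {a₁ a₂ b₁ b₂ p : ℝ} {b : ℕ}
    (hA : PowerType A a₁ a₂) (hB : PowerType B b₁ b₂) (hp : 0 < p) (hp1 : p ≤ 1)
    (hb₁ : 1 < b₁ * p) (hb : a₂ ≤ b) {K : ℂ → ℂ} (hKa : IsAnalytic K)
    (hKc : ∀ ζ, ‖K (starRingEnd ℂ ζ)‖ = ‖K ζ‖)
    (hK : ∃ C, 0 < C ∧ ∀ ζ : ℂ, ‖ζ‖ < 1 → ‖K ζ‖ ^ p ≤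
      C * ((1 - ‖ζ‖) * ((1 - ‖ζ‖) ^ (1 - ((b : ℝ) + 2) * p) *
        (A (1 - ‖ζ‖) * (B (1 - ‖ζ‖))⁻¹) ^ p) * (1 / ‖1 - ζ‖ ^ 2))) :
    ∃ C, 0 < C ∧ ∀ G : ℂ → ℂ, IsAnalytic G → ∀ u : ℂ → ℂ,
      (∀ z ∈ disc, ENNReal.ofReal ‖u z‖ ≤ ∫⁻ w, ENNReal.ofReal
        (‖G w‖ * ‖K (z * starRingEnd ℂ w)‖ * (1 - ‖w‖) ^ b) ∂areaMeasure) →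
      ∫⁻ z, ENNReal.ofReal (‖u z‖ ^ p * (B (1 - ‖z‖) ^ p * (1 - ‖z‖) ^ (-2 : ℝ))) ∂areaMeasure ≤
        ENNReal.ofReal C * ∫⁻ w, ENNReal.ofReal
          (‖G w‖ ^ p * (A (1 - ‖w‖) ^ p * (1 - ‖w‖) ^ (-2 : ℝ))) ∂areaMeasure := by
  obtain ⟨C₁, hC₁, hK⟩ := hK
  obtain ⟨C₂, hC₂, hS⟩ := lintegral_norm_le_of_le_one (b := b) hp hp1
  have hE : PowerType (fun t => B t ^ p * t ^ (-2 : ℝ)) _ _ := (hB.rpow hp.le).mul (.rpow_id _)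
  have hR : PowerType (fun t => (A t * (B t)⁻¹) ^ p) _ _ := (hA.mul hB.inv).rpow hp.le
  have hQ : PowerType (fun t => t ^ (1 - ((b : ℝ) + 2) * p) * (A t * (B t)⁻¹) ^ p) _ _ :=
    PowerType.mul (.rpow_id (1 - ((b : ℝ) + 2) * p)) hR
  have hEQ : PowerType (fun t => B t ^ p * t ^ (-2 : ℝ) *
      (t ^ (1 - ((b : ℝ) + 2) * p) * (A t * (B t)⁻¹) ^ p))
      (-1 - ((b : ℝ) + 2) * p + a₁ * p) (-1 - ((b : ℝ) + 2) * p + a₂ * p) := by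
    refine (PowerType.mul (.rpow_id (-1 - ((b : ℝ) + 2) * p)) (hA.rpow hp.le)).congr
      (hE.mul hQ).measurable fun t h0 h1 => ?_
    have hAt := hA.pos t h0 h1
    have hBt := hB.pos t h0 h1
    rw [Real.mul_rpow hAt.le (inv_pos.2 hBt).le, Real.inv_rpow hBt.le,
      show -1 - ((b : ℝ) + 2) * p = -2 + (1 - ((b : ℝ) + 2) * p) by ring, Real.rpow_add h0]
    have : 0 < B t ^ p := by positivity
    field_simp
  -- The lower exponent b₁p - 2 exceeds -1 because b₁p > 1. The upper exponent -1 - (b+2)p + a₂p is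
  -- below -1 because a₂ ≤ b.
  obtain ⟨C₃, hC₃, hFR⟩ := forelli_rudin hE hQ hEQ (by linarith) (by nlinarith)
  refine ⟨C₂ * C₁ * C₃, by positivity, fun G hG u hu => ?_⟩
  set g : ℂ → ENNReal := fun w =>
    ENNReal.ofReal (‖G w‖ ^ p * (1 - ‖w‖) ^ (((b : ℝ) + 2) * p - 2)) with hg
  set k : ℂ → ℂ → ENNReal := fun z w => ENNReal.ofReal
    ((B (1 - ‖z‖) ^ p * (1 - ‖z‖) ^ (-2 : ℝ)) * ((1 - ‖z‖ * ‖w‖) *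
      ((1 - ‖z‖ * ‖w‖) ^ (1 - ((b : ℝ) + 2) * p) *
        (A (1 - ‖z‖ * ‖w‖) * (B (1 - ‖z‖ * ‖w‖))⁻¹) ^ p) *
      (1 / ‖1 - z * starRingEnd ℂ w‖ ^ 2))) with hk
  have hpt : ∀ z ∈ disc, ENNReal.ofReal
      (‖u z‖ ^ p * (B (1 - ‖z‖) ^ p * (1 - ‖z‖) ^ (-2 : ℝ))) ≤
      ENNReal.ofReal (C₂ * C₁) * ∫⁻ w, g w * k z w ∂areaMeasure := by
    intro z hz
    have hz1 := mem_disc.1 hz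
    have hEz := hE.pos (1 - ‖z‖) (by linarith) (by linarith [norm_nonneg z])
    have hΦ : IsAnalytic fun w => G w * K (starRingEnd ℂ z * w) := by
      refine DifferentiableOn.mul hG (DifferentiableOn.comp hKa (by fun_prop) fun w hw => ?_)
      rw [mem_disc] at hw ⊢
      rw [norm_mul, RCLike.norm_conj]
      nlinarith [norm_nonneg z, norm_nonneg w]
    have h1 := hS _ hΦ
    have e1 : ∀ w, ‖K (starRingEnd ℂ z * w)‖ = ‖K (z * starRingEnd ℂ w)‖ := fun w => by
      rw [← hKc]; simp
    simp_rw [norm_mul, e1, Real.rpow_natCast] at h1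
    have h2 : ENNReal.ofReal (‖u z‖ ^ p) ≤ ENNReal.ofReal C₂ * ∫⁻ w, ENNReal.ofReal
        ((‖G w‖ * ‖K (z * starRingEnd ℂ w)‖) ^ p *
          (1 - ‖w‖) ^ (((b : ℝ) + 2) * p - 2)) ∂areaMeasure := by
      rw [← ENNReal.ofReal_rpow_of_nonneg (norm_nonneg _) hp.le]
      exact (ENNReal.rpow_le_rpow (hu z hz) hp.le).trans h1
    rw [mul_comm, ENNReal.ofReal_mul hEz.le]
    calc ENNReal.ofReal (B (1 - ‖z‖) ^ p * (1 - ‖z‖) ^ (-2 : ℝ)) * ENNReal.ofReal (‖u z‖ ^ p)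
        ≤ ENNReal.ofReal (B (1 - ‖z‖) ^ p * (1 - ‖z‖) ^ (-2 : ℝ)) *
          (ENNReal.ofReal C₂ * ∫⁻ w, ENNReal.ofReal
        ((‖G w‖ * ‖K (z * starRingEnd ℂ w)‖) ^ p *
          (1 - ‖w‖) ^ (((b : ℝ) + 2) * p - 2)) ∂areaMeasure) := by gcongr
      _ = ENNReal.ofReal C₂ * ∫⁻ w, ENNReal.ofReal (B (1 - ‖z‖) ^ p * (1 - ‖z‖) ^ (-2 : ℝ)) *
          ENNReal.ofReal ((‖G w‖ * ‖K (z * starRingEnd ℂ w)‖) ^ p *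
          (1 - ‖w‖) ^ (((b : ℝ) + 2) * p - 2)) ∂areaMeasure := by
        rw [lintegral_const_mul' _ _ ENNReal.ofReal_ne_top]; ring
      _ ≤ ENNReal.ofReal C₂ * ∫⁻ w, ENNReal.ofReal C₁ * (g w * k z w) ∂areaMeasure := by
        gcongr 1
        refine lintegral_mono_ae (ae_areaMeasure_mem.mono fun w hw => ?_)
        have hw1 := mem_disc.1 hw
        have hzw : ‖z * starRingEnd ℂ w‖ < 1 := by
          rw [norm_mul, RCLike.norm_conj]
          nlinarith [norm_nonneg z, norm_nonneg w]
        have h3 := hK _ hzw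
        rw [norm_mul, RCLike.norm_conj] at h3
        have hx : 0 < 1 - ‖w‖ := by linarith
        simp only [hg, hk]
        rw [← ENNReal.ofReal_mul hEz.le, ← ENNReal.ofReal_mul (by positivity),
          ← ENNReal.ofReal_mul hC₁.le, Real.mul_rpow (norm_nonneg _) (norm_nonneg _)]
        apply ENNReal.ofReal_le_ofReal
        refine (le_of_eq ?_).trans ((mul_le_mul_of_nonneg_left h3
          (show 0 ≤ (B (1 - ‖z‖) ^ p * (1 - ‖z‖) ^ (-2 : ℝ)) *
            (‖G w‖ ^ p * (1 - ‖w‖) ^ (((b : ℝ) + 2) * p - 2)) by positivity)).trans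
          (le_of_eq ?_)) <;> ring
      _ = _ := by
        rw [lintegral_const_mul' _ _ ENNReal.ofReal_ne_top, ← mul_assoc,
          ← ENNReal.ofReal_mul hC₂.le]
  have hgm : AEMeasurable g areaMeasure := by
    have := hG.aestronglyMeasurable.aemeasurable
    fun_prop
  have hkm : Measurable (Function.uncurry k) := by
    have := hA.measurable
    have := hB.measurable
    simp only [hk, Function.uncurry_def]
    fun_prop
  calc _ ≤ ∫⁻ z, ENNReal.ofReal (C₂ * C₁) * ∫⁻ w, g w * k z w ∂areaMeasure ∂areaMeasure :=
        lintegral_mono_ae (ae_areaMeasure_mem.mono hpt)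
    _ = ENNReal.ofReal (C₂ * C₁) * ∫⁻ z, ∫⁻ w, g w * k z w ∂areaMeasure ∂areaMeasure :=
        lintegral_const_mul' _ _ ENNReal.ofReal_ne_top
    _ ≤ ENNReal.ofReal (C₂ * C₁) * ∫⁻ w, g w * _ ∂areaMeasure := by
        gcongr 1
        exact lintegral_lintegral_mul_le hgm hkm hFR
    _ = ENNReal.ofReal (C₂ * C₁) * ∫⁻ w, ENNReal.ofReal C₃ * ENNReal.ofReal
          (‖G w‖ ^ p * (A (1 - ‖w‖) ^ p * (1 - ‖w‖) ^ (-2 : ℝ))) ∂areaMeasure := by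
        congr 1
        refine lintegral_congr_ae (ae_areaMeasure_mem.mono fun w hw => ?_)
        have hw1 := mem_disc.1 hw
        have hx : 0 < 1 - ‖w‖ := by linarith
        have hx1 : 1 - ‖w‖ ≤ 1 := by linarith [norm_nonneg w]
        have hAt := hA.pos _ hx hx1
        have hBt := hB.pos _ hx hx1
        simp only [hg]
        rw [← ENNReal.ofReal_mul (by positivity), ← ENNReal.ofReal_mul hC₃.le]
        congr 1
        set x := 1 - ‖w‖
        rw [Real.mul_rpow hAt.le (inv_pos.2 hBt).le, Real.inv_rpow hBt.le]
        have h6 : B x ^ p * (B x ^ p)⁻¹ = 1 := mul_inv_cancel₀ (by positivity)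
        have h9 : x ^ (((b : ℝ) + 2) * p - 2) * x ^ (1 - ((b : ℝ) + 2) * p) * x = 1 := by
          nth_rewrite 3 [← Real.rpow_one x]
          rw [← Real.rpow_add hx, ← Real.rpow_add hx]
          ring_nf
          exact Real.rpow_zero x
        linear_combination (‖G w‖ ^ p * C₃ * A x ^ p * x ^ (-2 : ℝ)) *
          ((x ^ (((b : ℝ) + 2) * p - 2) * x ^ (1 - ((b : ℝ) + 2) * p) * x) * h6 + h9)
    _ = _ := by
        rw [lintegral_const_mul' _ _ ENNReal.ofReal_ne_top, ← mul_assoc,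
          ← ENNReal.ofReal_mul (by positivity)]

/-- Hölder's inequality in the form used for Schur tests. -/
theorem lintegral_mul_rpow_le {α : Type*} [MeasurableSpace α] {ν : Measure α} {f D k : α → ℝ}
    {p : ℝ} (hp : 1 ≤ p) (hf : AEMeasurable f ν) (hD : AEMeasurable D ν) (hk : AEMeasurable k ν)
    (h : ∀ᵐ z ∂ν, 0 ≤ f z ∧ 0 < D z ∧ 0 < k z) :
    (∫⁻ z, ENNReal.ofReal (f z * k z) ∂ν) ^ p ≤
      (∫⁻ z, ENNReal.ofReal (f z ^ p * D z ^ (1 - p) * k z) ∂ν) *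
        (∫⁻ z, ENNReal.ofReal (D z * k z) ∂ν) ^ (p - 1) := by
  have hp0 : 0 < p := by linarith
  have h1 := ENNReal.lintegral_mul_norm_pow_le (μ := ν)
    (f := fun z => ENNReal.ofReal (f z ^ p * D z ^ (1 - p) * k z))
    (g := fun z => ENNReal.ofReal (D z * k z)) (by fun_prop) (by fun_prop)
    (p := 1 / p) (q := 1 - 1 / p) (by positivity)
    (by rw [sub_nonneg, div_le_one hp0]; exact hp) (by ring)
  have h2 : ∫⁻ z, ENNReal.ofReal (f z * k z) ∂ν = ∫⁻ z,
      ENNReal.ofReal (f z ^ p * D z ^ (1 - p) * k z) ^ (1 / p) *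
        ENNReal.ofReal (D z * k z) ^ (1 - 1 / p) ∂ν := by
    refine lintegral_congr_ae (h.mono fun z ⟨hf0, hD0, hk0⟩ => ?_)
    have hq : 0 ≤ 1 - 1 / p := by rw [sub_nonneg, div_le_one hp0]; exact hp
    simp only
    rw [ENNReal.ofReal_rpow_of_nonneg (by positivity) (by positivity),
      ENNReal.ofReal_rpow_of_nonneg (by positivity) hq, ← ENNReal.ofReal_mul (by positivity),
      Real.mul_rpow (by positivity) hk0.le, Real.mul_rpow (by positivity) (by positivity),
      Real.mul_rpow hD0.le hk0.le, ← Real.rpow_mul hf0, ← Real.rpow_mul hD0.le,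
      mul_one_div_cancel hp0.ne', Real.rpow_one]
    congr 1
    have e1 : D z ^ ((1 - p) * (1 / p)) * D z ^ (1 - 1 / p) = 1 := by
      rw [← Real.rpow_add hD0]
      have : (1 - p) * (1 / p) + (1 - 1 / p) = 0 := by field_simp; ring
      rw [this, Real.rpow_zero]
    have e2 : k z ^ (1 / p) * k z ^ (1 - 1 / p) = k z := by
      rw [← Real.rpow_add hk0]; simp
    linear_combination (-(f z * (D z ^ ((1 - p) * (1 / p)) * D z ^ (1 - 1 / p)))) * e2 -
      f z * k z * e1
  rw [h2]
  refine (ENNReal.rpow_le_rpow h1 hp0.le).trans (le_of_eq ?_)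
  rw [ENNReal.mul_rpow_of_nonneg _ _ hp0.le, ← ENNReal.rpow_mul, ← ENNReal.rpow_mul,
    one_div_mul_cancel hp0.ne', ENNReal.rpow_one]
  congr 2
  field_simp

/-- Schur test with the auxiliary function t^{1/p}/A(t). `forelli_rudin` is used twice: in w, to
bound the second Hölder factor by t^{1/p}/B(t) with t = 1 - |z|, and in z, after Tonelli, to recover
the weight A^p t^{-2} in w. -/
theorem lintegral_operator_le_of_one_le {A B : ℝ → ℝ} {a₁ a₂ b₁ b₂ p : ℝ} {b : ℕ}
    (hA : PowerType A a₁ a₂) (hB : PowerType B b₁ b₂) (hp : 1 ≤ p)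
    (hb₁ : 1 < b₁ * p) (hb : a₂ ≤ b) {K : ℂ → ℂ}
    (hK : ∃ C, 0 < C ∧ ∀ ζ : ℂ, ‖ζ‖ < 1 → ‖K ζ‖ ≤
      C * ((1 - ‖ζ‖) * ((1 - ‖ζ‖) ^ (1 - ((b : ℝ) + 2)) *
        (A (1 - ‖ζ‖) * (B (1 - ‖ζ‖))⁻¹)) * (1 / ‖1 - ζ‖ ^ 2))) :
    ∃ C, 0 < C ∧ ∀ G : ℂ → ℂ, IsAnalytic G → ∀ u : ℂ → ℂ,
      (∀ z ∈ disc, ENNReal.ofReal ‖u z‖ ≤ ∫⁻ w, ENNReal.ofReal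
        (‖G w‖ * ‖K (z * starRingEnd ℂ w)‖ * (1 - ‖w‖) ^ b) ∂areaMeasure) →
      ∫⁻ z, ENNReal.ofReal (‖u z‖ ^ p * (B (1 - ‖z‖) ^ p * (1 - ‖z‖) ^ (-2 : ℝ))) ∂areaMeasure ≤
        ENNReal.ofReal C * ∫⁻ w, ENNReal.ofReal
          (‖G w‖ ^ p * (A (1 - ‖w‖) ^ p * (1 - ‖w‖) ^ (-2 : ℝ))) ∂areaMeasure := by
  have hp0 : 0 < p := by linarith
  obtain ⟨C₁, hC₁, hK⟩ := hK
  have hb₁' : 1 / p < b₁ := by rwa [div_lt_iff₀ hp0]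
  have hip : 0 < 1 / p := by positivity
  -- the auxiliary function in the Schur test
  set D : ℝ → ℝ := fun t => t ^ (1 / p) * (A t)⁻¹ with hDdef
  have hD : PowerType D _ _ := (PowerType.rpow_id (1 / p)).mul hA.inv
  have hQ : PowerType (fun t => t ^ (1 - ((b : ℝ) + 2)) * (A t * (B t)⁻¹)) _ _ :=
    PowerType.mul (.rpow_id (1 - ((b : ℝ) + 2))) (hA.mul hB.inv)
  have hE₁ : PowerType (fun t => D t * t ^ (b : ℝ)) _ _ := hD.mul (.rpow_id _)
  have hEQ₁ : PowerType (fun t => D t * t ^ (b : ℝ) *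
      (t ^ (1 - ((b : ℝ) + 2)) * (A t * (B t)⁻¹))) (1 / p - 1 + -b₂) (1 / p - 1 + -b₁) := by
    refine (PowerType.mul (.rpow_id (1 / p - 1)) hB.inv).congr
      (hE₁.mul hQ).measurable fun t h0 h1 => ?_
    have hAt := hA.pos t h0 h1
    have hBt := hB.pos t h0 h1
    rw [hDdef, show 1 / p - 1 = 1 / p + (b : ℝ) + (1 - ((b : ℝ) + 2)) by ring,
      Real.rpow_add h0, Real.rpow_add h0]
    field_simp
  have hE₂ : PowerType (fun t => B t * t ^ (-1 - 1 / p)) _ _ := hB.mul (.rpow_id _)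
  have hEQ₂ : PowerType (fun t => B t * t ^ (-1 - 1 / p) *
      (t ^ (1 - ((b : ℝ) + 2)) * (A t * (B t)⁻¹))) (-2 - b - 1 / p + a₁) (-2 - b - 1 / p + a₂) := by
    refine (PowerType.mul (.rpow_id (-2 - b - 1 / p)) hA).congr
      (hE₂.mul hQ).measurable fun t h0 h1 => ?_
    have hAt := hA.pos t h0 h1
    have hBt := hB.pos t h0 h1
    rw [show -2 - (b : ℝ) - 1 / p = (-1 - 1 / p) + (1 - ((b : ℝ) + 2)) by ring, Real.rpow_add h0]
    field_simp
  -- In both applications the exponent conditions reduce to a₂ ≤ b and 1/p < b₁, each used once at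
  -- the boundary and once at infinity.
  obtain ⟨C₂, hC₂, hFR₁⟩ := forelli_rudin hE₁ hQ hEQ₁ (by linarith) (by linarith)
  obtain ⟨C₃, hC₃, hFR₂⟩ := forelli_rudin hE₂ hQ hEQ₂ (by linarith) (by linarith)
  refine ⟨C₁ ^ p * C₂ ^ (p - 1) * C₃, by positivity, fun G hG u hu => ?_⟩
  set κ : ℂ → ℂ → ℝ := fun z w => (1 - ‖z‖ * ‖w‖) * ((1 - ‖z‖ * ‖w‖) ^ (1 - ((b : ℝ) + 2)) *
        (A (1 - ‖z‖ * ‖w‖) * (B (1 - ‖z‖ * ‖w‖))⁻¹)) *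
      (1 / ‖1 - z * starRingEnd ℂ w‖ ^ 2) with hκ
  have hzw1 : ∀ z ∈ disc, ∀ w ∈ disc, ‖z * starRingEnd ℂ w‖ < 1 := by
    intro z hz w hw
    rw [mem_disc] at hz hw
    rw [norm_mul, RCLike.norm_conj]
    nlinarith [norm_nonneg z, norm_nonneg w]
  have hκpos : ∀ z ∈ disc, ∀ w ∈ disc, 0 < κ z w := by
    intro z hz w hw
    have h1 := hzw1 z hz w hw
    have h2 := one_sub_norm_le_norm_one_sub (z * starRingEnd ℂ w)
    have h3 : 0 < ‖1 - z * starRingEnd ℂ w‖ := by linarith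
    rw [norm_mul, RCLike.norm_conj] at h1
    have h4 : 0 ≤ ‖z‖ * ‖w‖ := by positivity
    have h5 : 0 < 1 - ‖z‖ * ‖w‖ := by linarith
    have := hA.pos _ h5 (by linarith)
    have := hB.pos _ h5 (by linarith)
    simp only [hκ]
    positivity
  have hκm : Measurable (Function.uncurry κ) := by
    have := hA.measurable
    have := hB.measurable
    simp only [hκ, Function.uncurry_def]
    fun_prop
  have hκK : ∀ z ∈ disc, ∀ w ∈ disc, ‖K (z * starRingEnd ℂ w)‖ ≤ C₁ * κ z w := by
    intro z hz w hw
    have := hK _ (hzw1 z hz w hw)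
    rwa [norm_mul, RCLike.norm_conj] at this
  set g : ℂ → ENNReal := fun w =>
    ENNReal.ofReal (‖G w‖ ^ p * D (1 - ‖w‖) ^ (1 - p) * (1 - ‖w‖) ^ (b : ℝ)) with hg
  set k : ℂ → ℂ → ENNReal := fun z w => ENNReal.ofReal
    ((B (1 - ‖z‖) * (1 - ‖z‖) ^ (-1 - 1 / p)) * κ z w) with hk
  have hGm := hG.aestronglyMeasurable.aemeasurable
  have hDm := hD.measurable
  have hpt : ∀ z ∈ disc, ENNReal.ofReal
      (‖u z‖ ^ p * (B (1 - ‖z‖) ^ p * (1 - ‖z‖) ^ (-2 : ℝ))) ≤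
      ENNReal.ofReal (C₁ ^ p * C₂ ^ (p - 1)) * ∫⁻ w, g w * k z w ∂areaMeasure := by
    intro z hz
    have hz1 := mem_disc.1 hz
    have hy : 0 < 1 - ‖z‖ := by linarith
    have hy1 : 1 - ‖z‖ ≤ 1 := by linarith [norm_nonneg z]
    have hBy := hB.pos _ hy hy1
    have hAy := hA.pos _ hy hy1
    have hκz : Measurable fun w => κ z w := hκm.comp (measurable_const.prodMk measurable_id)
    have h1 : ENNReal.ofReal ‖u z‖ ≤ ENNReal.ofReal C₁ *
        ∫⁻ w, ENNReal.ofReal (‖G w‖ * (κ z w * (1 - ‖w‖) ^ (b : ℝ))) ∂areaMeasure := by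
      refine (hu z hz).trans ?_
      rw [← lintegral_const_mul' _ _ ENNReal.ofReal_ne_top]
      refine lintegral_mono_ae (ae_areaMeasure_mem.mono fun w hw => ?_)
      have hx : 0 < 1 - ‖w‖ := by linarith [mem_disc.1 hw]
      rw [← ENNReal.ofReal_mul hC₁.le]
      apply ENNReal.ofReal_le_ofReal
      rw [Real.rpow_natCast]
      calc ‖G w‖ * ‖K (z * starRingEnd ℂ w)‖ * (1 - ‖w‖) ^ b
          ≤ ‖G w‖ * (C₁ * κ z w) * (1 - ‖w‖) ^ b := by
            gcongr
            exact hκK z hz w hw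
        _ = _ := by ring
    have h2 := lintegral_mul_rpow_le hp (f := fun w => ‖G w‖) (D := fun w => D (1 - ‖w‖))
      (k := fun w => κ z w * (1 - ‖w‖) ^ (b : ℝ)) (by fun_prop) (by fun_prop)
      (by fun_prop) (ae_areaMeasure_mem.mono fun w hw => by
        have hx : 0 < 1 - ‖w‖ := by linarith [mem_disc.1 hw]
        exact ⟨norm_nonneg _, hD.pos _ hx (by linarith [norm_nonneg w]),
          mul_pos (hκpos z hz w hw) (by positivity)⟩)
    -- Here w is the variable of integration and z is the parameter, so the symmetry of |1 - z w̄|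
    -- is needed.
    have h3 : ∫⁻ w, ENNReal.ofReal (D (1 - ‖w‖) * (κ z w * (1 - ‖w‖) ^ (b : ℝ))) ∂areaMeasure ≤
        ENNReal.ofReal (C₂ * ((1 - ‖z‖) ^ (1 / p) * (B (1 - ‖z‖))⁻¹)) := by
      refine (le_of_eq ?_).trans ((hFR₁ z hz).trans (le_of_eq ?_))
      · refine lintegral_congr fun w => ?_
        simp only [hκ]
        rw [norm_one_sub_mul_conj_comm, mul_comm ‖z‖ ‖w‖]
        congr 1
        ring
      · congr 2
        set y := 1 - ‖z‖
        have : y * y ^ (b : ℝ) * y ^ (1 - ((b : ℝ) + 2)) = 1 := by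
          nth_rewrite 1 [← Real.rpow_one y]
          rw [← Real.rpow_add hy, ← Real.rpow_add hy]
          ring_nf
          exact Real.rpow_zero y
        have h4 : (A y)⁻¹ * A y = 1 := inv_mul_cancel₀ hAy.ne'
        simp only [hDdef]
        linear_combination (y ^ (1 / p) * (B y)⁻¹) * (h4 *
          (y * y ^ (b : ℝ) * y ^ (1 - ((b : ℝ) + 2))) + this)
    rw [ENNReal.ofReal_mul (by positivity), ← ENNReal.ofReal_rpow_of_nonneg (norm_nonneg _) hp0.le]
    have h5 := (ENNReal.rpow_le_rpow h1 hp0.le)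
    rw [ENNReal.mul_rpow_of_nonneg _ _ hp0.le] at h5
    calc _ ≤ ENNReal.ofReal C₁ ^ p * ((∫⁻ w, ENNReal.ofReal (‖G w‖ ^ p * D (1 - ‖w‖) ^ (1 - p) *
            (κ z w * (1 - ‖w‖) ^ (b : ℝ))) ∂areaMeasure) *
            ENNReal.ofReal (C₂ * ((1 - ‖z‖) ^ (1 / p) * (B (1 - ‖z‖))⁻¹)) ^ (p - 1)) *
            ENNReal.ofReal (B (1 - ‖z‖) ^ p * (1 - ‖z‖) ^ (-2 : ℝ)) := by
          gcongr
          refine h5.trans ?_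
          gcongr 1
          refine h2.trans ?_
          gcongr 1
          exact ENNReal.rpow_le_rpow h3 (by linarith)
      _ = (ENNReal.ofReal C₁ ^ p *
            ENNReal.ofReal (C₂ * ((1 - ‖z‖) ^ (1 / p) * (B (1 - ‖z‖))⁻¹)) ^ (p - 1) *
            ENNReal.ofReal (B (1 - ‖z‖) ^ p * (1 - ‖z‖) ^ (-2 : ℝ))) *
            ∫⁻ w, ENNReal.ofReal (‖G w‖ ^ p * D (1 - ‖w‖) ^ (1 - p) *
            (κ z w * (1 - ‖w‖) ^ (b : ℝ))) ∂areaMeasure := by ring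
      _ = ENNReal.ofReal (C₁ ^ p * C₂ ^ (p - 1)) *
            (ENNReal.ofReal (B (1 - ‖z‖) * (1 - ‖z‖) ^ (-1 - 1 / p)) *
            ∫⁻ w, ENNReal.ofReal (‖G w‖ ^ p * D (1 - ‖w‖) ^ (1 - p) *
            (κ z w * (1 - ‖w‖) ^ (b : ℝ))) ∂areaMeasure) := by
          rw [← mul_assoc (ENNReal.ofReal (C₁ ^ p * C₂ ^ (p - 1)))]
          congr 1
          rw [ENNReal.ofReal_rpow_of_nonneg hC₁.le hp0.le,
            ENNReal.ofReal_rpow_of_nonneg (by positivity) (by linarith),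
            ← ENNReal.ofReal_mul (by positivity), ← ENNReal.ofReal_mul (by positivity),
            ← ENNReal.ofReal_mul (by positivity)]
          congr 1
          set y := 1 - ‖z‖
          rw [Real.mul_rpow hC₂.le (by positivity), Real.mul_rpow (by positivity) (by positivity),
            Real.inv_rpow hBy.le, ← Real.rpow_mul hy.le]
          have e1 : B y ^ p = B y ^ (p - 1) * B y := by
            nth_rewrite 3 [← Real.rpow_one (B y)]
            rw [← Real.rpow_add hBy]; ring_nf
          have e2 : y ^ (1 / p * (p - 1)) * y ^ (-2 : ℝ) = y ^ (-1 - 1 / p) := by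
            rw [← Real.rpow_add hy]
            congr 1
            field_simp
            ring
          rw [e1, ← e2]
          have : 0 < B y ^ (p - 1) := by positivity
          field_simp
      _ = _ := by
          rw [← lintegral_const_mul' _ _ ENNReal.ofReal_ne_top]
          congr 1
          refine lintegral_congr_ae (ae_areaMeasure_mem.mono fun w hw => ?_)
          have hx : 0 < 1 - ‖w‖ := by linarith [mem_disc.1 hw]
          have hDx := hD.pos _ hx (by linarith [norm_nonneg w])
          simp only [hg, hk]
          rw [← ENNReal.ofReal_mul (by positivity), ← ENNReal.ofReal_mul (by positivity)]
          congr 1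
          ring
  have hgm : AEMeasurable g areaMeasure := by fun_prop
  have hkm : Measurable (Function.uncurry k) := by
    have := hB.measurable
    have h6 : Measurable fun q : ℂ × ℂ => κ q.1 q.2 := hκm
    simp only [hk, Function.uncurry_def]
    fun_prop
  calc _ ≤ ∫⁻ z, ENNReal.ofReal (C₁ ^ p * C₂ ^ (p - 1)) *
          ∫⁻ w, g w * k z w ∂areaMeasure ∂areaMeasure :=
        lintegral_mono_ae (ae_areaMeasure_mem.mono hpt)
    _ = ENNReal.ofReal (C₁ ^ p * C₂ ^ (p - 1)) *
          ∫⁻ z, ∫⁻ w, g w * k z w ∂areaMeasure ∂areaMeasure :=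
        lintegral_const_mul' _ _ ENNReal.ofReal_ne_top
    _ ≤ ENNReal.ofReal (C₁ ^ p * C₂ ^ (p - 1)) * ∫⁻ w, g w * _ ∂areaMeasure := by
        gcongr 1
        exact lintegral_lintegral_mul_le hgm hkm hFR₂
    _ = ENNReal.ofReal (C₁ ^ p * C₂ ^ (p - 1)) * ∫⁻ w, ENNReal.ofReal C₃ * ENNReal.ofReal
          (‖G w‖ ^ p * (A (1 - ‖w‖) ^ p * (1 - ‖w‖) ^ (-2 : ℝ))) ∂areaMeasure := by
        congr 1
        refine lintegral_congr_ae (ae_areaMeasure_mem.mono fun w hw => ?_)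
        have hx : 0 < 1 - ‖w‖ := by linarith [mem_disc.1 hw]
        have hx1 : 1 - ‖w‖ ≤ 1 := by linarith [norm_nonneg w]
        have hAt := hA.pos _ hx hx1
        have hBt := hB.pos _ hx hx1
        have hDt := hD.pos _ hx hx1
        simp only [hg]
        rw [← ENNReal.ofReal_mul (by positivity), ← ENNReal.ofReal_mul hC₃.le]
        congr 1
        set x := 1 - ‖w‖
        have e1 : D x ^ (1 - p) = x ^ (1 / p - 1) * (A x ^ p * (A x)⁻¹) := by
          rw [hDdef]
          simp only
          rw [Real.mul_rpow (by positivity) (by positivity), ← Real.rpow_mul hx.le,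
            Real.inv_rpow hAt.le, ← Real.rpow_neg hAt.le, ← Real.rpow_neg_one (A x),
            ← Real.rpow_add hAt]
          congr 2
          · field_simp
          · ring
        have e2 : x ^ (1 / p - 1) * x ^ (b : ℝ) * x * x ^ (-1 - 1 / p) *
            x ^ (1 - ((b : ℝ) + 2)) = x ^ (-2 : ℝ) := by
          nth_rewrite 3 [← Real.rpow_one x]
          rw [← Real.rpow_add hx, ← Real.rpow_add hx, ← Real.rpow_add hx, ← Real.rpow_add hx]
          ring_nf
        rw [e1, ← e2]
        field_simp
    _ = _ := by
        rw [lintegral_const_mul' _ _ ENNReal.ofReal_ne_top, ← mul_assoc,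
          ← ENNReal.ofReal_mul (by positivity)]

/-! ### Coefficient multipliers -/

theorem IsAnalytic.norm_rpow_mul_le {A : ℝ → ℝ} {a₁ a₂ p : ℝ} (hA : PowerType A a₁ a₂)
    (hp : 0 < p) : ∃ C, 0 < C ∧ ∀ G : ℂ → ℂ, IsAnalytic G →
      (∫⁻ w, ENNReal.ofReal
        (‖G w‖ ^ p * (A (1 - ‖w‖) ^ p * (1 - ‖w‖) ^ (-2 : ℝ))) ∂areaMeasure) ≠ ⊤ →
      ∀ w ∈ disc, ‖G w‖ ^ p * A (1 - ‖w‖) ^ p ≤ C * (∫⁻ w, ENNReal.ofReal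
        (‖G w‖ ^ p * (A (1 - ‖w‖) ^ p * (1 - ‖w‖) ^ (-2 : ℝ))) ∂areaMeasure).toReal := by
  obtain ⟨C, hC, h⟩ := norm_rpow_mul_le_lintegral ((hA.rpow hp.le).mul (.rpow_id (-2))) hp
  refine ⟨C, hC, fun G hG hI w hw => ?_⟩
  have hx : 0 < 1 - ‖w‖ := by linarith [mem_disc.1 hw]
  have h1 := h G hG w hw
  rw [← ENNReal.ofReal_toReal hI, ← ENNReal.ofReal_mul hC.le,
    ENNReal.ofReal_le_ofReal_iff (by positivity)] at h1
  refine (le_of_eq ?_).trans h1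
  have : (1 - ‖w‖) ^ (-2 : ℝ) * (1 - ‖w‖) ^ 2 = 1 := by
    rw [← Real.rpow_natCast, ← Real.rpow_add hx]
    norm_num
  linear_combination (-(‖G w‖ ^ p * A (1 - ‖w‖) ^ p)) * this

theorem PowerType.pow_le_mul {A : ℝ → ℝ} {a₁ a₂ : ℝ} (hA : PowerType A a₁ a₂) {b : ℕ}
    (hb : a₂ ≤ b) : ∃ C, 0 < C ∧ ∀ t, 0 < t → t ≤ 1 → t ^ b ≤ C * A t := by
  obtain ⟨C, hC, h⟩ := hA.bound
  have h1 := hA.pos 1 one_pos le_rfl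
  refine ⟨C * (A 1)⁻¹, by positivity, fun t ht ht1 => ?_⟩
  have h2 := (h 1 t ht ht1 le_rfl).1
  have h3 : t ^ b ≤ t ^ a₂ := by
    rw [← Real.rpow_natCast]
    exact Real.rpow_le_rpow_of_exponent_ge ht ht1 hb
  have h4 : t ^ a₂ * (1 / t) ^ a₂ = 1 := by
    rw [← Real.mul_rpow ht.le (by positivity), mul_one_div_cancel ht.ne', Real.one_rpow]
  have h5 : t ^ a₂ * A 1 ≤ C * A t := by
    calc t ^ a₂ * A 1 ≤ t ^ a₂ * (C * (1 / t) ^ a₂ * A t) := by gcongr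
      _ = C * A t * (t ^ a₂ * (1 / t) ^ a₂) := by ring
      _ = C * A t := by rw [h4, mul_one]
  calc t ^ b ≤ t ^ a₂ := h3
    _ = (A 1)⁻¹ * (t ^ a₂ * A 1) := by field_simp
    _ ≤ (A 1)⁻¹ * (C * A t) := by gcongr
    _ = _ := by ring

/-- Boundedness of coefficient multipliers between weighted Bergman-type spaces. -/
theorem lintegral_multiplier_le {A B : ℝ → ℝ} {a₁ a₂ b₁ b₂ p : ℝ} {N e b : ℕ}
    (hA : PowerType A a₁ a₂) (hB : PowerType B b₁ b₂) (hp : 0 < p) (hb₁ : 1 < b₁ * p)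
    (hN : 2 ≤ N) (hNp : 2 ≤ N * p) (he : a₂ - b₁ ≤ e) (hbe : b + 1 = N + e) (hab : a₂ ≤ b)
    (j : ℕ) {S : ℕ → ℝ}
    (hS : SymbolClass N (fun n => ((n : ℝ) + 1) ^ (b + 1) *
      (A (1 / ((n : ℝ) + 1)) * (B (1 / ((n : ℝ) + 1)))⁻¹)) S) :
    ∃ C, 0 < C ∧ ∀ G : ℂ → ℂ, IsAnalytic G → ∀ u : ℂ → ℂ,
      (∀ z ∈ disc, u z =
        ∑' n, (S n * betaMoment b (n + j) : ℝ) * coeff G (n + j) * z ^ n) →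
      ∫⁻ z, ENNReal.ofReal (‖u z‖ ^ p * (B (1 - ‖z‖) ^ p * (1 - ‖z‖) ^ (-2 : ℝ))) ∂areaMeasure ≤
        ENNReal.ofReal C * ∫⁻ w, ENNReal.ofReal
          (‖G w‖ ^ p * (A (1 - ‖w‖) ^ p * (1 - ‖w‖) ^ (-2 : ℝ))) ∂areaMeasure := by
  have hR := hA.mul hB.inv
  rw [hbe] at hS
  have hcast : ((b : ℝ) + 2) = ((N + e : ℕ) : ℝ) + 1 := by rw [← hbe]; push_cast; ring
  set K : ℂ → ℂ := fun ζ => ∑' n, (S n : ℂ) * ζ ^ n with hKdef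
  have hsum : ∀ r : ℝ, 0 ≤ r → r < 1 → Summable fun n => |S n| * r ^ n := by
    intro r hr hr1
    obtain ⟨C, hC, h⟩ := hS.bound
    have he' : a₂ + -b₁ ≤ ((N + e : ℕ) : ℝ) := by
      push_cast
      linarith [(N.cast_nonneg : (0 : ℝ) ≤ N)]
    obtain ⟨_, _, h1⟩ := hR.tsum_le he'
    refine Summable.of_nonneg_of_le (fun n => by positivity) (fun n => ?_)
      ((h1 r hr hr1).1.mul_left C)
    rw [← mul_assoc]
    exact mul_le_mul_of_nonneg_right (h n) (by positivity)
  have hop : ∃ C, 0 < C ∧ ∀ G : ℂ → ℂ, IsAnalytic G → ∀ u : ℂ → ℂ,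
      (∀ z ∈ disc, ENNReal.ofReal ‖u z‖ ≤ ∫⁻ w, ENNReal.ofReal
        (‖G w‖ * ‖K (z * starRingEnd ℂ w)‖ * (1 - ‖w‖) ^ b) ∂areaMeasure) →
      ∫⁻ z, ENNReal.ofReal (‖u z‖ ^ p * (B (1 - ‖z‖) ^ p * (1 - ‖z‖) ^ (-2 : ℝ))) ∂areaMeasure ≤
        ENNReal.ofReal C * ∫⁻ w, ENNReal.ofReal
          (‖G w‖ ^ p * (A (1 - ‖w‖) ^ p * (1 - ‖w‖) ^ (-2 : ℝ))) ∂areaMeasure := by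
    -- For p ≤ 1 the p-th power of the kernel is estimated. For p ≥ 1 the Schur test needs only the
    -- kernel itself, that is, the exponent q = 1.
    rcases le_total p 1 with hp1 | hp1
    · have h1 := hS.norm_kernel_rpow_le hR (by linarith) hp hNp
      rw [← hcast] at h1
      refine lintegral_operator_le_of_le_one hA hB hp hp1 hb₁ hab
        (isAnalytic_tsum fun r hr hr1 => by simpa using hsum r hr hr1) (fun ζ => ?_) h1
      rw [← RCLike.norm_conj (K ζ)]
      simp only [hKdef, Complex.conj_tsum, map_mul, map_pow, Complex.conj_ofReal]
    · have h1 := hS.norm_kernel_rpow_le hR (by linarith) one_pos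
        (by rw [mul_one]; exact_mod_cast hN)
      rw [← hcast] at h1
      simp only [mul_one, Real.rpow_one] at h1
      exact lintegral_operator_le_of_one_le hA hB hp1 hb₁ hab h1
  obtain ⟨C, hC, hop⟩ := hop
  obtain ⟨C', hC', hgr⟩ := IsAnalytic.norm_rpow_mul_le hA hp
  obtain ⟨D, hD, hpow⟩ := hA.pow_le_mul hab
  refine ⟨C * (2 ^ b) ^ p, by positivity, fun G hG u hu => ?_⟩
  set I := ∫⁻ w, ENNReal.ofReal
          (‖G w‖ ^ p * (A (1 - ‖w‖) ^ p * (1 - ‖w‖) ^ (-2 : ℝ))) ∂areaMeasure with hI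
  rcases eq_or_ne I ⊤ with htop | htop
  · rw [htop, ENNReal.mul_top (by positivity)]
    exact le_top
  -- Finite energy forces |G| ≲ 1/A, and t^b ≲ A(t) as a₂ ≤ b. This is the growth condition of the
  -- integral representation.
  have hM : ∀ w ∈ disc, ‖G w‖ * (1 - ‖w‖) ^ b ≤ D * (C' * I.toReal) ^ (1 / p) := by
    intro w hw
    have hx : 0 < 1 - ‖w‖ := by linarith [mem_disc.1 hw]
    have hx1 : 1 - ‖w‖ ≤ 1 := by linarith [norm_nonneg w]
    have hAx := hA.pos _ hx hx1
    have h1 := hgr G hG htop w hw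
    rw [← Real.mul_rpow (norm_nonneg _) hAx.le] at h1
    have h2 := Real.rpow_le_rpow (by positivity) h1 (show 0 ≤ 1 / p by positivity)
    rw [← Real.rpow_mul (by positivity), mul_one_div_cancel hp.ne', Real.rpow_one] at h2
    calc ‖G w‖ * (1 - ‖w‖) ^ b ≤ ‖G w‖ * (D * A (1 - ‖w‖)) := by
          gcongr; exact hpow _ hx hx1
      _ = D * (‖G w‖ * A (1 - ‖w‖)) := by ring
      _ ≤ _ := by gcongr
  -- The operator bound is stated with (1 - |w|)^b. The factor 2^b in (1 - |w|^2)^b ≤ 2^b (1 -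
  -- |w|)^b is put into the function.
  have h2G : IsAnalytic fun w => (2 : ℂ) ^ b * G w := DifferentiableOn.const_mul hG _
  have h3 := hop _ h2G u fun z hz => by
    rw [hu z hz, tsum_mul_coeff_eq_integral hG hM j hsum hz, ofReal_norm]
    refine (enorm_integral_le_lintegral_enorm _).trans ?_
    refine lintegral_mono_ae (ae_areaMeasure_mem.mono fun w hw => ?_)
    have hw1 := mem_disc.1 hw
    have h0 := norm_nonneg w
    have h1 : 0 ≤ 1 - ‖w‖ ^ 2 := by nlinarith
    rw [← ofReal_norm]
    apply ENNReal.ofReal_le_ofReal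
    rw [norm_mul, norm_mul, norm_mul, norm_mul, norm_pow, norm_pow, RCLike.norm_conj,
      Complex.norm_real, Real.norm_of_nonneg (by positivity), Complex.norm_two]
    calc ‖G w‖ * ‖w‖ ^ j * (1 - ‖w‖ ^ 2) ^ b * ‖K (z * starRingEnd ℂ w)‖
        ≤ ‖G w‖ * 1 * (2 ^ b * (1 - ‖w‖) ^ b) * ‖K (z * starRingEnd ℂ w)‖ := by
          gcongr
          · exact pow_le_one₀ h0 hw1.le
          · exact one_sub_sq_pow_le h0 hw1.le b
      _ = _ := by ring
  refine h3.trans (le_of_eq ?_)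
  rw [ENNReal.ofReal_mul hC.le, mul_assoc, hI, 
    ← lintegral_const_mul' (ENNReal.ofReal ((2 ^ b) ^ p)) _ ENNReal.ofReal_ne_top]
  congr 1
  refine lintegral_congr fun w => ?_
  rw [← ENNReal.ofReal_mul (by positivity), norm_mul, norm_pow, Complex.norm_two,
    Real.mul_rpow (by positivity) (norm_nonneg _), mul_assoc]

/-! ### Doubling conditions and power exponents -/

theorem two_pow_le_div {x y : ℝ} (hy : 0 < y) (hxy : y ≤ x) :
    ∃ n : ℕ, 2 ^ n * y ≤ x ∧ x < 2 ^ (n + 1) * y := by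
  obtain ⟨n, h1, h2⟩ := exists_nat_pow_near ((one_le_div hy).2 hxy) one_lt_two
  exact ⟨n, (le_div_iff₀ hy).1 h1, (div_lt_iff₀ hy).1 h2⟩

theorem le_pow_mul_of_doubling {f : ℝ → ℝ} {C : ℝ} (hC : 0 ≤ C)
    (h : ∀ t, 0 < t → t ≤ 1 → f t ≤ C * f (t / 2)) (n : ℕ) {t : ℝ} (ht : 0 < t) (ht1 : t ≤ 1) :
    f t ≤ C ^ n * f (t / 2 ^ n) := by
  induction n with
  | zero => simp
  | succ n ih =>
    have h2 : (1 : ℝ) ≤ 2 ^ n := one_le_pow₀ one_le_two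
    calc f t ≤ C ^ n * f (t / 2 ^ n) := ih
      _ ≤ C ^ n * (C * f (t / 2 ^ n / 2)) := by
          gcongr
          exact h _ (by positivity) ((div_le_self ht.le h2).trans ht1)
      _ = _ := by rw [pow_succ, pow_succ, div_div]; ring

/-- Iterate the doubling n + 1 times, with 2^n ≤ x/y < 2^{n+1}; the exponent is the binary logarithm
of the constant, enlarged to be at least 1. -/
theorem upper_exponent_of_doubling {f : ℝ → ℝ} (hpos : ∀ t, 0 < t → t ≤ 1 → 0 < f t)
    (hmono : MonotoneOn f (Ioc 0 1)) {C : ℝ} (h : ∀ t, 0 < t → t ≤ 1 → f t ≤ C * f (t / 2)) :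
    ∃ b D : ℝ, 0 ≤ b ∧ 0 < D ∧ ∀ x y, 0 < y → y ≤ x → x ≤ 1 → f x ≤ D * (x / y) ^ b * f y := by
  set E := max C 1
  have hE1 : 1 ≤ E := le_max_right _ _
  have hE : 0 < E := one_pos.trans_le hE1
  have h' : ∀ t, 0 < t → t ≤ 1 → f t ≤ E * f (t / 2) := fun t h0 h1 => (h t h0 h1).trans <|
    mul_le_mul_of_nonneg_right (le_max_left _ _) (hpos _ (by linarith) (by linarith)).le
  refine ⟨Real.logb 2 E, E, Real.logb_nonneg one_lt_two hE1, hE, fun x y hy hxy hx => ?_⟩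
  obtain ⟨n, h1, h2⟩ := two_pow_le_div hy hxy
  have hx0 := hy.trans_le hxy
  have hfy := hpos y hy (hxy.trans hx)
  have e1 : E ^ n ≤ (x / y) ^ Real.logb 2 E := by
    calc E ^ n = ((2 : ℝ) ^ Real.logb 2 E) ^ n := by
          rw [Real.rpow_logb two_pos (by norm_num) hE]
      _ = ((2 : ℝ) ^ n) ^ Real.logb 2 E := by
          rw [← Real.rpow_natCast, ← Real.rpow_mul two_pos.le, mul_comm,
            Real.rpow_mul two_pos.le, Real.rpow_natCast]
      _ ≤ _ := Real.rpow_le_rpow (by positivity) ((le_div_iff₀ hy).2 h1)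
          (Real.logb_nonneg one_lt_two hE1)
  have h3 : x / 2 ^ (n + 1) ≤ y := by
    rw [div_le_iff₀ (by positivity)]; linarith
  calc f x ≤ E ^ (n + 1) * f (x / 2 ^ (n + 1)) := le_pow_mul_of_doubling hE.le h' _ hx0 hx
    _ ≤ E ^ (n + 1) * f y := by
        gcongr
        exact hmono ⟨by positivity, h3.trans (hxy.trans hx)⟩ ⟨hy, hxy.trans hx⟩ h3
    _ = E * E ^ n * f y := by ring
    _ ≤ _ := by gcongr

/-- Each halving gains the factor q < 1, so n halvings from x gain q^n. The decay exponent is -log₂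
q, and the incomplete last halving costs the factor 1/q. -/
theorem lower_exponent_of_reverse_doubling {f : ℝ → ℝ}
    (hpos : ∀ t, 0 < t → t ≤ 1 → 0 < f t)
    (hmono : MonotoneOn f (Ioc 0 1)) {q : ℝ} (hq : 0 < q) (hq1 : q < 1)
    (h : ∀ t, 0 < t → t ≤ 1 → f (t / 2) ≤ q * f t) :
    ∃ ε D : ℝ, 0 < ε ∧ 0 < D ∧ ∀ x y, 0 < y → y ≤ x → x ≤ 1 → f y ≤ D * (y / x) ^ ε * f x := by
  have hε : 0 < -Real.logb 2 q := neg_pos.2 (Real.logb_neg one_lt_two hq hq1)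
  refine ⟨-Real.logb 2 q, q⁻¹, hε, inv_pos.2 hq, fun x y hy hxy hx => ?_⟩
  obtain ⟨n, h1, h2⟩ := two_pow_le_div hy hxy
  have hx0 := hy.trans_le hxy
  have hfx := hpos x hx0 hx
  have hit : ∀ m : ℕ, f (x / 2 ^ m) ≤ q ^ m * f x := by
    intro m
    induction m with
    | zero => simp
    | succ m ih =>
      have h2 : (1 : ℝ) ≤ 2 ^ m := one_le_pow₀ one_le_two
      have := h (x / 2 ^ m) (by positivity) ((div_le_self hx0.le h2).trans hx)
      rw [div_div, ← pow_succ] at this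
      refine this.trans ?_
      rw [pow_succ', mul_assoc]
      gcongr
  have e1 : q ^ (n + 1) ≤ (y / x) ^ (-Real.logb 2 q) := by
    calc q ^ (n + 1) = ((2 : ℝ) ^ Real.logb 2 q) ^ (n + 1) := by
          rw [Real.rpow_logb two_pos (by norm_num) hq]
      _ = (((2 : ℝ) ^ (n + 1))⁻¹) ^ (-Real.logb 2 q) := by
          rw [← Real.rpow_natCast, ← Real.rpow_mul two_pos.le, mul_comm,
            Real.rpow_mul two_pos.le, Real.rpow_natCast, Real.inv_rpow (by positivity),
            Real.rpow_neg (by positivity), inv_inv]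
      _ ≤ _ := by
          refine Real.rpow_le_rpow (by positivity) ?_ hε.le
          rw [le_div_iff₀ hx0, inv_mul_le_iff₀ (by positivity)]
          exact h2.le
  have h3 : y ≤ x / 2 ^ n := by rw [le_div_iff₀ (by positivity)]; linarith
  have h4 : x / 2 ^ n ≤ x := div_le_self hx0.le (one_le_pow₀ one_le_two)
  calc f y ≤ f (x / 2 ^ n) := hmono ⟨hy, hxy.trans hx⟩ ⟨by positivity, h4.trans hx⟩ h3
    _ ≤ q ^ n * f x := hit n
    _ = q⁻¹ * q ^ (n + 1) * f x := by rw [pow_succ]; field_simp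
    _ ≤ _ := by gcongr

/-- The tail integral as a function of the distance to the boundary. -/
noncomputable def tailFun (μ : ℝ → ℝ) (t : ℝ) : ℝ := tail μ (max (1 - t) 0)

theorem tailFun_eq (μ : ℝ → ℝ) {t : ℝ} (ht : t ≤ 1) : tailFun μ t = tail μ (1 - t) := by
  rw [tailFun, max_eq_left (by linarith)]

theorem tail_eq_tailFun (μ : ℝ → ℝ) {r : ℝ} (hr : 0 ≤ r) : tail μ r = tailFun μ (1 - r) := by
  rw [tailFun_eq μ (by linarith), sub_sub_cancel]

theorem tail_sub_tail {μ : ℝ → ℝ} (hμ : IntegrableOn μ (Ico 0 1)) {r s : ℝ} (hr : 0 ≤ r)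
    (hrs : r ≤ s) (hs : s ≤ 1) : tail μ r - tail μ s = ∫ x in Ico r s, μ x := by
  rw [tail, tail, ← Ico_union_Ico_eq_Ico hrs hs, setIntegral_union Ico_disjoint_Ico_same
    measurableSet_Ico (hμ.mono_set (Ico_subset_Ico hr hs))
    (hμ.mono_set (Ico_subset_Ico (hr.trans hrs) le_rfl)), add_sub_cancel_right]

theorem tail_anti {μ : ℝ → ℝ} (h0 : ∀ r ∈ Ico (0 : ℝ) 1, 0 ≤ μ r)
    (hμ : IntegrableOn μ (Ico 0 1)) {r s : ℝ} (hr : 0 ≤ r) (hrs : r ≤ s) :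
    tail μ s ≤ tail μ r := by
  refine setIntegral_mono_set (hμ.mono_set (Ico_subset_Ico_left hr)) ?_
    (Ico_subset_Ico_left hrs).eventuallyLE
  exact (ae_restrict_iff' measurableSet_Ico).2
    (Filter.Eventually.of_forall fun x hx => h0 x ⟨hr.trans hx.1, hx.2⟩)

theorem tail_nonneg {μ : ℝ → ℝ} (h0 : ∀ r ∈ Ico (0 : ℝ) 1, 0 ≤ μ r) {r : ℝ} (hr : 0 ≤ r) :
    0 ≤ tail μ r :=
  setIntegral_nonneg measurableSet_Ico fun x hx => h0 x ⟨hr.trans hx.1, hx.2⟩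

/-- The cut-off in `tailFun` keeps the argument of the tail in [0, ∞), so monotonicity holds on the
whole line and gives measurability at once. -/
theorem tailFun_monotone {μ : ℝ → ℝ} (h0 : ∀ r ∈ Ico (0 : ℝ) 1, 0 ≤ μ r)
    (hμ : IntegrableOn μ (Ico 0 1)) : Monotone (tailFun μ) := fun _ _ hst =>
  tail_anti h0 hμ (le_max_right _ _) (max_le_max_right 0 (by linarith))

theorem tailFun_nonneg {μ : ℝ → ℝ} (h0 : ∀ r ∈ Ico (0 : ℝ) 1, 0 ≤ μ r) (t : ℝ) :
    0 ≤ tailFun μ t := tail_nonneg h0 (le_max_right _ _)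

namespace IsRadialWeight

variable {μ : ℝ → ℝ} (hμ : IsRadialWeight μ)
include hμ

theorem monotone : Monotone (tailFun μ) := tailFun_monotone hμ.nonneg hμ.integrableOn

theorem tailFun_pos {t : ℝ} (ht : 0 < t) : 0 < tailFun μ t := by
  have h1 : 0 < tailFun μ (min t (1 / 2)) := by
    have h2 : min t (1 / 2) ≤ 1 / 2 := min_le_right _ _
    have h3 : 0 < min t (1 / 2) := lt_min ht (by norm_num)
    rw [tailFun_eq μ (by linarith)]
    exact hμ.tail_pos _ ⟨by linarith, by linarith⟩
  exact h1.trans_le (hμ.monotone (min_le_left _ _))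

theorem powerType_of_doubling {C : ℝ}
    (h : ∀ t, 0 < t → t ≤ 1 → tailFun μ t ≤ C * tailFun μ (t / 2)) :
    ∃ b, 0 ≤ b ∧ PowerType (tailFun μ) 0 b := by
  obtain ⟨b, D, hb, hD, hbd⟩ := upper_exponent_of_doubling (fun t ht _ => hμ.tailFun_pos ht)
    (hμ.monotone.monotoneOn _) h
  refine ⟨b, hb, hμ.monotone.measurable, fun t ht _ => hμ.tailFun_pos ht, max D 1, by positivity,
    fun x y hy hxy hx => ⟨(hbd x y hy hxy hx).trans ?_, ?_⟩⟩
  · have := hμ.tailFun_pos hy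
    have := hy.trans_le hxy
    gcongr
    exact le_max_left _ _
  · rw [Real.rpow_zero, mul_one]
    calc tailFun μ y ≤ 1 * tailFun μ x := by rw [one_mul]; exact hμ.monotone hxy
      _ ≤ _ := by
        gcongr
        · exact (hμ.tailFun_pos (hy.trans_le hxy)).le
        · exact le_max_right _ _

end IsRadialWeight

theorem memDHat_iff {μ : ℝ → ℝ} : MemDHat μ ↔ IsRadialWeight μ ∧
    ∃ C, 0 < C ∧ ∀ t, 0 < t → t ≤ 1 → tailFun μ t ≤ C * tailFun μ (t / 2) := by
  refine and_congr_right fun hμ => exists_congr fun C => and_congr_right fun hC =>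
    ⟨fun h t ht ht1 => ?_, fun h r hr => ?_⟩
  · rw [tailFun_eq μ ht1, tailFun_eq μ (by linarith)]
    convert h (1 - t) ⟨by linarith, by linarith⟩ using 3
    ring
  · rw [tail_eq_tailFun μ hr.1, tail_eq_tailFun μ (by linarith [hr.1])]
    convert h (1 - r) (by linarith [hr.2]) (by linarith [hr.1]) using 3
    ring

theorem memDCheck_iff {μ : ℝ → ℝ} : MemDCheck μ ↔ IsRadialWeight μ ∧
    ∃ K : ℝ, 1 < K ∧ ∃ C : ℝ, 1 < C ∧
      ∀ t, 0 < t → t ≤ 1 → C * tailFun μ (t / K) ≤ tailFun μ t := by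
  refine and_congr_right fun hμ => exists_congr fun K => and_congr_right fun hK =>
    exists_congr fun C => and_congr_right fun hC => ⟨fun h t ht ht1 => ?_, fun h r hr => ?_⟩
  · have : t / K ≤ t := div_le_self ht.le hK.le
    rw [tailFun_eq μ ht1, tailFun_eq μ (by linarith)]
    simpa using h (1 - t) ⟨by linarith, by linarith⟩
  · have h1 : (1 - r) / K ≤ 1 - r := div_le_self (by linarith [hr.2]) hK.le
    have := h (1 - r) (by linarith [hr.2]) (by linarith [hr.1])
    rwa [← tail_eq_tailFun μ hr.1, tailFun_eq μ (by linarith [hr.1])] at this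

/-! ### The weight μ̂(r)^p / (1 - r)^2 -/

/-- The radial weight `μ̂(r)ᵖ / (1 - r)²`. -/
noncomputable def powWeight (p : ℝ) (μ : ℝ → ℝ) (r : ℝ) : ℝ := tail μ r ^ p / (1 - r) ^ 2

theorem powWeight_nonneg {μ : ℝ → ℝ} (hμ : IsRadialWeight μ) (p : ℝ) :
    ∀ r ∈ Ico (0 : ℝ) 1, 0 ≤ powWeight p μ r := fun r hr => by
  have := tail_nonneg hμ.nonneg hr.1
  rw [powWeight]
  positivity

section

variable {μ : ℝ → ℝ} (hμ : IsRadialWeight μ) {p : ℝ} (hp : 0 < p)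
  (hint : IntegrableOn (powWeight p μ) (Ico 0 1))
include hμ hp hint

theorem tailFun_powWeight_sub_le {s t : ℝ} (hs : 0 < s) (hst : s ≤ t) (ht : t ≤ 1) :
    tailFun (powWeight p μ) t - tailFun (powWeight p μ) s ≤ tailFun μ t ^ p / s ^ 2 * (t - s) := by
  rw [tailFun_eq _ ht, tailFun_eq _ (hst.trans ht),
    tail_sub_tail hint (by linarith) (by linarith) (by linarith)]
  calc ∫ x in Ico (1 - t) (1 - s), powWeight p μ x
      ≤ ∫ _ in Ico (1 - t) (1 - s), tailFun μ t ^ p / s ^ 2 := by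
        refine setIntegral_mono_on (hint.mono_set (Ico_subset_Ico (by linarith) (by linarith)))
          (by simp) measurableSet_Ico fun x hx => ?_
        rw [powWeight, tail_eq_tailFun μ (by linarith [hx.1])]
        have := tailFun_nonneg hμ.nonneg (1 - x)
        have := tailFun_nonneg hμ.nonneg t
        gcongr
        · exact hμ.monotone (by linarith [hx.1])
        · linarith [hx.2]
    _ = _ := by
        rw [setIntegral_const, smul_eq_mul, measureReal_def, Real.volume_Ico,
          ENNReal.toReal_ofReal (by linarith)]
        ring

theorem le_tailFun_powWeight_sub {s t : ℝ} (hs : 0 < s) (hst : s ≤ t) (ht : t ≤ 1) :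
    tailFun μ s ^ p / t ^ 2 * (t - s) ≤ tailFun (powWeight p μ) t - tailFun (powWeight p μ) s := by
  rw [tailFun_eq (powWeight p μ) ht, tailFun_eq (powWeight p μ) (hst.trans ht),
    tail_sub_tail hint (by linarith) (by linarith) (by linarith)]
  calc tailFun μ s ^ p / t ^ 2 * (t - s) = ∫ _ in Ico (1 - t) (1 - s), tailFun μ s ^ p / t ^ 2 := by
        rw [setIntegral_const, smul_eq_mul, measureReal_def, Real.volume_Ico,
          ENNReal.toReal_ofReal (by linarith)]
        ring
    _ ≤ _ := by
        refine setIntegral_mono_on (by simp)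
          (hint.mono_set (Ico_subset_Ico (by linarith) (by linarith)))
          measurableSet_Ico fun x hx => ?_
        rw [powWeight, tail_eq_tailFun μ (by linarith [hx.1])]
        have := tailFun_nonneg hμ.nonneg s
        have := tailFun_nonneg hμ.nonneg (1 - x)
        have := hx.2
        gcongr
        · exact pow_pos (by linarith) 2
        · exact hμ.monotone (by linarith [hx.2])
        · linarith
        · linarith [hx.1]

theorem le_tailFun_powWeight {t : ℝ} (ht0 : 0 < t) (ht : t ≤ 1) :
    tailFun μ (t / 2) ^ p / (2 * t) ≤ tailFun (powWeight p μ) t - tailFun (powWeight p μ) (t / 2) := by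
  refine le_trans (le_of_eq ?_)
    (le_tailFun_powWeight_sub hμ hp hint (half_pos ht0) (by linarith) ht)
  field_simp
  ring

theorem isRadialWeight_powWeight : IsRadialWeight (powWeight p μ) where
  nonneg := powWeight_nonneg hμ p
  integrableOn := hint
  tail_pos r hr := by
    have h1 := le_tailFun_powWeight hμ hp hint (t := 1 - r) (by linarith [hr.2])
      (by linarith [hr.1])
    have h2 := tailFun_nonneg (powWeight_nonneg hμ p) ((1 - r) / 2)
    have h3 := hμ.tailFun_pos (t := (1 - r) / 2) (by linarith [hr.2])
    have h4 : 0 < 1 - r := by linarith [hr.2]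
    have : 0 < tailFun μ ((1 - r) / 2) ^ p / (2 * (1 - r)) := by positivity
    rw [tail_eq_tailFun _ hr.1.le]
    linarith

/-- By doubling of μ̂, the increment of the new tail over [t/2, t] is at least a multiple of
`tailFun μ t ^ p / t`, while the whole tail at t is at most such a multiple. So increment and tail
are comparable, which gives both classes. -/
theorem memD_powWeight (hd : ∃ C, 0 < C ∧ ∀ t, 0 < t → t ≤ 1 → tailFun μ t ≤ C * tailFun μ (t / 2))
    (hle : ∃ C, 0 < C ∧ ∀ t, 0 < t → t ≤ 1 →
      tailFun (powWeight p μ) t ≤ C * (tailFun μ t ^ p / t)) : MemD (powWeight p μ) := by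
  obtain ⟨C, hC, hd⟩ := hd
  obtain ⟨D, hD, hle⟩ := hle
  have hw := isRadialWeight_powWeight hμ hp hint
  have hd' : ∀ t, 0 < t → t ≤ 1 → tailFun μ t ^ p ≤ C ^ p * tailFun μ (t / 2) ^ p := by
    intro t ht ht1
    rw [← Real.mul_rpow hC.le (tailFun_nonneg hμ.nonneg _)]
    exact Real.rpow_le_rpow (tailFun_nonneg hμ.nonneg _) (hd t ht ht1) hp.le
  have hlow : ∀ t, 0 < t → t ≤ 1 → tailFun (powWeight p μ) t ≤
      2 * C ^ p * D * (tailFun (powWeight p μ) t - tailFun (powWeight p μ) (t / 2)) := by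
    intro t ht ht1
    calc _ ≤ D * (tailFun μ t ^ p / t) := hle t ht ht1
      _ ≤ D * ((C ^ p * tailFun μ (t / 2) ^ p) / t) := by gcongr; exact hd' t ht ht1
      _ = 2 * C ^ p * D * (tailFun μ (t / 2) ^ p / (2 * t)) := by field_simp
      _ ≤ _ := by gcongr; exact le_tailFun_powWeight hμ hp hint ht ht1
  set E := 2 * C ^ p * D with hE
  have hE0 : 0 < E := by positivity
  have hEn := hlow 1 one_pos le_rfl
  have h1 := hw.tailFun_pos (one_pos)
  have h2 := hw.tailFun_pos (half_pos (one_pos (α := ℝ)))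
  refine ⟨memDHat_iff.2 ⟨hw, D * (C ^ p * C ^ p * 2), by positivity, fun t ht ht1 => ?_⟩,
    memDCheck_iff.2 ⟨hw, 2, one_lt_two, 1 + E⁻¹, by simpa, fun t ht ht1 => ?_⟩⟩
  · have h3 := le_tailFun_powWeight hμ hp hint (half_pos ht) (by linarith)
    have h4 := (hw.tailFun_pos (half_pos (half_pos ht))).le
    calc _ ≤ D * (tailFun μ t ^ p / t) := hle t ht ht1
      _ ≤ D * ((C ^ p * (C ^ p * tailFun μ (t / 2 / 2) ^ p)) / t) := by
          gcongr
          refine (hd' t ht ht1).trans ?_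
          gcongr
          exact hd' (t / 2) (half_pos ht) (by linarith)
      _ = D * (C ^ p * C ^ p) * (tailFun μ (t / 2 / 2) ^ p / (2 * (t / 2))) := by field_simp
      _ ≤ D * (C ^ p * C ^ p) * (1 * tailFun (powWeight p μ) (t / 2)) := by
          gcongr; linarith
      _ ≤ D * (C ^ p * C ^ p) * (2 * tailFun (powWeight p μ) (t / 2)) := by
          have := (hw.tailFun_pos (half_pos ht)).le
          gcongr
          norm_num
      _ = _ := by ring
  · have h3 := hlow t ht ht1
    have h4 := hw.monotone (show t / 2 ≤ t by linarith)
    have h5 : E⁻¹ * tailFun (powWeight p μ) (t / 2) ≤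
        tailFun (powWeight p μ) t - tailFun (powWeight p μ) (t / 2) := by
      rw [inv_mul_le_iff₀ hE0]
      linarith
    linarith

end

section

variable {μ : ℝ → ℝ} (hμ : IsRadialWeight μ) {p : ℝ} (hp : 0 < p) (hD : MemD (powWeight p μ))
include hμ hp hD

/-- The 𝒟̌ condition bounds the tail at t by (1 - 1/C)^{-1} times its increment over [t/K, t], where
the weight is at most μ̂^p K^2/t^2. -/
theorem tailFun_powWeight_le : ∃ C, 0 < C ∧ ∀ t, 0 < t → t ≤ 1 →
    tailFun (powWeight p μ) t ≤ C * (tailFun μ t ^ p / t) := by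
  obtain ⟨-, hcheck⟩ := hD
  obtain ⟨hw, K, hK, C, hC, h⟩ := memDCheck_iff.1 hcheck
  have hC' : 0 < 1 - C⁻¹ := by linarith [inv_lt_one_of_one_lt₀ hC]
  have hC0 : 0 < C := by linarith
  have hK0 : 0 < K := by linarith
  refine ⟨K ^ 2 / (1 - C⁻¹), by positivity, fun t ht ht1 => ?_⟩
  have h1 := h t ht ht1
  rw [← le_inv_mul_iff₀ hC0] at h1
  have h2 := tailFun_powWeight_sub_le hμ hp hw.integrableOn (div_pos ht hK0)
    (div_le_self ht.le hK.le) ht1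
  have h3 : tailFun μ t ^ p / (t / K) ^ 2 * (t - t / K) ≤ K ^ 2 * (tailFun μ t ^ p / t) := by
    have := tailFun_nonneg hμ.nonneg t
    have := div_pos ht hK0
    calc _ ≤ tailFun μ t ^ p / (t / K) ^ 2 * t := by gcongr; linarith
      _ = _ := by field_simp
  rw [div_mul_eq_mul_div, le_div_iff₀ hC']
  linarith

/-- Sandwich: the p-th power of H(t), divided by 4t, is at most the new tail Φ(2t), which by 𝒟̂ is ≲
Φ(t/2), and this is ≲ H(t/2)^p/t by `tailFun_powWeight_le`. For t ≥ 1/2, positivity and monotonicity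
suffice. -/
theorem doubling_of_memD :
    ∃ C, 0 < C ∧ ∀ t, 0 < t → t ≤ 1 → tailFun μ t ≤ C * tailFun μ (t / 2) := by
  obtain ⟨D, hD0, hle⟩ := tailFun_powWeight_le hμ hp hD
  obtain ⟨hw, C, hC, h⟩ := memDHat_iff.1 hD.1
  have h14 : 0 < tailFun μ (1 / 4) := hμ.tailFun_pos (by norm_num)
  have h11 : 0 < tailFun μ 1 := hμ.tailFun_pos one_pos
  set E := C * C * (D * 8) with hE
  have hE0 : 0 < E := by positivity
  refine ⟨max (E ^ (1 / p)) (tailFun μ 1 / tailFun μ (1 / 4)),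
    lt_max_of_lt_left (by positivity), fun t ht ht1 => ?_⟩
  have hpos := hμ.tailFun_pos (half_pos ht)
  have hpos' := hμ.tailFun_pos ht
  rcases le_total t (1 / 2) with ht2 | ht2
  · have h1 := le_tailFun_powWeight hμ hp hw.integrableOn (t := 2 * t) (by linarith) (by linarith)
    rw [mul_div_cancel_left₀ t two_ne_zero] at h1
    have h2 := h (2 * t) (by linarith) (by linarith)
    rw [mul_div_cancel_left₀ t two_ne_zero] at h2
    have h3 := h t ht ht1
    have h4 := hle (t / 2) (half_pos ht) (by linarith)
    have h5 := hw.tailFun_pos ht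
    have h6 : tailFun μ t ^ p / (2 * (2 * t)) ≤ C * (C * (D * (tailFun μ (t / 2) ^ p / (t / 2)))) := by
      calc _ ≤ tailFun (powWeight p μ) (2 * t) := by linarith
        _ ≤ C * tailFun (powWeight p μ) t := h2
        _ ≤ C * (C * tailFun (powWeight p μ) (t / 2)) := by gcongr
        _ ≤ _ := by gcongr
    have h7 : tailFun μ t ^ p ≤ E * tailFun μ (t / 2) ^ p := by
      rw [div_le_iff₀ (by positivity)] at h6
      refine h6.trans (le_of_eq ?_)
      rw [hE]
      field_simp
      ring
    have h8 := Real.rpow_le_rpow (by positivity) h7 (show 0 ≤ 1 / p by positivity)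
    rw [Real.mul_rpow hE0.le (by positivity), ← Real.rpow_mul hpos.le, ← Real.rpow_mul hpos'.le,
      mul_one_div_cancel hp.ne', Real.rpow_one, Real.rpow_one] at h8
    refine h8.trans ?_
    gcongr
    exact le_max_left _ _
  · calc tailFun μ t ≤ tailFun μ 1 := hμ.monotone ht1
      _ = tailFun μ 1 / tailFun μ (1 / 4) * tailFun μ (1 / 4) := by field_simp
      _ ≤ _ := by
        gcongr
        · exact le_max_right _ _
        · exact hμ.monotone (by linarith)

/-- The tail Φ of the new weight is bounded by its increment over [t/2, t], hence contracts by a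
fixed factor at each halving and decays like t^ε. Since H^p ≲ tΦ ≲ H^p, this gives H^p the decay
exponent 1 + ε, strictly above 1. -/
theorem exists_powerType_of_memD : ∃ γ β, 1 < γ * p ∧ PowerType (tailFun μ) γ β := by
  obtain ⟨D, hD0, hle⟩ := tailFun_powWeight_le hμ hp hD
  obtain ⟨C, hC, hd⟩ := doubling_of_memD hμ hp hD
  obtain ⟨β, hβ, hP⟩ := hμ.powerType_of_doubling hd
  have hw := hD.1.1
  have hw1 := hw.integrableOn
  have hd' : ∀ t, 0 < t → t ≤ 1 → tailFun μ t ^ p ≤ C ^ p * tailFun μ (t / 2) ^ p := by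
    intro t ht ht1
    rw [← Real.mul_rpow hC.le (tailFun_nonneg hμ.nonneg _)]
    exact Real.rpow_le_rpow (tailFun_nonneg hμ.nonneg _) (hd t ht ht1) hp.le
  have hlow : ∀ t, 0 < t → t ≤ 1 → tailFun μ t ^ p ≤
      2 * C ^ p * t * (tailFun (powWeight p μ) t - tailFun (powWeight p μ) (t / 2)) := by
    intro t ht ht1
    calc _ ≤ C ^ p * tailFun μ (t / 2) ^ p := hd' t ht ht1
      _ = 2 * C ^ p * t * (tailFun μ (t / 2) ^ p / (2 * t)) := by field_simp
      _ ≤ _ := by gcongr; exact le_tailFun_powWeight hμ hp hw1 ht ht1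
  -- The added 1 ensures E > 1, so that the contraction factor 1 - 1/E lies in (0,1).
  set E := 2 * C ^ p * D + 1 with hE
  have hE0 : 0 < 2 * C ^ p * D := by positivity
  have hE1 : 1 < E := by linarith
  obtain ⟨ε, F, hε, hF, hlo⟩ := lower_exponent_of_reverse_doubling (f := tailFun (powWeight p μ))
    (fun t ht _ => hw.tailFun_pos ht) (hw.monotone.monotoneOn _) (q := 1 - E⁻¹)
    (by linarith [inv_lt_one_of_one_lt₀ hE1]) (by linarith [inv_pos.2 (one_pos.trans hE1)])
    (fun t ht ht1 => by
      have h1 : tailFun (powWeight p μ) t ≤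
          E * (tailFun (powWeight p μ) t - tailFun (powWeight p μ) (t / 2)) := by
        have h0 := hw.monotone (show t / 2 ≤ t by linarith)
        calc _ ≤ D * (tailFun μ t ^ p / t) := hle t ht ht1
          _ ≤ D * ((2 * C ^ p * t *
              (tailFun (powWeight p μ) t - tailFun (powWeight p μ) (t / 2))) / t) := by
              gcongr; exact hlow t ht ht1
          _ = (2 * C ^ p * D) *
              (tailFun (powWeight p μ) t - tailFun (powWeight p μ) (t / 2)) := by field_simp
          _ ≤ _ := by
              gcongr
              linarith
      rw [← inv_mul_le_iff₀ (by linarith)] at h1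
      linarith)
  refine ⟨(1 + ε) / p, β, by rw [div_mul_cancel₀ _ hp.ne']; linarith,
    hμ.monotone.measurable, fun t ht _ => hμ.tailFun_pos ht, ?_⟩
  obtain ⟨A, hA, hup⟩ := hP.bound
  set B := 2 * C ^ p * (F * D) with hB
  have hB0 : 0 < B := by positivity
  refine ⟨max A (B ^ (1 / p)), lt_max_of_lt_left hA, fun x y hy hxy hx => ⟨?_, ?_⟩⟩
  · have := hμ.tailFun_pos hy
    have := hy.trans_le hxy
    refine (hup x y hy hxy hx).1.trans ?_
    gcongr
    exact le_max_left _ _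
  · have hx0 := hy.trans_le hxy
    have hHy := hμ.tailFun_pos hy
    have hHx := hμ.tailFun_pos hx0
    have h0 := hw.tailFun_pos (half_pos hy)
    have h1 : tailFun μ y ^ p ≤ B * (y / x) ^ (1 + ε) * tailFun μ x ^ p := by
      calc _ ≤ 2 * C ^ p * y * (tailFun (powWeight p μ) y - tailFun (powWeight p μ) (y / 2)) :=
            hlow y hy (hxy.trans hx)
        _ ≤ 2 * C ^ p * y * tailFun (powWeight p μ) y := by gcongr; linarith
        _ ≤ 2 * C ^ p * y * (F * (y / x) ^ ε * (D * (tailFun μ x ^ p / x))) := by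
            gcongr
            exact (hlo x y hy hxy hx).trans (by gcongr; exact hle x hx0 hx)
        _ = _ := by
            rw [Real.rpow_add (div_pos hy hx0), Real.rpow_one, hB]
            field_simp
    have h8 := Real.rpow_le_rpow (by positivity) h1 (show 0 ≤ 1 / p by positivity)
    rw [Real.mul_rpow (by positivity) (by positivity), Real.mul_rpow hB0.le (by positivity),
      ← Real.rpow_mul hHy.le, ← Real.rpow_mul hHx.le, ← Real.rpow_mul (by positivity),
      mul_one_div_cancel hp.ne', Real.rpow_one, Real.rpow_one, mul_one_div] at h8
    refine h8.trans ?_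
    gcongr
    exact le_max_right _ _

end

/-! ### Moments of the weight -/

theorem setLIntegral_Ioo_one_sub (f : ℝ → ENNReal) :
    ∫⁻ u in Ioo (0 : ℝ) 1, f (1 - u) = ∫⁻ u in Ioo (0 : ℝ) 1, f u := by
  have := (Measure.measurePreserving_sub_left volume (1 : ℝ)).setLIntegral_comp_preimage_emb
    (MeasurableEquiv.subLeft (1 : ℝ)).measurableEmbedding f (Ioo 0 1)
  simpa using this

theorem one_sub_pow_le_exp {v : ℝ} (hv1 : v ≤ 1) (n : ℕ) :
    (1 - v) ^ n ≤ Real.exp 1 * Real.exp (-((n + 1) * v)) := by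
  calc (1 - v) ^ n ≤ Real.exp (-v) ^ n := by
        have := Real.add_one_le_exp (-v)
        exact pow_le_pow_left₀ (by linarith) (by linarith) n
    _ = Real.exp v * Real.exp (-((n + 1) * v)) := by
        rw [← Real.exp_nat_mul, ← Real.exp_add]; congr 1; ring
    _ ≤ _ := by gcongr

/-- A beta integral, dominated by a gamma integral through (1 - v)^n ≤ e · e^{-(n+1)v}. -/
theorem lintegral_pow_mul_rpow_le {a : ℝ} (ha : -1 < a) : ∃ C, 0 < C ∧ ∀ n : ℕ,
    ∫⁻ u in Ioo (0 : ℝ) 1, ENNReal.ofReal (u ^ n * (1 - u) ^ a) ≤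
      ENNReal.ofReal (C * ((n : ℝ) + 1) ^ (-(a + 1))) := by
  have hG : 0 < Real.Gamma (a + 1) := Real.Gamma_pos_of_pos (by linarith)
  refine ⟨Real.exp 1 * Real.Gamma (a + 1), by positivity, fun n => ?_⟩
  have hn : (0 : ℝ) < n + 1 := by positivity
  have key := Real.integral_rpow_mul_exp_neg_mul_Ioi (show 0 < a + 1 by linarith) hn
  have hint : IntegrableOn (fun t : ℝ => t ^ (a + 1 - 1) * Real.exp (-(((n : ℝ) + 1) * t)))
      (Ioi 0) := .of_integral_ne_zero (by rw [key]; positivity)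
  have h0 : 0 ≤ᵐ[volume.restrict (Ioi (0 : ℝ))]
      fun t : ℝ => t ^ (a + 1 - 1) * Real.exp (-(((n : ℝ) + 1) * t)) :=
    (ae_restrict_iff' measurableSet_Ioi).2 (Filter.Eventually.of_forall fun t ht => by
      have : 0 < t := ht
      positivity)
  rw [← setLIntegral_Ioo_one_sub]
  calc ∫⁻ u in Ioo (0 : ℝ) 1, ENNReal.ofReal ((1 - u) ^ n * (1 - (1 - u)) ^ a)
      ≤ ∫⁻ u in Ioo (0 : ℝ) 1, ENNReal.ofReal (Real.exp 1) *
          ENNReal.ofReal (u ^ (a + 1 - 1) * Real.exp (-(((n : ℝ) + 1) * u))) := by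
        refine setLIntegral_mono' measurableSet_Ioo fun u hu => ?_
        rw [← ENNReal.ofReal_mul (by positivity), add_sub_cancel_right, sub_sub_cancel]
        apply ENNReal.ofReal_le_ofReal
        have := one_sub_pow_le_exp hu.2.le n
        have h2 := Real.rpow_nonneg hu.1.le a
        nlinarith
    _ = ENNReal.ofReal (Real.exp 1) * ∫⁻ u in Ioo (0 : ℝ) 1,
          ENNReal.ofReal (u ^ (a + 1 - 1) * Real.exp (-(((n : ℝ) + 1) * u))) :=
        lintegral_const_mul' _ _ ENNReal.ofReal_ne_top
    _ ≤ ENNReal.ofReal (Real.exp 1) * ∫⁻ u in Ioi (0 : ℝ),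
          ENNReal.ofReal (u ^ (a + 1 - 1) * Real.exp (-(((n : ℝ) + 1) * u))) := by
        gcongr
        exact Ioo_subset_Ioi_self
    _ = _ := by
        rw [← ofReal_integral_eq_lintegral_ofReal hint h0, key, ← ENNReal.ofReal_mul (by positivity),
          one_div, Real.inv_rpow hn.le, Real.rpow_neg hn.le]
        congr 1
        ring

/-- The moments of `μ` against `s ^ (2 * n + 1) * (1 - s ^ 2) ^ i`. -/
noncomputable def momentSeq (μ : ℝ → ℝ) (i n : ℕ) : ℝ :=
  ∫ s in Ico (0 : ℝ) 1, s ^ (2 * n + 1) * (1 - s ^ 2) ^ i * μ s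

theorem moment_eq_momentSeq (μ : ℝ → ℝ) (n : ℕ) :
    moment μ (2 * (n : ℝ) + 1) = momentSeq μ 0 n := by
  refine integral_congr_ae (Filter.Eventually.of_forall fun s => ?_)
  simp only [pow_zero, mul_one]
  rw [← Real.rpow_natCast]
  push_cast
  rfl

theorem integrableOn_continuous_mul {μ g : ℝ → ℝ} (hμ : IntegrableOn μ (Ico 0 1))
    (hg : Continuous g) : IntegrableOn (fun s => g s * μ s) (Ico 0 1) :=
  hμ.continuousOn_mul_of_subset hg.continuousOn isCompact_Icc measurableSet_Ico Ico_subset_Icc_self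

/-- Since s^{2n+3} - s^{2n+1} = -s^{2n+1}(1 - s^2), differences of moments are moments of the same
family. This is why moments are symbols. -/
theorem momentSeq_succ_sub {μ : ℝ → ℝ} (hμ : IntegrableOn μ (Ico 0 1)) (i n : ℕ) :
    momentSeq μ i (n + 1) - momentSeq μ i n = -momentSeq μ (i + 1) n := by
  rw [momentSeq, momentSeq, momentSeq, ← integral_sub (integrableOn_continuous_mul hμ (by fun_prop))
    (integrableOn_continuous_mul hμ (by fun_prop)), ← integral_neg]
  refine integral_congr_ae (Filter.Eventually.of_forall fun s => ?_)
  ring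

theorem IsRadialWeight.momentSeq_nonneg {μ : ℝ → ℝ} (hμ : IsRadialWeight μ) (i n : ℕ) :
    0 ≤ momentSeq μ i n :=
  setIntegral_nonneg measurableSet_Ico fun s hs => by
    have h1 := hμ.nonneg s hs
    have h2 := hs.1
    have h3 : 0 ≤ 1 - s ^ 2 := by nlinarith [hs.1, hs.2]
    positivity

/-- Layer-cake formula for the measure μ(s) ds: write s^{m+1} as the integral of (m+1)u^m over [0,
s] and exchange the integrals. -/
theorem lintegral_pow_mul_eq {μ : ℝ → ℝ} (hμ : IsRadialWeight μ) (m : ℕ) :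
    ∫⁻ s in Ico (0 : ℝ) 1, ENNReal.ofReal (s ^ (m + 1) * μ s) =
      ∫⁻ u in Ioo (0 : ℝ) 1, ENNReal.ofReal (((m : ℝ) + 1) * u ^ m * tail μ u) := by
  have hm : AEMeasurable (fun s => ENNReal.ofReal (μ s)) (volume.restrict (Ico (0 : ℝ) 1)) :=
    hμ.integrableOn.aestronglyMeasurable.aemeasurable.ennreal_ofReal
  set ν := (volume.restrict (Ico (0 : ℝ) 1)).withDensity fun s => ENNReal.ofReal (μ s) with hν
  have hnn : 0 ≤ᵐ[ν] fun s : ℝ => s := by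
    refine (withDensity_absolutelyContinuous _ _).ae_le ?_
    exact (ae_restrict_iff' measurableSet_Ico).2 (Filter.Eventually.of_forall fun s hs => hs.1)
  have h1 := lintegral_comp_eq_lintegral_meas_lt_mul ν hnn aemeasurable_id
    (g := fun t : ℝ => ((m : ℝ) + 1) * t ^ m) (fun t _ => by
      apply Continuous.intervalIntegrable; fun_prop)
    ((ae_restrict_iff' measurableSet_Ioi).2 (Filter.Eventually.of_forall fun t ht => by
      have : 0 < t := ht
      positivity))
  have h2 : ∫⁻ s in Ico (0 : ℝ) 1, ENNReal.ofReal (s ^ (m + 1) * μ s) =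
      ∫⁻ s, ENNReal.ofReal (∫ t in (0 : ℝ)..s, ((m : ℝ) + 1) * t ^ m) ∂ν := by
    have e : ∀ s : ℝ, ∫ t in (0 : ℝ)..s, ((m : ℝ) + 1) * t ^ m = s ^ (m + 1) := by
      intro s
      rw [intervalIntegral.integral_const_mul, integral_pow]
      field_simp
      ring
    simp only [e]
    rw [hν, lintegral_withDensity_eq_lintegral_mul₀ hm (by fun_prop)]
    refine setLIntegral_congr_fun measurableSet_Ico fun s hs => ?_
    have := hs.1
    simp only [Pi.mul_apply]
    rw [mul_comm, ENNReal.ofReal_mul' (by positivity)]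
  have h3 : ∀ t : ℝ, 0 < t → t < 1 → ν {a | t < a} = ENNReal.ofReal (tail μ t) := by
    intro t ht ht1
    have e : {a : ℝ | t < a} ∩ Ico 0 1 = Ioo t 1 := by
      ext a
      simp only [mem_inter_iff, mem_ofPred_eq, mem_Ico, mem_Ioo]
      constructor
      · rintro ⟨h, -, h'⟩; exact ⟨h, h'⟩
      · rintro ⟨h, h'⟩; exact ⟨h, by linarith, h'⟩
    change ν (Ioi t) = _
    rw [hν, withDensity_apply _ measurableSet_Ioi, Measure.restrict_restrict measurableSet_Ioi]
    change ∫⁻ a in {a : ℝ | t < a} ∩ Ico 0 1, _ = _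
    rw [e, tail, ofReal_integral_eq_lintegral_ofReal
      (hμ.integrableOn.mono_set (Ico_subset_Ico_left ht.le))
      ((ae_restrict_iff' measurableSet_Ico).2 (Filter.Eventually.of_forall fun x hx =>
        hμ.nonneg x ⟨ht.le.trans hx.1, hx.2⟩)), setLIntegral_congr Ioo_ae_eq_Ico]
  have h4 : ∀ t : ℝ, 1 ≤ t → ν {a | t < a} = 0 := by
    intro t ht
    have e : {a : ℝ | t < a} ∩ Ico 0 1 = ∅ := by
      ext a
      simp only [mem_inter_iff, mem_ofPred_eq, mem_Ico, mem_empty_iff_false, iff_false]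
      rintro ⟨h, -, h'⟩
      linarith
    change ν (Ioi t) = _
    rw [hν, withDensity_apply _ measurableSet_Ioi, Measure.restrict_restrict measurableSet_Ioi]
    change ∫⁻ a in {a : ℝ | t < a} ∩ Ico 0 1, _ = _
    rw [e, setLIntegral_empty]
  rw [h2]
  refine h1.trans ?_
  rw [← Ioo_union_Ici_eq_Ioi (zero_lt_one' ℝ), lintegral_union measurableSet_Ici
    (by rw [Set.disjoint_left]; intro x hx hx'; exact absurd hx.2 (not_lt.2 hx')),
    setLIntegral_congr_fun (g := fun _ => 0) measurableSet_Ici (fun t ht => by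
      change ν {a | t < a} * _ = 0; rw [h4 t ht, zero_mul]), lintegral_zero, add_zero]
  refine setLIntegral_congr_fun measurableSet_Ioo fun t ht => ?_
  have := ht.1
  rw [h3 t ht.1 ht.2, mul_comm, ← ENNReal.ofReal_mul (by positivity)]

/-- In the layer-cake integral, μ̂(u) is at most H(T)(1 + C((n+1)(1-u))^b) with T = 1/(n+1). The
beta integrals then cancel every power of n + 1. -/
theorem integral_pow_mul_le {μ : ℝ → ℝ} (hμ : IsRadialWeight μ) {b : ℝ} (hb : 0 ≤ b)
    (hP : PowerType (tailFun μ) 0 b) : ∃ C, 0 < C ∧ ∀ n : ℕ,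
      ∫ s in Ico (0 : ℝ) 1, s ^ (n + 1) * μ s ≤ C * tailFun μ (1 / ((n : ℝ) + 1)) := by
  obtain ⟨C, hC, hbd⟩ := hP.bound
  obtain ⟨D, hD, hβ⟩ := lintegral_pow_mul_rpow_le (show -1 < b by linarith)
  obtain ⟨F, hF, hβ0⟩ := lintegral_pow_mul_rpow_le (show (-1 : ℝ) < 0 by norm_num)
  refine ⟨F + C * D, by positivity, fun n => ?_⟩
  have hn : (0 : ℝ) < n + 1 := by positivity
  have hn1 : 1 / ((n : ℝ) + 1) ≤ 1 := by
    rw [div_le_one hn]; linarith [(n.cast_nonneg : (0 : ℝ) ≤ n)]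
  set T := 1 / ((n : ℝ) + 1) with hT
  have hT0 : 0 < T := by positivity
  have hH := hμ.tailFun_pos hT0
  rw [integral_eq_lintegral_of_nonneg_ae ((ae_restrict_iff' measurableSet_Ico).2
    (Filter.Eventually.of_forall fun x hx => mul_nonneg (pow_nonneg hx.1 _) (hμ.nonneg x hx)))
    (integrableOn_continuous_mul hμ.integrableOn (by fun_prop)).aestronglyMeasurable]
  refine ENNReal.toReal_le_of_le_ofReal (by positivity) ?_
  rw [lintegral_pow_mul_eq hμ]
  calc ∫⁻ u in Ioo (0 : ℝ) 1, ENNReal.ofReal (((n : ℝ) + 1) * u ^ n * tail μ u)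
      ≤ ∫⁻ u in Ioo (0 : ℝ) 1, (ENNReal.ofReal ((n + 1) * tailFun μ T) *
            ENNReal.ofReal (u ^ n * (1 - u) ^ (0 : ℝ)) +
          ENNReal.ofReal ((n + 1) * tailFun μ T * (C * (n + 1) ^ b)) *
            ENNReal.ofReal (u ^ n * (1 - u) ^ b)) := by
        refine setLIntegral_mono' measurableSet_Ioo fun u hu => ?_
        have hu0 := hu.1
        have hu1 : 0 < 1 - u := by linarith [hu.2]
        rw [← ENNReal.ofReal_mul (by positivity), ← ENNReal.ofReal_mul (by positivity),
          ← ENNReal.ofReal_add (by positivity) (by positivity), tail_eq_tailFun μ hu0.le,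
          Real.rpow_zero]
        apply ENNReal.ofReal_le_ofReal
        have h1 : tailFun μ (1 - u) ≤ tailFun μ T + C * ((n + 1) ^ b * (1 - u) ^ b) * tailFun μ T := by
          rcases le_total (1 - u) T with h | h
          · have := hμ.monotone h
            have : 0 ≤ C * (((n : ℝ) + 1) ^ b * (1 - u) ^ b) * tailFun μ T := by positivity
            linarith
          · have h2 := (hbd (1 - u) T hT0 h (by linarith)).1
            rw [hT, div_div_eq_mul_div, div_one, Real.mul_rpow hu1.le hn.le, ← hT] at h2
            linarith
        calc ((n : ℝ) + 1) * u ^ n * tailFun μ (1 - u) ≤ ((n : ℝ) + 1) * u ^ n *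
              (tailFun μ T + C * ((n + 1) ^ b * (1 - u) ^ b) * tailFun μ T) := by gcongr
          _ = _ := by ring
    _ = ENNReal.ofReal ((n + 1) * tailFun μ T) *
          (∫⁻ u in Ioo (0 : ℝ) 1, ENNReal.ofReal (u ^ n * (1 - u) ^ (0 : ℝ))) +
          ENNReal.ofReal ((n + 1) * tailFun μ T * (C * (n + 1) ^ b)) *
            ∫⁻ u in Ioo (0 : ℝ) 1, ENNReal.ofReal (u ^ n * (1 - u) ^ b) := by
        rw [lintegral_add_left (by fun_prop), lintegral_const_mul' _ _ ENNReal.ofReal_ne_top,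
          lintegral_const_mul' _ _ ENNReal.ofReal_ne_top]
    _ ≤ ENNReal.ofReal ((n + 1) * tailFun μ T) *
          ENNReal.ofReal (F * ((n : ℝ) + 1) ^ (-((0 : ℝ) + 1))) +
          ENNReal.ofReal ((n + 1) * tailFun μ T * (C * (n + 1) ^ b)) *
            ENNReal.ofReal (D * ((n : ℝ) + 1) ^ (-(b + 1))) := by
        gcongr
        · exact hβ0 n
        · exact hβ n
    _ = _ := by
        rw [← ENNReal.ofReal_mul (by positivity), ← ENNReal.ofReal_mul (by positivity),
          ← ENNReal.ofReal_add (by positivity) (by positivity)]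
        congr 1
        rw [zero_add, Real.rpow_neg hn.le, Real.rpow_neg hn.le, Real.rpow_add hn, Real.rpow_one]
        have := Real.rpow_pos_of_pos hn b
        field_simp

/-- Half of the power is spent on the factor: s^n (1 - s)^i ≲ (n+1)^{-i}. The other half, s^{n+1},
leaves the moment of `integral_pow_mul_le`. -/
theorem momentSeq_le {μ : ℝ → ℝ} (hμ : IsRadialWeight μ) {b : ℝ} (hb : 0 ≤ b)
    (hP : PowerType (tailFun μ) 0 b) (i : ℕ) : ∃ C, 0 < C ∧ ∀ n : ℕ,
      momentSeq μ i n ≤ C * (tailFun μ (1 / ((n : ℝ) + 1)) / ((n : ℝ) + 1) ^ i) := by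
  obtain ⟨C, hC, h⟩ := integral_pow_mul_le hμ hb hP
  refine ⟨2 ^ i * i.factorial * Real.exp 1 * C, by positivity, fun n => ?_⟩
  have hn : (0 : ℝ) < n + 1 := by positivity
  calc momentSeq μ i n ≤ ∫ s in Ico (0 : ℝ) 1,
        2 ^ i * i.factorial * Real.exp 1 / ((n : ℝ) + 1) ^ i * (s ^ (n + 1) * μ s) := by
        refine setIntegral_mono_on (integrableOn_continuous_mul hμ.integrableOn (by fun_prop))
          ((integrableOn_continuous_mul hμ.integrableOn (by fun_prop)).const_mul _)
          measurableSet_Ico fun s hs => ?_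
        have hs0 := hs.1
        have hs1 : 0 ≤ 1 - s := by linarith [hs.2]
        have hμs := hμ.nonneg s hs
        have h1 := Real.pow_div_factorial_le_exp (((n : ℝ) + 1) * (1 - s)) (by positivity) i
        have h2 := one_sub_pow_le_exp (show 1 - s ≤ 1 by linarith) n
        rw [sub_sub_cancel] at h2
        have h3 : s ^ n * (1 - s) ^ i ≤ i.factorial * Real.exp 1 / ((n : ℝ) + 1) ^ i := by
          rw [le_div_iff₀ (by positivity)]
          rw [div_le_iff₀ (by positivity), mul_pow] at h1
          calc s ^ n * (1 - s) ^ i * ((n : ℝ) + 1) ^ i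
              = s ^ n * (((n : ℝ) + 1) ^ i * (1 - s) ^ i) := by ring
            _ ≤ (Real.exp 1 * Real.exp (-(((n : ℝ) + 1) * (1 - s)))) *
                (Real.exp (((n : ℝ) + 1) * (1 - s)) * i.factorial) := by gcongr
            _ = i.factorial * Real.exp 1 *
                (Real.exp (-(((n : ℝ) + 1) * (1 - s))) * Real.exp (((n : ℝ) + 1) * (1 - s))) := by
                ring
            _ = _ := by rw [← Real.exp_add, neg_add_cancel, Real.exp_zero, mul_one]
        have h4 := one_sub_sq_pow_le hs0 (by linarith) i
        calc s ^ (2 * n + 1) * (1 - s ^ 2) ^ i * μ s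
            ≤ s ^ (2 * n + 1) * (2 ^ i * (1 - s) ^ i) * μ s := by gcongr
          _ = 2 ^ i * (s ^ n * (1 - s) ^ i) * (s ^ (n + 1) * μ s) := by ring
          _ ≤ 2 ^ i * (i.factorial * Real.exp 1 / ((n : ℝ) + 1) ^ i) * (s ^ (n + 1) * μ s) := by
              gcongr
          _ = _ := by ring
    _ = 2 ^ i * i.factorial * Real.exp 1 / ((n : ℝ) + 1) ^ i *
        ∫ s in Ico (0 : ℝ) 1, s ^ (n + 1) * μ s := integral_const_mul _ _
    _ ≤ 2 ^ i * i.factorial * Real.exp 1 / ((n : ℝ) + 1) ^ i *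
        (C * tailFun μ (1 / ((n : ℝ) + 1))) := by gcongr; exact h n
    _ = _ := by ring

/-- On [1 - t, 1) with t = 1/(2(n+1)), Bernoulli's inequality gives s^{n+1} ≥ 1/2, hence s^{2n+1} ≥
1/4. No doubling is used here. -/
theorem le_momentSeq_zero {μ : ℝ → ℝ} (hμ : IsRadialWeight μ) (n : ℕ) :
    tailFun μ (1 / (2 * ((n : ℝ) + 1))) ≤ 4 * momentSeq μ 0 n := by
  set t := 1 / (2 * ((n : ℝ) + 1)) with ht
  have hn : (0 : ℝ) < n + 1 := by positivity
  have ht0 : 0 < t := by positivity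
  have ht2 : t ≤ 1 / 2 := by
    rw [ht]
    apply one_div_le_one_div_of_le two_pos
    linarith [(n.cast_nonneg : (0 : ℝ) ≤ n)]
  have hhalf : 1 / 2 ≤ (1 - t) ^ (n + 1) := by
    have := one_add_mul_le_pow (a := -t) (by linarith) (n + 1)
    have e : ((n : ℝ) + 1) * t = 1 / 2 := by rw [ht]; field_simp
    push_cast at this
    rw [← sub_eq_add_neg] at this
    linarith
  have hq : 1 / 4 ≤ (1 - t) ^ (2 * n + 1) := by
    calc (1 / 4 : ℝ) = 1 / 2 * (1 / 2) := by norm_num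
      _ ≤ (1 - t) ^ (n + 1) * (1 - t) ^ (n + 1) := by gcongr
      _ = (1 - t) ^ (2 * n + 1) * (1 - t) := by ring
      _ ≤ (1 - t) ^ (2 * n + 1) * 1 := by
          have : 0 ≤ 1 - t := by linarith
          gcongr
          linarith
      _ = _ := mul_one _
  rw [tailFun_eq μ (by linarith), tail, momentSeq, ← integral_const_mul]
  calc ∫ s in Ico (1 - t) 1, μ s
      ≤ ∫ s in Ico (1 - t) 1, 4 * (s ^ (2 * n + 1) * (1 - s ^ 2) ^ 0 * μ s) := by
        have hsub : Ico (1 - t) 1 ⊆ Ico (0 : ℝ) 1 := Ico_subset_Ico_left (by linarith)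
        refine setIntegral_mono_on (hμ.integrableOn.mono_set hsub)
          (IntegrableOn.mono_set ((integrableOn_continuous_mul hμ.integrableOn
            (g := fun s => s ^ (2 * n + 1) * (1 - s ^ 2) ^ 0) (by fun_prop)).const_mul 4) hsub)
          measurableSet_Ico fun s hs => ?_
        have h1 := hμ.nonneg s (hsub hs)
        have h2 : (1 - t) ^ (2 * n + 1) ≤ s ^ (2 * n + 1) :=
          pow_le_pow_left₀ (by linarith) hs.1 _
        rw [pow_zero, mul_one]
        nlinarith
    _ ≤ _ := by
        refine setIntegral_mono_set
          ((integrableOn_continuous_mul hμ.integrableOn (by fun_prop)).const_mul _) ?_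
          (Ico_subset_Ico_left (by linarith)).eventuallyLE
        refine (ae_restrict_iff' measurableSet_Ico).2 (Filter.Eventually.of_forall fun s hs => ?_)
        have h1 := hμ.nonneg s hs
        have h2 := hs.1
        simp only [pow_zero, mul_one, Pi.zero_apply]
        positivity

theorem momentSeq_zero_pos {μ : ℝ → ℝ} (hμ : IsRadialWeight μ) (n : ℕ) : 0 < momentSeq μ 0 n := by
  have := le_momentSeq_zero hμ n
  have := hμ.tailFun_pos (t := 1 / (2 * ((n : ℝ) + 1))) (by positivity)
  linarith

theorem PowerType.regularSeq {A : ℝ → ℝ} {a b : ℝ} (hA : PowerType A a b) :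
    RegularSeq fun n => A (1 / ((n : ℝ) + 1)) := by
  have hle : ∀ n : ℕ, 1 / ((n : ℝ) + 1) ≤ 1 := fun n => by
    rw [div_le_one (by positivity)]; linarith [(n.cast_nonneg : (0 : ℝ) ≤ n)]
  have hanti : ∀ n : ℕ, 1 / (((n + 1 : ℕ) : ℝ) + 1) ≤ 1 / ((n : ℝ) + 1) := fun n =>
    one_div_le_one_div_of_le (by positivity) (by push_cast; linarith)
  have htwo : ∀ n : ℕ, 1 / ((n : ℝ) + 1) ≤ 2 * (1 / (((n + 1 : ℕ) : ℝ) + 1)) := fun n => by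
    rw [mul_one_div, div_le_div_iff₀ (by positivity) (by positivity)]
    push_cast
    linarith [(n.cast_nonneg : (0 : ℝ) ≤ n)]
  obtain ⟨C, hC, h⟩ := hA.le_of_le_two_mul
  obtain ⟨D, hD, h'⟩ := hA.inv.le_of_le_two_mul
  refine ⟨fun n => hA.pos _ (by positivity) (hle n), ⟨D, hD, fun n => ?_⟩, ⟨C, hC, fun n =>
    h _ _ (by positivity) (hanti n) (htwo n) (hle n)⟩⟩
  have h1 := h' _ _ (by positivity) (hanti n) (htwo n) (hle n)
  have p1 := hA.pos _ (by positivity) (hle n)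
  have p2 := hA.pos (1 / (((n + 1 : ℕ) : ℝ) + 1)) (by positivity) (hle (n + 1))
  rwa [← div_eq_mul_inv, le_div_iff₀ p2, inv_mul_le_iff₀ p1, mul_comm] at h1

/-- The induction on the order runs over all i at once, because a difference raises i by one. -/
theorem symbolClass_momentSeq {μ : ℝ → ℝ} (hμ : IsRadialWeight μ) {b : ℝ} (hb : 0 ≤ b)
    (hP : PowerType (tailFun μ) 0 b) (j : ℕ) :
    SymbolClass j (fun n => tailFun μ (1 / ((n : ℝ) + 1))) fun n => momentSeq μ 0 n := by
  have key : ∀ j i : ℕ, SymbolClass j (fun n => tailFun μ (1 / ((n : ℝ) + 1)) / ((n : ℝ) + 1) ^ i)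
      fun n => momentSeq μ i n := by
    intro j
    induction j with
    | zero =>
      intro i
      obtain ⟨C, hC, h⟩ := momentSeq_le hμ hb hP i
      exact ⟨C, hC, fun n => by rw [abs_of_nonneg (hμ.momentSeq_nonneg i n)]; exact h n⟩
    | succ j ih =>
      intro i
      obtain ⟨C, hC, h⟩ := momentSeq_le hμ hb hP i
      refine ⟨⟨C, hC, fun n => by rw [abs_of_nonneg (hμ.momentSeq_nonneg i n)]; exact h n⟩, ?_⟩
      simp only [momentSeq_succ_sub hμ.integrableOn, div_div, ← pow_succ]
      simpa using (ih (i + 1)).const_mul (-1)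
  simpa using key j 0

theorem le_mul_momentSeq_zero {μ : ℝ → ℝ} (hμ : IsRadialWeight μ) {b : ℝ}
    (hP : PowerType (tailFun μ) 0 b) :
    ∃ c, 0 < c ∧ ∀ n : ℕ, c * tailFun μ (1 / ((n : ℝ) + 1)) ≤ momentSeq μ 0 n := by
  obtain ⟨C, hC, h⟩ := hP.le_of_le_two_mul
  refine ⟨(4 * C)⁻¹, by positivity, fun n => ?_⟩
  have h1 := le_momentSeq_zero hμ n
  have hn : (0 : ℝ) < n + 1 := by positivity
  have h2 := h (1 / ((n : ℝ) + 1)) (1 / (2 * ((n : ℝ) + 1))) (by positivity)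
    (one_div_le_one_div_of_le hn (by linarith)) (le_of_eq (by field_simp))
    (by rw [div_le_one hn]; linarith [(n.cast_nonneg : (0 : ℝ) ≤ n)])
  rw [inv_mul_le_iff₀ (by positivity)]
  nlinarith

/-! ### Weighted energies and the two norms -/

theorem lintegral_areaMeasure_radial {h : ℝ → ENNReal} (hh : Measurable h) :
    ∫⁻ z, h ‖z‖ ∂areaMeasure = 2 * ∫⁻ r in Ioo (0 : ℝ) 1, ENNReal.ofReal r * h r := by
  rw [lintegral_areaMeasure, disc, lintegral_ball_polar (f := fun z => h ‖z‖)
    (hh.comp measurable_norm)]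
  have key : ∀ r ∈ Ioo (0 : ℝ) 1, ENNReal.ofReal r * ∫⁻ θ in Ioo (-Real.pi) Real.pi,
      h ‖circleMap 0 r θ‖ = ENNReal.ofReal (2 * Real.pi) * (ENNReal.ofReal r * h r) := by
    rintro r ⟨hr0, hr1⟩
    simp only [norm_circleMap_zero, abs_of_pos hr0, lintegral_const, Measure.restrict_apply_univ,
      Real.volume_Ioo, sub_neg_eq_add, ← two_mul]
    ring
  rw [setLIntegral_congr_fun measurableSet_Ioo key,
    lintegral_const_mul' _ _ ENNReal.ofReal_ne_top, ← mul_assoc, ← ENNReal.ofReal_mul (by positivity)]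
  congr 1
  rw [mul_comm 2, ← mul_assoc, inv_mul_cancel₀ Real.pi_pos.ne', one_mul]
  norm_num

/-- The weighted energy of `G` with weight `A(1 - |w|)ᵖ (1 - |w|)⁻²`. -/
noncomputable def energy (p : ℝ) (A : ℝ → ℝ) (G : ℂ → ℂ) : ENNReal :=
  ∫⁻ w, ENNReal.ofReal (‖G w‖ ^ p * (A (1 - ‖w‖) ^ p * (1 - ‖w‖) ^ (-2 : ℝ))) ∂areaMeasure

theorem ofReal_norm_rpow {p : ℝ} (hp : 0 ≤ p) (z : ℂ) : ENNReal.ofReal (‖z‖ ^ p) = ‖z‖ₑ ^ p := by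
  rw [← ofReal_norm, ENNReal.ofReal_rpow_of_nonneg (norm_nonneg _) hp]

theorem energy_eq {p : ℝ} (hp : 0 ≤ p) (A : ℝ → ℝ) (G : ℂ → ℂ) :
    energy p A G = ∫⁻ w, ‖G w‖ₑ ^ p *
      ENNReal.ofReal (A (1 - ‖w‖) ^ p * (1 - ‖w‖) ^ (-2 : ℝ)) ∂areaMeasure := by
  refine lintegral_congr fun w => ?_
  rw [ENNReal.ofReal_mul (by positivity), ofReal_norm_rpow hp]

theorem lintegral_enorm_rpow_mul_le {p C : ℝ} (hC : 0 ≤ C) {W V : ℂ → ℝ}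
    (h : ∀ z ∈ disc, W z ≤ C * V z) (F : ℂ → ℂ) :
    ∫⁻ z, ‖F z‖ₑ ^ p * ENNReal.ofReal (W z) ∂areaMeasure ≤
      ENNReal.ofReal C * ∫⁻ z, ‖F z‖ₑ ^ p * ENNReal.ofReal (V z) ∂areaMeasure := by
  rw [← lintegral_const_mul' _ _ ENNReal.ofReal_ne_top]
  refine lintegral_mono_ae (ae_areaMeasure_mem.mono fun z hz => ?_)
  rw [mul_left_comm, ← ENNReal.ofReal_mul hC]
  gcongr
  exact h z hz

theorem rpow_le_two_rpow_abs {x c : ℝ} (hx : 1 ≤ x) (hx2 : x ≤ 2) : x ^ c ≤ 2 ^ |c| :=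
  (Real.rpow_le_rpow_of_exponent_le hx (le_abs_self c)).trans
    (Real.rpow_le_rpow (by linarith) hx2 (abs_nonneg c))

theorem one_sub_sq_rpow_le {r c : ℝ} (hr : 0 ≤ r) (hr1 : r < 1) :
    (1 - r ^ 2) ^ c ≤ 2 ^ |c| * (1 - r) ^ c := by
  have h : 1 - r ^ 2 = (1 + r) * (1 - r) := by ring
  rw [h, Real.mul_rpow (by linarith) (by linarith)]
  exact mul_le_mul_of_nonneg_right (rpow_le_two_rpow_abs (by linarith) (by linarith))
    (Real.rpow_nonneg (by linarith) _)

theorem rpow_one_sub_le {r c : ℝ} (hr : 0 ≤ r) (hr1 : r < 1) :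
    (1 - r) ^ c ≤ 2 ^ |c| * (1 - r ^ 2) ^ c := by
  have h : 1 - r = (1 + r)⁻¹ * (1 - r ^ 2) := by
    have : 1 + r ≠ 0 := by linarith
    field_simp
    ring
  have h1 : 0 < 1 - r ^ 2 := by nlinarith
  rw [h, Real.mul_rpow (by positivity) h1.le, Real.inv_rpow (by positivity),
    ← Real.rpow_neg (by positivity), ← abs_neg]
  exact mul_le_mul_of_nonneg_right (rpow_le_two_rpow_abs (by linarith) (by linarith))
    (Real.rpow_nonneg h1.le _)

theorem pow_weight_eq {t p : ℝ} (ht : 0 < t) (k : ℕ) :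
    (t ^ (k : ℝ)) ^ p * t ^ (-2 : ℝ) = t ^ ((k : ℝ) * p - 2) := by
  rw [← Real.rpow_mul ht.le, ← Real.rpow_add ht]
  rfl

theorem lintegral_besov_le_energy {p : ℝ} (hp : 0 ≤ p) (k : ℕ) (F : ℂ → ℂ) :
    ∫⁻ z, ‖F z‖ₑ ^ p * ENNReal.ofReal ((1 - ‖z‖ ^ 2) ^ ((k : ℝ) * p - 2)) ∂areaMeasure ≤
      ENNReal.ofReal (2 ^ |(k : ℝ) * p - 2|) * energy p (fun t => t ^ (k : ℝ)) F := by
  rw [energy_eq hp]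
  refine lintegral_enorm_rpow_mul_le (by positivity) (fun z hz => ?_) F
  have h1 := mem_disc.1 hz
  rw [pow_weight_eq (by linarith)]
  exact one_sub_sq_rpow_le (norm_nonneg z) h1

theorem energy_le_lintegral_besov {p : ℝ} (hp : 0 ≤ p) (k : ℕ) (F : ℂ → ℂ) :
    energy p (fun t => t ^ (k : ℝ)) F ≤ ENNReal.ofReal (2 ^ |(k : ℝ) * p - 2|) *
      ∫⁻ z, ‖F z‖ₑ ^ p * ENNReal.ofReal ((1 - ‖z‖ ^ 2) ^ ((k : ℝ) * p - 2)) ∂areaMeasure := by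
  rw [energy_eq hp]
  refine lintegral_enorm_rpow_mul_le (by positivity) (fun z hz => ?_) F
  have h1 := mem_disc.1 hz
  rw [pow_weight_eq (by linarith)]
  exact rpow_one_sub_le (norm_nonneg z) h1

theorem lintegral_fracBesov_le_energy {μ : ℝ → ℝ} (hμ : IsRadialWeight μ) {p : ℝ} (hp : 0 ≤ p)
    (F : ℂ → ℂ) :
    ∫⁻ z, ‖F z‖ₑ ^ p * ENNReal.ofReal (tail μ ‖z‖ ^ p / (1 - ‖z‖ ^ 2) ^ 2) ∂areaMeasure ≤
      energy p (tailFun μ) F := by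
  rw [energy_eq hp]
  refine (lintegral_enorm_rpow_mul_le zero_le_one (fun z hz => ?_) F).trans (by
    rw [ENNReal.ofReal_one, one_mul])
  have h1 := mem_disc.1 hz
  have h0 := norm_nonneg z
  have h2 : 0 < 1 - ‖z‖ := by linarith
  have h3 := tailFun_nonneg hμ.nonneg (1 - ‖z‖)
  rw [one_mul, tail_eq_tailFun μ h0, Real.rpow_neg h2.le, ← div_eq_mul_inv, Real.rpow_two]
  gcongr
  nlinarith

theorem energy_le_lintegral_fracBesov {μ : ℝ → ℝ} (hμ : IsRadialWeight μ) {p : ℝ} (hp : 0 ≤ p)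
    (F : ℂ → ℂ) :
    energy p (tailFun μ) F ≤ ENNReal.ofReal 4 *
      ∫⁻ z, ‖F z‖ₑ ^ p * ENNReal.ofReal (tail μ ‖z‖ ^ p / (1 - ‖z‖ ^ 2) ^ 2) ∂areaMeasure := by
  rw [energy_eq hp]
  refine lintegral_enorm_rpow_mul_le (by norm_num) (fun z hz => ?_) F
  have h1 := mem_disc.1 hz
  have h0 := norm_nonneg z
  have h2 : 0 < 1 - ‖z‖ := by linarith
  have h3 := Real.rpow_nonneg (tailFun_nonneg hμ.nonneg (1 - ‖z‖)) p
  have h4 : 0 < 1 - ‖z‖ ^ 2 := by nlinarith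
  rw [tail_eq_tailFun μ h0, Real.rpow_neg h2.le, ← div_eq_mul_inv, Real.rpow_two, mul_div_assoc',
    div_le_div_iff₀ (by positivity) (by positivity)]
  have h5 : (1 - ‖z‖ ^ 2) ^ 2 ≤ 4 * (1 - ‖z‖) ^ 2 := by
    have : 1 - ‖z‖ ^ 2 ≤ 2 * (1 - ‖z‖) := by nlinarith
    nlinarith
  nlinarith

theorem sum_rpow_le {p : ℝ} (hp : 0 < p) (k : ℕ) (x : ℕ → ENNReal) :
    (∑ i ∈ Finset.range k, x i) ^ p ≤ (k : ENNReal) ^ p * ∑ i ∈ Finset.range k, x i ^ p := by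
  rcases Nat.eq_zero_or_pos k with rfl | hk
  · simp [ENNReal.zero_rpow_of_pos hp]
  obtain ⟨m, hm, hmax⟩ := Finset.exists_max_image (Finset.range k) x ⟨0, by simpa using hk⟩
  calc (∑ i ∈ Finset.range k, x i) ^ p ≤ (k * x m) ^ p := by
        gcongr
        simpa using Finset.sum_le_card_nsmul _ _ _ hmax
    _ = (k : ENNReal) ^ p * x m ^ p := ENNReal.mul_rpow_of_nonneg _ _ hp.le
    _ ≤ _ := by
        gcongr
        exact Finset.single_le_sum (f := fun i => x i ^ p) (fun _ _ => zero_le) hm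

theorem add_rpow_le {p : ℝ} (hp : 0 < p) (x y : ENNReal) :
    (x + y) ^ p ≤ (2 : ENNReal) ^ p * (x ^ p + y ^ p) := by
  simpa [Finset.sum_range_succ] using sum_rpow_le hp 2 fun i => if i = 0 then x else y

theorem exists_nnreal_rpow_le {p : ℝ} {C : ENNReal} (hp : 0 < p) (hC : C ≠ ⊤) :
    ∃ D : NNReal, 0 < D ∧ ∀ X Y : ENNReal, X ≤ C * Y →
      X ^ (1 / p) ≤ (D : ENNReal) * Y ^ (1 / p) := by
  have hp' : 0 ≤ 1 / p := by positivity
  refine ⟨C.toNNReal ^ (1 / p) + 1, by positivity, fun X Y h => ?_⟩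
  calc X ^ (1 / p) ≤ (C * Y) ^ (1 / p) := by gcongr
    _ = C ^ (1 / p) * Y ^ (1 / p) := ENNReal.mul_rpow_of_nonneg _ _ hp'
    _ ≤ _ := by
        gcongr
        conv_lhs => rw [← ENNReal.coe_toNNReal hC]
        rw [← ENNReal.coe_rpow_of_nonneg _ hp']
        exact_mod_cast le_self_add

theorem besovOrder_spec {p : ℝ} (hp : 0 < p) : 1 < (besovOrder p : ℝ) * p := by
  obtain ⟨n, hn⟩ := exists_nat_gt (1 / p)
  exact Nat.sInf_mem (s := {n : ℕ | 1 < (n : ℝ) * p}) ⟨n, by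
    rwa [div_lt_iff₀ hp] at hn⟩

/-! ### The fractional derivative as a coefficient multiplier -/

theorem IsAnalytic.summable_norm_coeff {f : ℂ → ℂ} (hf : IsAnalytic f) {r : ℝ} (hr : 0 ≤ r)
    (hr1 : r < 1) (m : ℕ) : Summable fun n : ℕ => ((n : ℝ) + 1) ^ m * ‖coeff f n‖ * r ^ n := by
  obtain ⟨s, hrs, hs1⟩ := exists_between hr1
  have hs0 : 0 < s := hr.trans_lt hrs
  have h1 := (hf.hasSum (z := (s : ℂ)) (by
    rw [mem_disc, Complex.norm_real, Real.norm_of_nonneg hs0.le]; exact hs1)).summable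
  obtain ⟨M, hM⟩ := h1.tendsto_atTop_zero.norm.bddAbove_range
  have hM' : ∀ n, ‖coeff f n‖ * s ^ n ≤ M := fun n => by
    have := hM ⟨n, rfl⟩
    simpa [norm_mul, norm_pow, Complex.norm_real, abs_of_pos hs0] using this
  refine Summable.of_nonneg_of_le (fun n => by positivity) (fun n => ?_)
    ((summable_succ_pow_mul m (div_nonneg hr hs0.le) ((div_lt_one hs0).2 hrs)).1.mul_left M)
  have e : r ^ n = (r / s) ^ n * s ^ n := by rw [← mul_pow, div_mul_cancel₀ _ hs0.ne']
  calc ((n : ℝ) + 1) ^ m * ‖coeff f n‖ * r ^ n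
      = ((n : ℝ) + 1) ^ m * (r / s) ^ n * (‖coeff f n‖ * s ^ n) := by rw [e]; ring
    _ ≤ ((n : ℝ) + 1) ^ m * (r / s) ^ n * M := by gcongr; exact hM' n
    _ = _ := by ring

theorem factorial_add_div (n k : ℕ) : ((n + k).factorial / n.factorial : ℝ) =
    ∏ i ∈ Finset.range k, ((n : ℝ) + (1 + i)) := by
  induction k with
  | zero => simp [Nat.factorial_ne_zero]
  | succ k ih =>
    rw [Finset.prod_range_succ, ← ih, ← add_assoc, Nat.factorial_succ]
    push_cast
    ring

theorem symbolClass_inv_momentSeq {μ : ℝ → ℝ} (hμ : IsRadialWeight μ) {b : ℝ} (hb : 0 ≤ b)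
    (hP : PowerType (tailFun μ) 0 b) (j : ℕ) :
    SymbolClass j (fun n => (tailFun μ (1 / ((n : ℝ) + 1)))⁻¹) fun n => (momentSeq μ 0 n)⁻¹ :=
  (symbolClass_momentSeq hμ hb hP j).inv hP.regularSeq (le_mul_momentSeq_zero hμ hP)

theorem inv_momentSeq_le {μ : ℝ → ℝ} (hμ : IsRadialWeight μ) {b : ℝ}
    (hP : PowerType (tailFun μ) 0 b) :
    ∃ C, 0 < C ∧ ∃ m : ℕ, ∀ n, (momentSeq μ 0 n)⁻¹ ≤ C * ((n : ℝ) + 1) ^ m := by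
  obtain ⟨c, hc, h⟩ := le_mul_momentSeq_zero hμ hP
  obtain ⟨m, hm⟩ := exists_nat_ge b
  obtain ⟨D, hD, h'⟩ := hP.pow_le_mul hm
  refine ⟨c⁻¹ * D, by positivity, m, fun n => ?_⟩
  have hn : (0 : ℝ) < n + 1 := by positivity
  have h1 := h' (1 / ((n : ℝ) + 1)) (by positivity) (by
    rw [div_le_one hn]; linarith [(n.cast_nonneg : (0 : ℝ) ≤ n)])
  have hpos := momentSeq_zero_pos hμ n
  rw [one_div, inv_pow] at h1
  rw [inv_le_iff_one_le_mul₀ hpos]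
  have h2 := h n
  rw [one_div] at h2
  calc (1 : ℝ) = ((n : ℝ) + 1) ^ m * (((n : ℝ) + 1) ^ m)⁻¹ := by field_simp
    _ ≤ ((n : ℝ) + 1) ^ m * (D * tailFun μ ((n : ℝ) + 1)⁻¹) := by gcongr
    _ = c⁻¹ * D * ((n : ℝ) + 1) ^ m * (c * tailFun μ ((n : ℝ) + 1)⁻¹) := by field_simp
    _ ≤ _ := by gcongr

theorem fracDeriv_eq (μ : ℝ → ℝ) (f : ℂ → ℂ) (z : ℂ) :
    fracDeriv μ f z = ∑' n, coeff f n / ((momentSeq μ 0 n : ℝ) : ℂ) * z ^ n := by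
  simp only [fracDeriv, moment_eq_momentSeq]

section

variable {μ : ℝ → ℝ} (hμ : IsRadialWeight μ) {b : ℝ} (hP : PowerType (tailFun μ) 0 b)
include hμ hP

theorem summable_fracDeriv {f : ℂ → ℂ} (hf : IsAnalytic f) {r : ℝ} (hr : 0 ≤ r) (hr1 : r < 1) :
    Summable fun n => ‖coeff f n / ((momentSeq μ 0 n : ℝ) : ℂ)‖ * r ^ n := by
  obtain ⟨C, hC, m, h⟩ := inv_momentSeq_le hμ hP
  refine Summable.of_nonneg_of_le (fun n => by positivity) (fun n => ?_)
    ((hf.summable_norm_coeff hr hr1 m).mul_left C)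
  rw [norm_div, Complex.norm_real, Real.norm_of_nonneg (momentSeq_zero_pos hμ n).le,
    div_eq_mul_inv]
  calc _ ≤ ‖coeff f n‖ * (C * ((n : ℝ) + 1) ^ m) * r ^ n := by gcongr; exact h n
    _ = _ := by ring

theorem hasSum_fracDeriv {f : ℂ → ℂ} (hf : IsAnalytic f) {z : ℂ} (hz : z ∈ disc) :
    HasSum (fun n => coeff f n / ((momentSeq μ 0 n : ℝ) : ℂ) * z ^ n) (fracDeriv μ f z) := by
  rw [fracDeriv_eq]
  refine Summable.hasSum (Summable.of_norm ?_)
  simpa [norm_mul, norm_pow, norm_div] using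
    summable_fracDeriv hμ hP hf (norm_nonneg z) (mem_disc.1 hz)

theorem isAnalytic_fracDeriv {f : ℂ → ℂ} (hf : IsAnalytic f) : IsAnalytic (fracDeriv μ f) := by
  rw [show fracDeriv μ f = _ from funext (fracDeriv_eq μ f)]
  exact isAnalytic_tsum fun r hr hr1 => summable_fracDeriv hμ hP hf hr hr1

theorem coeff_fracDeriv {f : ℂ → ℂ} (hf : IsAnalytic f) (n : ℕ) :
    coeff (fracDeriv μ f) n = coeff f n / ((momentSeq μ 0 n : ℝ) : ℂ) :=
  coeff_of_hasSum (fun _ hz => hasSum_fracDeriv hμ hP hf hz) n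

end

theorem one_div_rpow_natCast_inv (n k : ℕ) :
    ((1 / ((n : ℝ) + 1)) ^ (k : ℝ))⁻¹ = ((n : ℝ) + 1) ^ k := by
  rw [Real.rpow_natCast, one_div, inv_pow, inv_inv]

theorem exists_nat_two_le (p : ℝ) (hp : 0 < p) : ∃ N : ℕ, 2 ≤ N ∧ 2 ≤ (N : ℝ) * p := by
  obtain ⟨n, hn⟩ := exists_nat_ge (2 / p)
  refine ⟨max 2 n, le_max_left _ _, ?_⟩
  rw [div_le_iff₀ hp] at hn
  refine hn.trans ?_
  gcongr
  exact le_max_right _ _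

theorem PowerType.of_le {A : ℝ → ℝ} {γ β γ' β' : ℝ} (hA : PowerType A γ β) (hγ : γ' ≤ γ)
    (hβ : β ≤ β') : PowerType A γ' β' where
  measurable := hA.measurable
  pos := hA.pos
  bound := by
    obtain ⟨C, hC, h⟩ := hA.bound
    refine ⟨C, hC, fun x y hy hxy hx => ?_⟩
    have hx0 := hy.trans_le hxy
    have p1 := hA.pos x hx0 hx
    have p2 := hA.pos y hy (hxy.trans hx)
    obtain ⟨h1, h2⟩ := h x y hy hxy hx
    refine ⟨h1.trans ?_, h2.trans ?_⟩
    · have := Real.rpow_le_rpow_of_exponent_le ((one_le_div hy).2 hxy) hβ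
      gcongr
    · have := Real.rpow_le_rpow_of_exponent_ge (div_pos hy hx0) ((div_le_one hx0).2 hxy) hγ
      gcongr

theorem PowerType.exists_nonneg {A : ℝ → ℝ} {γ β p : ℝ} (hA : PowerType A γ β) (hp : 0 < p)
    (hγ : 1 < γ * p) : ∃ b, 0 ≤ b ∧ PowerType A 0 b :=
  ⟨max β 0, le_max_right _ _, hA.of_le (by by_contra! h; nlinarith) (le_max_left _ _)⟩

section

variable {μ : ℝ → ℝ} (hμ : IsRadialWeight μ) {p γ β : ℝ} (hp : 0 < p) (hγ : 1 < γ * p)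
  (hP : PowerType (tailFun μ) γ β)
include hμ hp hγ hP

/-- The n-th coefficient of u is that of f^{(k)} divided by (n+1)…(n+k) and by the moment of index n
+ k. This is a smooth symbol, so the multiplier theorem applies with source weight t^k and target
weight H; the hypothesis 1 < γp is its condition on the target. -/
theorem energy_fracDeriv_tail_le {k : ℕ} (hk : 1 ≤ k) : ∃ C, 0 < C ∧ ∀ f u : ℂ → ℂ,
    IsAnalytic f → (∀ z ∈ disc, u z =
      ∑' n, coeff f (n + k) / ((momentSeq μ 0 (n + k) : ℝ) : ℂ) * z ^ n) →
    energy p (tailFun μ) u ≤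
      ENNReal.ofReal C * energy p (fun t => t ^ (k : ℝ)) (iteratedDeriv k f) := by
  obtain ⟨β', hβ', hP'⟩ := hP.exists_nonneg hp hγ
  have hγ0 : 0 < γ := by by_contra! h; nlinarith
  obtain ⟨N, hN, hNp⟩ := exists_nat_two_le p hp
  set b := N + k - 1 with hb
  have hbe : b + 1 = N + k := by omega
  have hkb : (k : ℝ) ≤ b := by
    have : k ≤ b := by omega
    exact_mod_cast this
  -- The first two factors are the actual multiplier. The last one is the inverse of `betaMoment b
  -- n`, which the integral representation multiplies back.
  set S : ℕ → ℝ := fun n => (momentSeq μ 0 (n + k))⁻¹ *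
    (∏ i ∈ Finset.range k, ((n : ℝ) + (1 + i)))⁻¹ *
    ((b.factorial : ℝ)⁻¹ * ∏ i ∈ Finset.range (b + 1), ((n : ℝ) + (1 + i))) with hSdef
  have hS : SymbolClass N (fun n => ((n : ℝ) + 1) ^ (b + 1) *
      ((1 / ((n : ℝ) + 1)) ^ (k : ℝ) * (tailFun μ (1 / ((n : ℝ) + 1)))⁻¹)) S := by
    have s1 := (symbolClass_inv_momentSeq hμ hβ' hP' N).shift_add hP'.regularSeq.inv k
    have s2 := (SymbolClass.prod_add_const N k fun i => 1 + (i : ℝ)).inv (RegularSeq.succ.pow k)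
      ⟨1, one_pos, fun n => by
        rw [one_mul]
        calc ((n : ℝ) + 1) ^ k = ∏ _i ∈ Finset.range k, ((n : ℝ) + 1) := by simp
          _ ≤ _ := Finset.prod_le_prod (fun _ _ => by positivity) fun i _ => by
            linarith [(i.cast_nonneg : (0 : ℝ) ≤ i)]⟩
    have s3 := (SymbolClass.prod_add_const N (b + 1) fun i => 1 + (i : ℝ)).const_mul
      (b.factorial : ℝ)⁻¹
    have s12 := s1.mul hP'.regularSeq.inv (RegularSeq.succ.pow k).inv s2
    have s := s12.mul (hP'.regularSeq.inv.mul (RegularSeq.succ.pow k).inv)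
      (RegularSeq.succ.pow (b + 1)) s3
    refine s.mono ⟨1, one_pos, fun n => le_of_eq ?_⟩
    rw [← one_div_rpow_natCast_inv n k, inv_inv]
    ring
  obtain ⟨C, hC, h⟩ := lintegral_multiplier_le (.rpow_id k) hP hp hγ hN hNp
    (by linarith : (k : ℝ) - γ ≤ (k : ℕ)) hbe hkb 0 hS
  refine ⟨C, hC, fun f u hf hu => h _ (hf.iteratedDeriv k) u fun z hz => ?_⟩
  rw [hu z hz]
  refine tsum_congr fun n => ?_
  rw [add_zero, coeff_iteratedDeriv, ← mul_assoc]
  congr 1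
  have hm := (momentSeq_zero_pos hμ (n + k)).ne'
  have key : S n * betaMoment b n * ((n + k).factorial / n.factorial) =
      (momentSeq μ 0 (n + k))⁻¹ := by
    rw [factorial_add_div, hSdef, betaMoment]
    have h1 := (prod_range_add_pos k n).ne'
    have h2 := (prod_range_add_pos (b + 1) n).ne'
    have h3 : (b.factorial : ℝ) ≠ 0 := by exact_mod_cast b.factorial_ne_zero
    field_simp
  rw [← Complex.ofReal_mul, key, Complex.ofReal_inv, div_eq_inv_mul]

/-- The reverse passage, with source weight H and target weight t^k, so that the condition on the
target is now kp > 1. Differentiation shifts coefficients by k, hence the multiplier theorem is used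
with j = k. -/
theorem energy_iteratedDeriv_le {k : ℕ} (hk : 1 < (k : ℝ) * p) : ∃ C, 0 < C ∧ ∀ f : ℂ → ℂ,
    IsAnalytic f → energy p (fun t => t ^ (k : ℝ)) (iteratedDeriv k f) ≤
      ENNReal.ofReal C * energy p (tailFun μ) (fracDeriv μ f) := by
  obtain ⟨β', hβ', hP'⟩ := hP.exists_nonneg hp hγ
  obtain ⟨N, hN, hNp⟩ := exists_nat_two_le p hp
  obtain ⟨e, he⟩ := exists_nat_ge β
  set b := N + e - 1 with hb
  have hbe : b + 1 = N + e := by omega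
  have hβb : β ≤ b := by
    have : e ≤ b := by omega
    exact he.trans (by exact_mod_cast this)
  -- The last factor inverts the beta moment at the shifted index n + k.
  set S : ℕ → ℝ := fun n => momentSeq μ 0 (n + k) *
    (∏ i ∈ Finset.range k, ((n : ℝ) + (1 + i))) *
    ((b.factorial : ℝ)⁻¹ * ∏ i ∈ Finset.range (b + 1), ((n : ℝ) + (k + (1 + i)))) with hSdef
  have hS : SymbolClass N (fun n => ((n : ℝ) + 1) ^ (b + 1) *
      (tailFun μ (1 / ((n : ℝ) + 1)) * ((1 / ((n : ℝ) + 1)) ^ (k : ℝ))⁻¹)) S := by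
    have s1 := (symbolClass_momentSeq hμ hβ' hP' N).shift_add hP'.regularSeq k
    have s2 := SymbolClass.prod_add_const N k fun i => 1 + (i : ℝ)
    have s3 := (SymbolClass.prod_add_const N (b + 1) fun i => k + (1 + (i : ℝ))).const_mul
      (b.factorial : ℝ)⁻¹
    have s12 := s1.mul hP'.regularSeq (RegularSeq.succ.pow k) s2
    have s := s12.mul (hP'.regularSeq.mul (RegularSeq.succ.pow k))
      (RegularSeq.succ.pow (b + 1)) s3
    refine s.mono ⟨1, one_pos, fun n => le_of_eq ?_⟩
    rw [one_div_rpow_natCast_inv n k]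
    ring
  obtain ⟨C, hC, h⟩ := lintegral_multiplier_le hP (.rpow_id k) hp hk hN hNp
    (by linarith [(k.cast_nonneg : (0 : ℝ) ≤ k)] : β - (k : ℝ) ≤ (e : ℕ)) hbe hβb k hS
  refine ⟨C, hC, fun f hf => h _ (isAnalytic_fracDeriv hμ hP' hf) _ fun z hz => ?_⟩
  rw [← ((hf.iteratedDeriv k).hasSum hz).tsum_eq]
  refine tsum_congr fun n => ?_
  rw [coeff_iteratedDeriv, coeff_fracDeriv hμ hP' hf]
  congr 1
  have hm := (momentSeq_zero_pos hμ (n + k)).ne'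
  have key : S n * betaMoment b (n + k) =
      ((n + k).factorial / n.factorial) * momentSeq μ 0 (n + k) := by
    rw [factorial_add_div, hSdef, betaMoment]
    have h2 := (prod_range_add_pos (b + 1) (n + k)).ne'
    have h3 : (b.factorial : ℝ) ≠ 0 := by exact_mod_cast b.factorial_ne_zero
    push_cast at h2 ⊢
    simp only [← add_assoc] at h2 ⊢
    field_simp
  have hm' : ((momentSeq μ 0 (n + k) : ℝ) : ℂ) ≠ 0 := by exact_mod_cast hm
  rw [key, Complex.ofReal_mul]
  field_simp

end

/-! ### Sufficiency: membership in 𝒟 implies both norm inequalities -/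

theorem lintegral_powWeight_ne_top {μ : ℝ → ℝ} (hμ : IsRadialWeight μ) {p : ℝ}
    (hint : IntegrableOn (powWeight p μ) (Ico 0 1)) :
    ∫⁻ z, ENNReal.ofReal (tailFun μ (1 - ‖z‖) ^ p * (1 - ‖z‖) ^ (-2 : ℝ)) ∂areaMeasure ≠ ⊤ := by
  have hm := hμ.monotone.measurable
  rw [lintegral_areaMeasure_radial
    (h := fun r => ENNReal.ofReal (tailFun μ (1 - r) ^ p * (1 - r) ^ (-2 : ℝ))) (by fun_prop)]
  refine ENNReal.mul_ne_top (by norm_num) (ne_top_of_le_ne_top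
    (hint.mono_set Ioo_subset_Ico_self).lintegral_lt_top.ne ?_)
  refine setLIntegral_mono' measurableSet_Ioo fun r hr => ?_
  have hr1 : 0 < 1 - r := by linarith [hr.2]
  calc _ ≤ 1 * ENNReal.ofReal (tailFun μ (1 - r) ^ p * (1 - r) ^ (-2 : ℝ)) := by
        gcongr
        rw [← ENNReal.ofReal_one]
        exact ENNReal.ofReal_le_ofReal hr.2.le
    _ = _ := by
        rw [one_mul, powWeight, tail_eq_tailFun μ hr.1.le, Real.rpow_neg hr1.le, ← div_eq_mul_inv,
          Real.rpow_two]

theorem besovOrder_pos {p : ℝ} (hp : 0 < p) : 1 ≤ besovOrder p := by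
  have := besovOrder_spec hp
  by_contra! h
  have h0 : besovOrder p = 0 := by omega
  rw [h0] at this
  norm_num at this

/-- Cauchy's estimate on the circle |z| = 1/2, where the energy controls |G| pointwise. -/
theorem enorm_coeff_rpow_le {A : ℝ → ℝ} {a₁ a₂ p : ℝ} (hA : PowerType A a₁ a₂) (hp : 0 < p)
    (j : ℕ) : ∃ C : ENNReal, C ≠ ⊤ ∧ ∀ G : ℂ → ℂ, IsAnalytic G →
      ‖coeff G j‖ₑ ^ p ≤ C * energy p A G := by
  obtain ⟨C, hC, h⟩ := IsAnalytic.norm_rpow_mul_le hA hp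
  have hA2 := hA.pos (1 / 2) (by norm_num) (by norm_num)
  -- The added 1 makes the constant visibly non-zero, as needed when the energy is infinite.
  refine ⟨ENNReal.ofReal ((2 ^ j) ^ p * (C / A (1 / 2) ^ p)) + 1, by finiteness, fun G hG => ?_⟩
  rcases eq_or_ne (energy p A G) ⊤ with htop | htop
  · rw [htop, ENNReal.mul_top (by positivity)]
    exact le_top
  set M := (C / A (1 / 2) ^ p * (energy p A G).toReal) ^ (1 / p) with hM
  have hM0 : 0 ≤ M := by positivity
  have hsphere : ∀ z ∈ Metric.sphere (0 : ℂ) (1 / 2), ‖G z‖ ≤ M := by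
    intro z hz
    have hz' : ‖z‖ = 1 / 2 := by simpa using hz
    have h1 := h G hG htop z (by rw [mem_disc, hz']; norm_num)
    rw [hz', show (1 : ℝ) - 1 / 2 = 1 / 2 by norm_num] at h1
    have h2 : ‖G z‖ ^ p ≤ C / A (1 / 2) ^ p * (energy p A G).toReal := by
      rw [div_mul_eq_mul_div, le_div_iff₀ (by positivity)]
      exact h1
    have h3 := Real.rpow_le_rpow (by positivity) h2 (show 0 ≤ 1 / p by positivity)
    rwa [← Real.rpow_mul (norm_nonneg _), mul_one_div_cancel hp.ne', Real.rpow_one] at h3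
  have hcl : DiffContOnCl ℂ G (Metric.ball 0 (1 / 2)) := by
    refine DifferentiableOn.diffContOnCl (DifferentiableOn.mono hG ?_)
    rw [closure_ball _ (by norm_num)]
    exact Metric.closedBall_subset_ball (by norm_num)
  have hcauchy := Complex.norm_iteratedDeriv_le_of_forall_mem_sphere_norm_le j (by norm_num) hcl
    hsphere
  have hcoef : ‖coeff G j‖ ≤ 2 ^ j * M := by
    rw [coeff, norm_div, Complex.norm_natCast, div_le_iff₀ (by positivity)]
    refine hcauchy.trans (le_of_eq ?_)
    rw [one_div, inv_pow, div_inv_eq_mul]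
    ring
  have hfin : ‖coeff G j‖ ^ p ≤ (2 ^ j) ^ p * (C / A (1 / 2) ^ p) * (energy p A G).toReal := by
    calc ‖coeff G j‖ ^ p ≤ (2 ^ j * M) ^ p := by gcongr
      _ = _ := by
        rw [Real.mul_rpow (by positivity) hM0, hM, ← Real.rpow_mul (by positivity),
          one_div_mul_cancel hp.ne', Real.rpow_one, mul_assoc]
  calc ‖coeff G j‖ₑ ^ p = ENNReal.ofReal (‖coeff G j‖ ^ p) := (ofReal_norm_rpow hp.le _).symm
    _ ≤ ENNReal.ofReal ((2 ^ j) ^ p * (C / A (1 / 2) ^ p) * (energy p A G).toReal) :=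
        ENNReal.ofReal_le_ofReal hfin
    _ = ENNReal.ofReal ((2 ^ j) ^ p * (C / A (1 / 2) ^ p)) * energy p A G := by
        rw [ENNReal.ofReal_mul (by positivity), ENNReal.ofReal_toReal htop]
    _ ≤ _ := by gcongr; exact le_self_add

theorem iteratedDeriv_zero_eq (f : ℂ → ℂ) (j : ℕ) :
    iteratedDeriv j f 0 = j.factorial * coeff f j := by
  have : (j.factorial : ℂ) ≠ 0 := by exact_mod_cast j.factorial_ne_zero
  rw [coeff, mul_div_cancel₀ _ this]

section

variable {μ : ℝ → ℝ} (hμ : IsRadialWeight μ) {p : ℝ} (hp : 0 < p) (hD : MemD (powWeight p μ))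
include hμ hp hD

/-- The integral of the k-th derivative is handled by `energy_iteratedDeriv_le`. The finitely many
values f^{(j)}(0) are multiples of coefficients of D^μ f, hence bounded by its energy. -/
theorem besovLeFracBesov_of_memD : BesovLeFracBesov p μ := by
  obtain ⟨γ, β, hγ, hP⟩ := exists_powerType_of_memD hμ hp hD
  obtain ⟨b, -, hP'⟩ := hP.exists_nonneg hp hγ
  obtain ⟨C, hC, h⟩ := energy_iteratedDeriv_le hμ hp hγ hP (besovOrder_spec hp)
  choose D hDtop hcoef using fun j : ℕ => enorm_coeff_rpow_le hP hp j
  set k := besovOrder p with hk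
  set E : ENNReal := (∑ j ∈ Finset.range k,
      ‖((j.factorial * momentSeq μ 0 j : ℝ) : ℂ)‖ₑ ^ p * D j) +
    ENNReal.ofReal (2 ^ |(k : ℝ) * p - 2|) * ENNReal.ofReal C with hE
  have hEtop : E ≠ ⊤ := by
    refine ENNReal.add_ne_top.2 ⟨ENNReal.sum_ne_top.2 fun j _ => ENNReal.mul_ne_top
      (ENNReal.rpow_ne_top_of_nonneg hp.le enorm_ne_top) (hDtop j), by finiteness⟩
  obtain ⟨F, hF, hle⟩ := exists_nnreal_rpow_le hp
    (ENNReal.mul_ne_top hEtop (ENNReal.ofReal_ne_top (r := 4)))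
  refine ⟨F, hF, fun f hf => hle _ _ ?_⟩
  have hG := isAnalytic_fracDeriv hμ hP' hf
  rw [mul_assoc]
  refine le_trans ?_ (mul_le_mul_right (energy_le_lintegral_fracBesov hμ hp.le _) E)
  rw [hE, add_mul, Finset.sum_mul]
  gcongr with j hj
  · have h1 : iteratedDeriv j f 0 =
        ((j.factorial * momentSeq μ 0 j : ℝ) : ℂ) * coeff (fracDeriv μ f) j := by
      have : ((momentSeq μ 0 j : ℝ) : ℂ) ≠ 0 := by exact_mod_cast (momentSeq_zero_pos hμ j).ne'
      rw [iteratedDeriv_zero_eq, coeff_fracDeriv hμ hP' hf]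
      push_cast
      field_simp
    rw [h1, enorm_mul, ENNReal.mul_rpow_of_nonneg _ _ hp.le, mul_assoc]
    gcongr
    exact hcoef j _ hG
  · refine (lintegral_besov_le_energy hp.le k _).trans ?_
    rw [mul_assoc]
    gcongr
    exact h f hf

/-- D^μ f is a polynomial of degree below k plus z^k u(z). The polynomial is bounded by the values
f^{(j)}(0) and has finite energy because the weight is integrable; u is controlled by
`energy_fracDeriv_tail_le`. -/
theorem fracBesovLeBesov_of_memD : FracBesovLeBesov p μ := by
  obtain ⟨γ, β, hγ, hP⟩ := exists_powerType_of_memD hμ hp hD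
  obtain ⟨b, -, hP'⟩ := hP.exists_nonneg hp hγ
  obtain ⟨C, hC, h⟩ := energy_fracDeriv_tail_le hμ hp hγ hP (besovOrder_pos hp)
  set k := besovOrder p with hk
  have hw := lintegral_powWeight_ne_top hμ hD.1.1.integrableOn
  set w := ∫⁻ z, ENNReal.ofReal (tailFun μ (1 - ‖z‖) ^ p * (1 - ‖z‖) ^ (-2 : ℝ)) ∂areaMeasure
    with hwdef
  set c : ENNReal := ∑ j ∈ Finset.range k,
    ‖(((j.factorial * momentSeq μ 0 j)⁻¹ : ℝ) : ℂ)‖ₑ with hc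
  have hctop : c ≠ ⊤ := ENNReal.sum_ne_top.2 fun j _ => enorm_ne_top
  set E₁ : ENNReal := 2 ^ p * (c ^ p * (k ^ p * w))
  set E₂ : ENNReal := 2 ^ p * (ENNReal.ofReal C * ENNReal.ofReal (2 ^ |(k : ℝ) * p - 2|))
  have h2 : (2 : ENNReal) ^ p ≠ ⊤ := ENNReal.rpow_ne_top_of_nonneg hp.le (by norm_num)
  have hE₁ : E₁ ≠ ⊤ := ENNReal.mul_ne_top h2 (ENNReal.mul_ne_top
    (ENNReal.rpow_ne_top_of_nonneg hp.le hctop) (ENNReal.mul_ne_top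
    (ENNReal.rpow_ne_top_of_nonneg hp.le (by norm_num)) hw))
  have hE₂ : E₂ ≠ ⊤ := ENNReal.mul_ne_top h2 (by finiteness)
  obtain ⟨F, hF, hle⟩ := exists_nnreal_rpow_le hp (ENNReal.add_ne_top.2 ⟨hE₁, hE₂⟩)
  refine ⟨F, hF, fun f hf => hle _ _ ?_⟩
  refine (lintegral_fracBesov_le_energy hμ hp.le _).trans ?_
  set u : ℂ → ℂ := fun z =>
    ∑' n, coeff f (n + k) / ((momentSeq μ 0 (n + k) : ℝ) : ℂ) * z ^ n with hu
  set Q := ∑ j ∈ Finset.range k, ‖iteratedDeriv j f 0‖ₑ with hQ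
  have hsplit : ∀ z ∈ disc, ‖fracDeriv μ f z‖ₑ ≤ c * Q + ‖u z‖ₑ := by
    intro z hz
    have hz1 : ‖z‖ₑ ≤ 1 := by
      rw [← ofReal_norm, ← ENNReal.ofReal_one]
      exact ENNReal.ofReal_le_ofReal (mem_disc.1 hz).le
    have h1 := hasSum_fracDeriv hμ hP' hf hz
    have h2 : fracDeriv μ f z = ∑ j ∈ Finset.range k,
        coeff f j / ((momentSeq μ 0 j : ℝ) : ℂ) * z ^ j + z ^ k * u z := by
      rw [← h1.tsum_eq, ← h1.summable.sum_add_tsum_nat_add k, hu, ← tsum_mul_left]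
      congr 1
      refine tsum_congr fun n => ?_
      rw [pow_add]
      ring
    rw [h2]
    refine (enorm_add_le _ _).trans (add_le_add ((enorm_sum_le _ _).trans ?_) ?_)
    · rw [hQ, Finset.mul_sum]
      refine Finset.sum_le_sum fun j hj => ?_
      rw [show coeff f j / ((momentSeq μ 0 j : ℝ) : ℂ) * z ^ j =
          (((j.factorial * momentSeq μ 0 j)⁻¹ : ℝ) : ℂ) * iteratedDeriv j f 0 * z ^ j by
        rw [coeff]; push_cast; ring, enorm_mul, enorm_mul, enorm_pow]
      calc _ ≤ c * ‖iteratedDeriv j f 0‖ₑ * 1 := by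
            gcongr
            · exact Finset.single_le_sum
                (f := fun j : ℕ => ‖(((j.factorial * momentSeq μ 0 j)⁻¹ : ℝ) : ℂ)‖ₑ)
                (fun _ _ => zero_le) hj
            · exact pow_le_one₀ zero_le hz1
        _ = _ := mul_one _
    · rw [enorm_mul, enorm_pow]
      calc _ ≤ 1 * ‖u z‖ₑ := by gcongr; exact pow_le_one₀ zero_le hz1
        _ = _ := one_mul _
  have hm := hμ.monotone.measurable
  have hint : energy p (tailFun μ) (fracDeriv μ f) ≤
      2 ^ p * ((c * Q) ^ p * w + energy p (tailFun μ) u) := by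
    rw [energy_eq hp.le, energy_eq hp.le, hwdef, ← lintegral_const_mul _ (by fun_prop),
      ← lintegral_add_left (by fun_prop), ← lintegral_const_mul' _ _ h2]
    refine lintegral_mono_ae (ae_areaMeasure_mem.mono fun z hz => ?_)
    rw [← add_mul, ← mul_assoc]
    gcongr
    exact (ENNReal.rpow_le_rpow (hsplit z hz) hp.le).trans (add_rpow_le hp _ _)
  refine hint.trans ?_
  have hQp : Q ^ p ≤ (k : ENNReal) ^ p * ∑ j ∈ Finset.range k, ‖iteratedDeriv j f 0‖ₑ ^ p :=
    sum_rpow_le hp k _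
  have hup := (h f u hf fun z _ => rfl).trans
    (mul_le_mul_right (energy_le_lintegral_besov hp.le k (iteratedDeriv k f)) (ENNReal.ofReal C))
  set X := ∑ j ∈ Finset.range k, ‖iteratedDeriv j f 0‖ₑ ^ p
  set Y := ∫⁻ z, ‖iteratedDeriv k f z‖ₑ ^ p *
      ENNReal.ofReal ((1 - ‖z‖ ^ 2) ^ ((k : ℝ) * p - 2)) ∂areaMeasure
  calc 2 ^ p * ((c * Q) ^ p * w + energy p (tailFun μ) u)
      ≤ 2 ^ p * (c ^ p * (k ^ p * X) * w +
          ENNReal.ofReal C * (ENNReal.ofReal (2 ^ |(k : ℝ) * p - 2|) * Y)) := by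
        rw [ENNReal.mul_rpow_of_nonneg _ _ hp.le]
        gcongr
    _ = E₁ * X + E₂ * Y := by ring
    _ ≤ E₁ * (X + Y) + E₂ * (X + Y) := by
        gcongr
        · exact le_self_add
        · exact le_add_self
    _ = _ := by rw [← add_mul]

end

/-! ### Necessity: testing on monomials -/

theorem coeff_pow (n m : ℕ) : coeff (fun z => z ^ n) m = if m = n then 1 else 0 := by
  have : (m.factorial : ℂ) ≠ 0 := by exact_mod_cast m.factorial_ne_zero
  rw [coeff, iteratedDeriv_fun_pow_zero]
  split_ifs with h
  · subst h
    exact div_self this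
  · rw [Nat.cast_zero, zero_div]

theorem fracDeriv_pow (μ : ℝ → ℝ) (n : ℕ) (z : ℂ) :
    fracDeriv μ (fun z => z ^ n) z = z ^ n / ((momentSeq μ 0 n : ℝ) : ℂ) := by
  rw [fracDeriv_eq, tsum_eq_single n fun m hm => by rw [coeff_pow, if_neg hm, zero_div, zero_mul],
    coeff_pow, if_pos rfl]
  ring

theorem isAnalytic_pow (n : ℕ) : IsAnalytic fun z => z ^ n :=
  (differentiable_pow n).differentiableOn

/-- The `p`-th power of the norm of `z ^ n` in the Besov space is of order at most `n`. -/
theorem besov_pow_le {p : ℝ} (hp : 0 < p) : ∃ C, 0 < C ∧ ∀ n : ℕ, 2 * besovOrder p ≤ n →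
    (∑ j ∈ Finset.range (besovOrder p), ‖iteratedDeriv j (fun z : ℂ => z ^ n) 0‖ₑ ^ p) +
      ∫⁻ z, ‖iteratedDeriv (besovOrder p) (fun z : ℂ => z ^ n) z‖ₑ ^ p *
        ENNReal.ofReal ((1 - ‖z‖ ^ 2) ^ ((besovOrder p : ℝ) * p - 2)) ∂areaMeasure ≤
      ENNReal.ofReal (C * n) := by
  have hk1 := besovOrder_pos hp
  have hkp := besovOrder_spec hp
  set k := besovOrder p
  obtain ⟨C, hC, h⟩ := lintegral_pow_mul_rpow_le (show -1 < (k : ℝ) * p - 2 by linarith)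
  refine ⟨2 ^ |(k : ℝ) * p - 2| * (2 * (C * (p / 2) ^ (-((k : ℝ) * p - 1)))),
    by positivity, fun n hn => ?_⟩
  have hn0 : (0 : ℝ) < n := by
    have : 0 < n := by omega
    exact_mod_cast this
  rw [Finset.sum_eq_zero fun j hj => by
    rw [iteratedDeriv_fun_pow_zero, if_neg (by have := Finset.mem_range.1 hj; omega), Nat.cast_zero, enorm_zero,
      ENNReal.zero_rpow_of_pos hp], zero_add]
  refine (lintegral_besov_le_energy hp.le k _).trans ?_
  rw [mul_assoc, ENNReal.ofReal_mul (by positivity)]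
  gcongr
  -- The radial exponent (n - k)p is rounded down to an integer. The assumption n ≥ 2k keeps m + 1
  -- at least np/2, and makes the derivatives of order below k vanish at 0.
  set m := ⌊((n : ℝ) - k) * p⌋₊ with hm
  have hnk : (n : ℝ) / 2 ≤ n - k := by
    have : (2 * k : ℝ) ≤ n := by exact_mod_cast hn
    linarith
  have hm1 : n * (p / 2) ≤ (m : ℝ) + 1 := by
    refine le_trans ?_ (Nat.lt_floor_add_one _).le
    nlinarith
  have hm2 : (m : ℝ) ≤ ((n : ℝ) - k) * p := Nat.floor_le (by
    have : 0 ≤ (n : ℝ) - k := by linarith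
    positivity)
  have hpt : ∀ z ∈ disc, ‖iteratedDeriv k (fun z : ℂ => z ^ n) z‖ ^ p ≤
      (n : ℝ) ^ ((k : ℝ) * p) * ‖z‖ ^ m := by
    intro z hz
    have h1 : ‖iteratedDeriv k (fun z : ℂ => z ^ n) z‖ ≤ (n : ℝ) ^ k * ‖z‖ ^ (n - k) := by
      rw [iteratedDeriv_pow, norm_mul, norm_pow, Complex.norm_natCast]
      gcongr
      exact_mod_cast Nat.descFactorial_le_pow n k
    have h2 : (‖z‖ ^ (n - k)) ^ p ≤ ‖z‖ ^ m := by
      rcases (norm_nonneg z).eq_or_lt with h0 | h0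
      · rw [← h0, zero_pow (by omega), Real.zero_rpow hp.ne']
        positivity
      · rw [← Real.rpow_natCast, ← Real.rpow_mul h0.le, ← Real.rpow_natCast, Nat.cast_sub (by omega)]
        exact Real.rpow_le_rpow_of_exponent_ge h0 (mem_disc.1 hz).le hm2
    calc _ ≤ ((n : ℝ) ^ k * ‖z‖ ^ (n - k)) ^ p := by gcongr
      _ = (n : ℝ) ^ ((k : ℝ) * p) * (‖z‖ ^ (n - k)) ^ p := by
          rw [Real.mul_rpow (by positivity) (by positivity), ← Real.rpow_natCast,
            ← Real.rpow_mul hn0.le]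
      _ ≤ _ := by gcongr
  calc energy p (fun t => t ^ (k : ℝ)) (iteratedDeriv k fun z => z ^ n)
      ≤ ∫⁻ z, ENNReal.ofReal ((n : ℝ) ^ ((k : ℝ) * p) *
          (‖z‖ ^ m * (1 - ‖z‖) ^ ((k : ℝ) * p - 2))) ∂areaMeasure := by
        refine lintegral_mono_ae (ae_areaMeasure_mem.mono fun z hz => ?_)
        have h1 : 0 < 1 - ‖z‖ := by linarith [mem_disc.1 hz]
        apply ENNReal.ofReal_le_ofReal
        rw [pow_weight_eq h1, ← mul_assoc]
        gcongr
        exact hpt z hz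
    _ = 2 * ∫⁻ r in Ioo (0 : ℝ) 1, ENNReal.ofReal r * ENNReal.ofReal ((n : ℝ) ^ ((k : ℝ) * p) *
          (r ^ m * (1 - r) ^ ((k : ℝ) * p - 2))) :=
        lintegral_areaMeasure_radial (h := fun r => ENNReal.ofReal ((n : ℝ) ^ ((k : ℝ) * p) *
          (r ^ m * (1 - r) ^ ((k : ℝ) * p - 2)))) (by fun_prop)
    _ ≤ 2 * ∫⁻ r in Ioo (0 : ℝ) 1, ENNReal.ofReal ((n : ℝ) ^ ((k : ℝ) * p)) *
          ENNReal.ofReal (r ^ m * (1 - r) ^ ((k : ℝ) * p - 2)) := by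
        refine mul_le_mul_right (setLIntegral_mono' measurableSet_Ioo fun r hr => ?_) 2
        rw [← ENNReal.ofReal_mul (p := (n : ℝ) ^ ((k : ℝ) * p)) (by positivity)]
        calc _ ≤ 1 * ENNReal.ofReal ((n : ℝ) ^ ((k : ℝ) * p) *
              (r ^ m * (1 - r) ^ ((k : ℝ) * p - 2))) := by
              gcongr
              rw [← ENNReal.ofReal_one]
              exact ENNReal.ofReal_le_ofReal hr.2.le
          _ = _ := one_mul _
    _ ≤ 2 * (ENNReal.ofReal ((n : ℝ) ^ ((k : ℝ) * p)) *
          ENNReal.ofReal (C * (n * (p / 2)) ^ (-((k : ℝ) * p - 1)))) := by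
        rw [lintegral_const_mul' _ _ ENNReal.ofReal_ne_top]
        gcongr
        refine (h m).trans (ENNReal.ofReal_le_ofReal ?_)
        rw [show (k : ℝ) * p - 2 + 1 = k * p - 1 by ring]
        gcongr C * ?_
        exact Real.rpow_le_rpow_of_nonpos (by positivity) hm1 (by linarith)
    _ = _ := by
        rw [← ENNReal.ofReal_mul (by positivity), ← ENNReal.ofReal_ofNat 2,
          ← ENNReal.ofReal_mul (by norm_num), Real.mul_rpow hn0.le (by positivity)]
        congr 1
        have : (n : ℝ) ^ ((k : ℝ) * p) * (n : ℝ) ^ (-((k : ℝ) * p - 1)) = n := by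
          rw [← Real.rpow_add hn0]
          ring_nf
          exact Real.rpow_one _
        linear_combination (2 * C * (p / 2) ^ (-((k : ℝ) * p - 1))) * this

/-- D^μ only divides z^n by the moment of index n, so the norm of D^μ z^n is an explicit radial
integral, while the p-th power of the Besov norm of z^n is at most of order n. -/
theorem lintegral_rpow_mul_powWeight_le {μ : ℝ → ℝ} (hμ : IsRadialWeight μ) {p : ℝ} (hp : 0 < p)
    (hle : FracBesovLeBesov p μ) : ∃ C, 0 < C ∧ ∃ n₀ : ℕ, ∀ n : ℕ, n₀ ≤ n →
      ∫⁻ r in Ioo (0 : ℝ) 1, ENNReal.ofReal (r ^ ((n : ℝ) * p + 1) * powWeight p μ r) ≤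
        ENNReal.ofReal (C * n * momentSeq μ 0 n ^ p) := by
  obtain ⟨B, hB, hle⟩ := hle
  obtain ⟨C, hC, hbes⟩ := besov_pow_le hp
  refine ⟨4 * ((B : ℝ) ^ p * C), by positivity, 2 * besovOrder p, fun n hn => ?_⟩
  have hL := momentSeq_zero_pos hμ n
  have h1 := ENNReal.rpow_le_rpow (hle _ (isAnalytic_pow n)) hp.le
  rw [fracBesovNorm, besovNorm, ENNReal.mul_rpow_of_nonneg _ _ hp.le, ← ENNReal.rpow_mul,
    ← ENNReal.rpow_mul, one_div_mul_cancel hp.ne', ENNReal.rpow_one, ENNReal.rpow_one] at h1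
  have h2 := (energy_le_lintegral_fracBesov hμ hp.le _).trans
    (mul_le_mul_right (h1.trans (mul_le_mul_right (hbes n hn) _)) (ENNReal.ofReal 4))
  have hm := hμ.monotone.measurable
  have h3 : ENNReal.ofReal (momentSeq μ 0 n ^ (-p)) *
      ∫⁻ r in Ioo (0 : ℝ) 1, ENNReal.ofReal (r ^ ((n : ℝ) * p + 1) * powWeight p μ r) ≤
      energy p (tailFun μ) (fracDeriv μ fun z => z ^ n) := by
    have e : energy p (tailFun μ) (fracDeriv μ fun z => z ^ n) = ∫⁻ z, ENNReal.ofReal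
        ((‖z‖ ^ n / momentSeq μ 0 n) ^ p *
          (tailFun μ (1 - ‖z‖) ^ p * (1 - ‖z‖) ^ (-2 : ℝ))) ∂areaMeasure := by
      refine lintegral_congr fun z => ?_
      rw [fracDeriv_pow, norm_div, norm_pow, Complex.norm_real, Real.norm_of_nonneg hL.le]
    rw [e, lintegral_areaMeasure_radial (h := fun r => ENNReal.ofReal
        ((r ^ n / momentSeq μ 0 n) ^ p * (tailFun μ (1 - r) ^ p * (1 - r) ^ (-2 : ℝ))))
        (by fun_prop), ← lintegral_const_mul' _ _ ENNReal.ofReal_ne_top]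
    refine le_trans (le_of_eq ?_) (le_mul_of_one_le_left zero_le one_le_two)
    refine setLIntegral_congr_fun measurableSet_Ioo fun r hr => ?_
    have hr1 : 0 < 1 - r := by linarith [hr.2]
    have hr0 := hr.1
    rw [← ENNReal.ofReal_mul (by positivity), ← ENNReal.ofReal_mul hr0.le, powWeight,
      tail_eq_tailFun μ hr0.le, Real.rpow_neg hr1.le, Real.rpow_two,
      Real.div_rpow (by positivity) hL.le, Real.rpow_neg hL.le, Real.rpow_add hr0, Real.rpow_one,
      Real.rpow_mul hr0.le, Real.rpow_natCast]
    congr 1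
    ring
  have h4 := h3.trans h2
  have hBp : (B : ENNReal) ^ p = ENNReal.ofReal ((B : ℝ) ^ p) := by
    rw [← ENNReal.ofReal_coe_nnreal, ENNReal.ofReal_rpow_of_nonneg B.coe_nonneg hp.le]
  rw [hBp, ← ENNReal.ofReal_mul (by positivity), ← ENNReal.ofReal_mul (by positivity)] at h4
  have h5 := mul_le_mul_right h4 (ENNReal.ofReal (momentSeq μ 0 n ^ p))
  rw [← mul_assoc, ← ENNReal.ofReal_mul (by positivity), ← ENNReal.ofReal_mul (by positivity),
    ← Real.rpow_add hL, add_neg_cancel, Real.rpow_zero, ENNReal.ofReal_one, one_mul] at h5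
  refine h5.trans (le_of_eq ?_)
  congr 1
  ring

/-- Reduces the goal to an estimate near the boundary, stated without assuming integrability: the
case t = t₀ supplies it, and for t ≥ t₀ both sides are comparable to constants. -/
theorem memD_powWeight_of_lintegral_le {μ : ℝ → ℝ} (hμ : IsRadialWeight μ) {p : ℝ} (hp : 0 < p)
    (hd : ∃ C, 0 < C ∧ ∀ t, 0 < t → t ≤ 1 → tailFun μ t ≤ C * tailFun μ (t / 2))
    {C t₀ : ℝ} (hC : 0 < C) (ht₀ : 0 < t₀) (ht₀1 : t₀ ≤ 1)
    (h : ∀ t, 0 < t → t ≤ t₀ → ∫⁻ r in Ico (1 - t) 1, ENNReal.ofReal (powWeight p μ r) ≤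
      ENNReal.ofReal (C * (tailFun μ t ^ p / t))) : MemD (powWeight p μ) := by
  have hm := hμ.monotone.measurable
  have hms : AEStronglyMeasurable (powWeight p μ) (volume.restrict (Ico 0 1)) := by
    have : Measurable fun r : ℝ => tailFun μ (1 - r) ^ p / (1 - r) ^ 2 := by fun_prop
    refine this.aestronglyMeasurable.congr ((ae_restrict_iff' measurableSet_Ico).2
      (Filter.Eventually.of_forall fun r hr => ?_))
    simp only [powWeight, tail_eq_tailFun μ hr.1]
  have hnn := powWeight_nonneg hμ p
  have hnn' : ∀ t, t ≤ 1 → 0 ≤ᵐ[volume.restrict (Ico (1 - t) 1)] powWeight p μ := fun t ht =>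
    (ae_restrict_iff' measurableSet_Ico).2 (Filter.Eventually.of_forall fun r hr =>
      hnn r ⟨by linarith [hr.1], hr.2⟩)
  have hint : IntegrableOn (powWeight p μ) (Ico 0 1) := by
    rw [← Ico_union_Ico_eq_Ico (show 0 ≤ 1 - t₀ by linarith) (show 1 - t₀ ≤ 1 by linarith)]
    refine IntegrableOn.union ?_ ?_
    · refine ⟨hms.mono_measure (Measure.restrict_mono (Ico_subset_Ico_right
        (show 1 - t₀ ≤ 1 by linarith)) le_rfl),
        .restrict_of_bounded (C := tailFun μ 1 ^ p / t₀ ^ 2) (by simp) ?_⟩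
      refine (ae_restrict_iff' measurableSet_Ico).2 (Filter.Eventually.of_forall fun r hr => ?_)
      have h1 : t₀ ≤ 1 - r := by linarith [hr.2]
      have h2 := tailFun_nonneg hμ.nonneg (1 - r)
      have h3 := tailFun_nonneg hμ.nonneg 1
      rw [Real.norm_of_nonneg (hnn r ⟨hr.1, by linarith⟩), powWeight, tail_eq_tailFun μ hr.1]
      gcongr
      exact hμ.monotone (by linarith [hr.1])
    · refine ⟨hms.mono_measure (Measure.restrict_mono (Ico_subset_Ico_left
        (show 0 ≤ 1 - t₀ by linarith)) le_rfl),
        ?_⟩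
      rw [hasFiniteIntegral_iff_ofReal (hnn' t₀ ht₀1)]
      exact (h t₀ ht₀ le_rfl).trans_lt ENNReal.ofReal_lt_top
  have hw := isRadialWeight_powWeight hμ hp hint
  have hH := hμ.tailFun_pos ht₀
  refine memD_powWeight hμ hp hint hd
    ⟨max C (tailFun (powWeight p μ) 1 / tailFun μ t₀ ^ p), lt_max_of_lt_left hC,
      fun t ht ht1 => ?_⟩
  have hHt := hμ.tailFun_pos ht
  rcases le_total t t₀ with htt | htt
  · calc tailFun (powWeight p μ) t ≤ C * (tailFun μ t ^ p / t) := by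
          rw [tailFun_eq _ ht1, tail, integral_eq_lintegral_of_nonneg_ae (hnn' t ht1)
            (hint.mono_set (Ico_subset_Ico_left (by linarith))).aestronglyMeasurable]
          exact ENNReal.toReal_le_of_le_ofReal (by positivity) (h t ht htt)
      _ ≤ _ := by gcongr; exact le_max_left _ _
  · have h1 : 1 ≤ tailFun μ t ^ p / t / tailFun μ t₀ ^ p := by
      rw [le_div_iff₀ (by positivity), le_div_iff₀ ht, one_mul]
      calc tailFun μ t₀ ^ p * t ≤ tailFun μ t₀ ^ p * 1 := by gcongr
        _ ≤ tailFun μ t ^ p := by rw [mul_one]; gcongr; exact hμ.monotone htt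
    have h2 := (hw.tailFun_pos one_pos)
    calc tailFun (powWeight p μ) t ≤ tailFun (powWeight p μ) 1 * 1 := by
          rw [mul_one]; exact hw.monotone ht1
      _ ≤ tailFun (powWeight p μ) 1 * (tailFun μ t ^ p / t / tailFun μ t₀ ^ p) := by gcongr
      _ = tailFun (powWeight p μ) 1 / tailFun μ t₀ ^ p * (tailFun μ t ^ p / t) := by ring
      _ ≤ _ := by gcongr; exact le_max_right _ _

theorem memD_of_fracBesovLeBesov_of_doubling {μ : ℝ → ℝ} (hμ : IsRadialWeight μ) {p : ℝ}
    (hp : 0 < p) (hd : ∃ C, 0 < C ∧ ∀ t, 0 < t → t ≤ 1 → tailFun μ t ≤ C * tailFun μ (t / 2))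
    (h : FracBesovLeBesov p μ) : MemD (powWeight p μ) := by
  obtain ⟨C, hC, n₀, hB⟩ := lintegral_rpow_mul_powWeight_le hμ hp h
  obtain ⟨D, hD, hdd⟩ := id hd
  obtain ⟨b, hb, hP⟩ := hμ.powerType_of_doubling hdd
  obtain ⟨E, hE, hL⟩ := momentSeq_le hμ hb hP 0
  refine memD_powWeight_of_lintegral_le hμ hp hd (t₀ := 1 / (2 * ((n₀ : ℝ) + 1)))
    (C := 2 * 2 ^ p * (C * (E * D) ^ p)) (by positivity) (by positivity) ?_ fun t ht ht0 => ?_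
  · rw [div_le_one (by positivity)]
    linarith [(n₀.cast_nonneg : (0 : ℝ) ≤ n₀)]
  rw [le_div_iff₀ (by positivity)] at ht0
  -- With nt ≤ 1/2 the power r^n stays above 1/2 on [1 - t, 1), while 1/(n+1) < 2t bounds the moment
  -- by a multiple of H(t) through doubling.
  set n := ⌊1 / (2 * t)⌋₊ with hn
  have hn1 : (n : ℝ) * (2 * t) ≤ 1 := by
    rw [← le_div_iff₀ (by positivity)]
    exact Nat.floor_le (by positivity)
  have hn2 : 1 < ((n : ℝ) + 1) * (2 * t) := by
    rw [← div_lt_iff₀ (by positivity)]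
    exact Nat.lt_floor_add_one _
  have hn0 : n₀ ≤ n := by
    refine Nat.le_floor ?_
    rw [le_div_iff₀ (by positivity)]
    nlinarith
  have ht2 : t ≤ 1 / 2 := by
    nlinarith [(n₀.cast_nonneg : (0 : ℝ) ≤ n₀)]
  have hHt := hμ.tailFun_pos ht
  have hLn : momentSeq μ 0 n ≤ E * D * tailFun μ t := by
    refine (hL n).trans ?_
    rw [pow_zero, div_one, mul_assoc]
    gcongr
    calc tailFun μ (1 / ((n : ℝ) + 1)) ≤ tailFun μ (2 * t) := by
          refine hμ.monotone ?_
          rw [div_le_iff₀ (by positivity)]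
          linarith
      _ ≤ D * tailFun μ (2 * t / 2) := hdd _ (by linarith) (by linarith)
      _ = _ := by rw [mul_div_cancel_left₀ t two_ne_zero]
  have hL0 := (momentSeq_zero_pos hμ n).le
  have hlow : ∀ r, 1 - t ≤ r → r < 1 → 1 ≤ 2 * 2 ^ p * r ^ ((n : ℝ) * p + 1) := by
    intro r hr hr1
    have hr0 : 1 / 2 ≤ r := by linarith
    have h1 : 1 / 2 ≤ r ^ n := by
      have := one_add_mul_le_pow (a := -t) (by linarith) n
      calc 1 / 2 ≤ 1 + (n : ℝ) * -t := by nlinarith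
        _ ≤ (1 + -t) ^ n := this
        _ ≤ r ^ n := pow_le_pow_left₀ (by linarith) (by linarith) n
    rw [Real.rpow_add (by linarith), Real.rpow_one, Real.rpow_mul (by linarith),
      Real.rpow_natCast]
    calc (1 : ℝ) = 2 * 2 ^ p * ((1 / 2) ^ p * (1 / 2)) := by
          rw [one_div, Real.inv_rpow (by norm_num)]
          have := Real.rpow_pos_of_pos (two_pos (α := ℝ)) p
          field_simp
      _ ≤ _ := by gcongr
  calc ∫⁻ r in Ico (1 - t) 1, ENNReal.ofReal (powWeight p μ r)
      ≤ ∫⁻ r in Ico (1 - t) 1, ENNReal.ofReal (2 * 2 ^ p) *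
          ENNReal.ofReal (r ^ ((n : ℝ) * p + 1) * powWeight p μ r) := by
        refine setLIntegral_mono' measurableSet_Ico fun r hr => ?_
        have h1 := hlow r hr.1 hr.2
        have h2 := powWeight_nonneg hμ p r ⟨by linarith [hr.1], hr.2⟩
        rw [← ENNReal.ofReal_mul (by positivity), ← mul_assoc]
        apply ENNReal.ofReal_le_ofReal
        nlinarith
    _ ≤ ENNReal.ofReal (2 * 2 ^ p) * ∫⁻ r in Ioo (0 : ℝ) 1,
          ENNReal.ofReal (r ^ ((n : ℝ) * p + 1) * powWeight p μ r) := by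
        rw [lintegral_const_mul' _ _ ENNReal.ofReal_ne_top]
        exact mul_le_mul_right (lintegral_mono_set
          (show Ico (1 - t) 1 ⊆ Ioo (0 : ℝ) 1 from fun r hr => ⟨by linarith [hr.1], hr.2⟩)) _
    _ ≤ ENNReal.ofReal (2 * 2 ^ p) * ENNReal.ofReal (C * n * momentSeq μ 0 n ^ p) := by
        gcongr
        exact hB n hn0
    _ ≤ _ := by
        rw [← ENNReal.ofReal_mul (by positivity)]
        apply ENNReal.ofReal_le_ofReal
        have h1 : (n : ℝ) ≤ 1 / t := by
          rw [le_div_iff₀ ht]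
          nlinarith [(n.cast_nonneg : (0 : ℝ) ≤ n)]
        calc 2 * 2 ^ p * (C * n * momentSeq μ 0 n ^ p)
            ≤ 2 * 2 ^ p * (C * (1 / t) * (E * D * tailFun μ t) ^ p) := by gcongr
          _ = _ := by
            rw [Real.mul_rpow (by positivity) hHt.le]
            ring

/-! ### Necessity: doubling of the tail when p ≥ 1 -/

theorem momentSeq_zero_antitone {μ : ℝ → ℝ} (hμ : IsRadialWeight μ) :
    Antitone (momentSeq μ 0) :=
  antitone_nat_of_succ_le fun n => by
    have h1 := momentSeq_succ_sub hμ.integrableOn 0 n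
    have h2 := hμ.momentSeq_nonneg 1 n
    rw [zero_add] at h1
    linarith

theorem ofReal_momentSeq_zero {μ : ℝ → ℝ} (hμ : IsRadialWeight μ) (n : ℕ) :
    ENNReal.ofReal (momentSeq μ 0 n) = ENNReal.ofReal (2 * n + 1) *
      ∫⁻ u in Ioo (0 : ℝ) 1, ENNReal.ofReal (tailFun μ (1 - u) * u ^ (2 * n)) := by
  have hnn : 0 ≤ᵐ[volume.restrict (Ico (0 : ℝ) 1)] fun s => s ^ (2 * n + 1) * μ s :=
    (ae_restrict_iff' measurableSet_Ico).2 (Filter.Eventually.of_forall fun s hs =>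
      mul_nonneg (pow_nonneg hs.1 _) (hμ.nonneg s hs))
  have h := ofReal_integral_eq_lintegral_ofReal (integrableOn_continuous_mul hμ.integrableOn
    (g := fun s => s ^ (2 * n + 1)) (by fun_prop)) hnn
  simp only [momentSeq, pow_zero, mul_one]
  rw [h, lintegral_pow_mul_eq hμ, ← lintegral_const_mul' _ _ ENNReal.ofReal_ne_top]
  refine setLIntegral_congr_fun measurableSet_Ioo fun u hu => ?_
  rw [← ENNReal.ofReal_mul (by positivity), tail_eq_tailFun μ hu.1.le]
  push_cast
  congr 1
  ring

/-- Used to introduce the factor (1 - u)^{-2} of the tested weight at the cost of x^{-2}. -/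
theorem rpow_half_mul_sq_le {u x : ℝ} (hu : 0 < u) (hu1 : u < 1) (hx : 0 < x) :
    u ^ (x / 2) * (1 - u) ^ 2 ≤ 8 / x ^ 2 := by
  have h1 : u ^ (x / 2) ≤ Real.exp (-(x * (1 - u) / 2)) := by
    calc u ^ (x / 2) ≤ Real.exp (-(1 - u)) ^ (x / 2) := by
          gcongr
          linarith [Real.add_one_le_exp (-(1 - u))]
      _ = _ := by rw [← Real.exp_mul]; congr 1; ring
  have h2 := Real.pow_div_factorial_le_exp (x * (1 - u) / 2)
    (by have : 0 < 1 - u := by linarith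
        positivity) 2
  rw [Real.exp_neg] at h1
  have h3 := Real.exp_pos (x * (1 - u) / 2)
  rw [le_div_iff₀ (by positivity)]
  calc u ^ (x / 2) * (1 - u) ^ 2 * x ^ 2
      ≤ (Real.exp (x * (1 - u) / 2))⁻¹ * (1 - u) ^ 2 * x ^ 2 := by gcongr
    _ = (Real.exp (x * (1 - u) / 2))⁻¹ * (8 * ((x * (1 - u) / 2) ^ 2 / (Nat.factorial 2 : ℕ))) := by
        norm_num [Nat.factorial]
        ring
    _ ≤ (Real.exp (x * (1 - u) / 2))⁻¹ * (8 * Real.exp (x * (1 - u) / 2)) := by gcongr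
    _ = 8 := by field_simp

/-- By the layer-cake formula the moment of index 2j is about j ∫ μ̂(u) u^{4j} du. Hölder's
inequality, where p ≥ 1 enters, passes to an integral of μ̂^p that the monomial test at index 3j
controls; all powers of j cancel. -/
theorem momentSeq_two_mul_le {μ : ℝ → ℝ} (hμ : IsRadialWeight μ) {p : ℝ} (hp : 1 ≤ p)
    {C : ℝ} (hC : 0 < C) {n₀ : ℕ} (hB : ∀ n : ℕ, n₀ ≤ n →
      ∫⁻ r in Ioo (0 : ℝ) 1, ENNReal.ofReal (r ^ ((n : ℝ) * p + 1) * powWeight p μ r) ≤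
        ENNReal.ofReal (C * n * momentSeq μ 0 n ^ p)) :
    ∃ D, 0 < D ∧ ∀ j : ℕ, 2 ≤ j → n₀ ≤ j → momentSeq μ 0 (2 * j) ≤ D * momentSeq μ 0 (3 * j) := by
  have hp0 : 0 < p := by linarith
  set K := 5 ^ p * (24 * C) * 2 ^ (p - 1) with hK
  have hK0 : 0 < K := by positivity
  refine ⟨K ^ (1 / p), by positivity, fun j hj hjn => ?_⟩
  have hj2 : (2 : ℝ) ≤ j := by exact_mod_cast hj
  have hj0 : (0 : ℝ) < j := by linarith
  have hm := hμ.monotone.measurable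
  have hL2 := momentSeq_zero_pos hμ (2 * j)
  have hL3 := momentSeq_zero_pos hμ (3 * j)
  -- The Hölder weight u^{-7j/2} is chosen so that the first factor has exponent 7jp/2 + j/2, which
  -- leaves room for u^{3jp+1} and a spare u^{j/2}, while the second factor is the integral of
  -- u^{j/2}, of order 1/j.
  have hH := lintegral_mul_rpow_le (ν := volume.restrict (Ioo (0 : ℝ) 1)) hp
    (f := fun u => tailFun μ (1 - u)) (D := fun u => u ^ (-(7 / 2 * (j : ℝ))))
    (k := fun u => u ^ (2 * (2 * j))) (by fun_prop) (by fun_prop) (by fun_prop)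
    ((ae_restrict_iff' measurableSet_Ioo).2 (Filter.Eventually.of_forall fun u hu =>
      ⟨tailFun_nonneg hμ.nonneg _, Real.rpow_pos_of_pos hu.1 _, pow_pos hu.1 _⟩))
  have hY : ∫⁻ u in Ioo (0 : ℝ) 1, ENNReal.ofReal (tailFun μ (1 - u) ^ p *
      (u ^ (-(7 / 2 * (j : ℝ)))) ^ (1 - p) * u ^ (2 * (2 * j))) ≤
      ENNReal.ofReal (24 * C / j * momentSeq μ 0 (3 * j) ^ p) := by
    calc _ ≤ ∫⁻ u in Ioo (0 : ℝ) 1, ENNReal.ofReal (8 / (j : ℝ) ^ 2) *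
          ENNReal.ofReal (u ^ (((3 * j : ℕ) : ℝ) * p + 1) * powWeight p μ u) := by
          refine setLIntegral_mono' measurableSet_Ioo fun u hu => ?_
          have hu0 := hu.1
          have hu1 : 0 < 1 - u := by linarith [hu.2]
          rw [← ENNReal.ofReal_mul (by positivity)]
          apply ENNReal.ofReal_le_ofReal
          have e1 : (u ^ (-(7 / 2 * (j : ℝ)))) ^ (1 - p) * u ^ (2 * (2 * j)) =
              u ^ (((3 * j : ℕ) : ℝ) * p + 1) * u ^ ((j : ℝ) / 2 + (j * p / 2 - 1)) := by
            rw [← Real.rpow_natCast, ← Real.rpow_mul hu0.le, ← Real.rpow_add hu0,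
              ← Real.rpow_add hu0]
            push_cast
            ring_nf
          -- Here j ≥ 2 and p ≥ 1 make the discarded exponent jp/2 - 1 non-negative.
          have e2 : u ^ ((j : ℝ) / 2 + (j * p / 2 - 1)) ≤ u ^ ((j : ℝ) / 2) := by
            refine Real.rpow_le_rpow_of_exponent_ge hu0 hu.2.le ?_
            nlinarith
          have h8 := rpow_half_mul_sq_le hu0 hu.2 hj0
          have h3 := Real.rpow_nonneg (tailFun_nonneg hμ.nonneg (1 - u)) p
          rw [mul_assoc, e1, powWeight, tail_eq_tailFun μ hu0.le]
          calc tailFun μ (1 - u) ^ p * (u ^ (((3 * j : ℕ) : ℝ) * p + 1) *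
                u ^ ((j : ℝ) / 2 + (j * p / 2 - 1)))
              ≤ tailFun μ (1 - u) ^ p * (u ^ (((3 * j : ℕ) : ℝ) * p + 1) * u ^ ((j : ℝ) / 2)) := by
                gcongr
            _ = (u ^ ((j : ℝ) / 2) * (1 - u) ^ 2) * (u ^ (((3 * j : ℕ) : ℝ) * p + 1) *
                (tailFun μ (1 - u) ^ p / (1 - u) ^ 2)) := by field_simp
            _ ≤ _ := by gcongr
      _ ≤ ENNReal.ofReal (8 / (j : ℝ) ^ 2) *
          ENNReal.ofReal (C * (3 * j : ℕ) * momentSeq μ 0 (3 * j) ^ p) := by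
          rw [lintegral_const_mul' _ _ ENNReal.ofReal_ne_top]
          gcongr
          exact hB (3 * j) (by omega)
      _ = _ := by
          rw [← ENNReal.ofReal_mul (by positivity)]
          congr 1
          push_cast
          field_simp
          ring
  have hZ : ∫⁻ u in Ioo (0 : ℝ) 1, ENNReal.ofReal (u ^ (-(7 / 2 * (j : ℝ))) * u ^ (2 * (2 * j))) ≤
      ENNReal.ofReal (2 / j) := by
    calc _ = ∫⁻ u in Ioo (0 : ℝ) 1, ENNReal.ofReal ((u / 1) ^ ((j : ℝ) / 2)) := by
          refine setLIntegral_congr_fun measurableSet_Ioo fun u hu => ?_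
          rw [div_one, ← Real.rpow_natCast, ← Real.rpow_add hu.1]
          push_cast
          ring_nf
      _ ≤ ∫⁻ u in Ioc (0 : ℝ) 1, ENNReal.ofReal ((u / 1) ^ ((j : ℝ) / 2)) :=
          lintegral_mono_set Ioo_subset_Ioc_self
      _ = ENNReal.ofReal (1 / ((j : ℝ) / 2 + 1)) :=
          lintegral_Ioc_div_rpow (by linarith) one_pos
      _ ≤ _ := by
          apply ENNReal.ofReal_le_ofReal
          rw [div_le_div_iff₀ (by positivity) hj0]
          linarith
  have h1 : ENNReal.ofReal (momentSeq μ 0 (2 * j) ^ p) ≤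
      ENNReal.ofReal (K * momentSeq μ 0 (3 * j) ^ p) := by
    calc ENNReal.ofReal (momentSeq μ 0 (2 * j) ^ p)
        = ENNReal.ofReal (momentSeq μ 0 (2 * j)) ^ p :=
          (ENNReal.ofReal_rpow_of_nonneg hL2.le hp0.le).symm
      _ ≤ ENNReal.ofReal (5 * j) ^ p * (ENNReal.ofReal (24 * C / j * momentSeq μ 0 (3 * j) ^ p) *
          ENNReal.ofReal (2 / j) ^ (p - 1)) := by
          rw [ofReal_momentSeq_zero hμ, ENNReal.mul_rpow_of_nonneg _ _ hp0.le]
          gcongr ?_ ^ p * ?_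
          · apply ENNReal.ofReal_le_ofReal
            push_cast
            linarith
          · exact hH.trans (mul_le_mul' hY (ENNReal.rpow_le_rpow hZ (by linarith)))
      _ = _ := by
          rw [ENNReal.ofReal_rpow_of_nonneg (by positivity) hp0.le,
            ENNReal.ofReal_rpow_of_nonneg (by positivity) (by linarith),
            ← ENNReal.ofReal_mul (by positivity), ← ENNReal.ofReal_mul (by positivity)]
          congr 1
          have hjp := Real.rpow_pos_of_pos hj0 p
          rw [Real.mul_rpow (by norm_num) hj0.le, Real.div_rpow (by norm_num) hj0.le,
            Real.rpow_sub_one hj0.ne', hK]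
          field_simp
  rw [ENNReal.ofReal_le_ofReal_iff (by positivity)] at h1
  have h8 := Real.rpow_le_rpow (by positivity) h1 (show 0 ≤ 1 / p by positivity)
  rwa [Real.mul_rpow hK0.le (by positivity), ← Real.rpow_mul hL2.le, ← Real.rpow_mul hL3.le,
    mul_one_div_cancel hp0.ne', Real.rpow_one, Real.rpow_one] at h8

/-- Split at s = 1 - t: below it the extra power s^{2d} is at most (1 - t)^{2d}, above it
s^{2(m+d)+1} ≤ 1. -/
theorem momentSeq_zero_le_add {μ : ℝ → ℝ} (hμ : IsRadialWeight μ) (m d : ℕ) {t : ℝ}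
    (ht1 : t ≤ 1) :
    momentSeq μ 0 (m + d) ≤ (1 - t) ^ (2 * d) * momentSeq μ 0 m + tailFun μ t := by
  have hi1 := integrableOn_continuous_mul hμ.integrableOn
    (g := fun s => s ^ (2 * m + 1) * (1 - s ^ 2) ^ 0) (by fun_prop)
  have hi2 : IntegrableOn ((Ico (1 - t) 1).indicator μ) (Ico 0 1) :=
    Integrable.indicator hμ.integrableOn measurableSet_Ico
  have e : tailFun μ t ≥ ∫ s in Ico (0 : ℝ) 1, (Ico (1 - t) 1).indicator μ s := by
    rw [setIntegral_indicator measurableSet_Ico, tailFun_eq μ ht1,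
      inter_eq_right.2 (Ico_subset_Ico_left (by linarith)), tail]
  refine le_trans ?_ (add_le_add_right e _)
  rw [momentSeq, momentSeq, ← integral_const_mul, ← integral_add (hi1.const_mul _) hi2]
  refine setIntegral_mono_on (integrableOn_continuous_mul hμ.integrableOn (by fun_prop))
    ((hi1.const_mul _).add hi2) measurableSet_Ico fun s hs => ?_
  have hμs := hμ.nonneg s hs
  have hs0 := hs.1
  have e2 : s ^ (2 * (m + d) + 1) = s ^ (2 * d) * s ^ (2 * m + 1) := by ring
  simp only [pow_zero, mul_one, e2]
  rcases le_total (1 - t) s with h | h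
  · rw [indicator_of_mem (show s ∈ Ico (1 - t) 1 from ⟨h, hs.2⟩)]
    have h1 : s ^ (2 * d) * s ^ (2 * m + 1) ≤ 1 :=
      mul_le_one₀ (pow_le_one₀ hs0 hs.2.le) (by positivity) (pow_le_one₀ hs0 hs.2.le)
    have h2 : 0 ≤ (1 - t) ^ (2 * d) * (s ^ (2 * m + 1) * μ s) := by
      have : 0 ≤ 1 - t := by linarith
      positivity
    nlinarith
  · have h3 : 0 ≤ (Ico (1 - t) 1).indicator μ s := by
      by_cases hmem : s ∈ Ico (1 - t) 1
      · rw [indicator_of_mem hmem]; exact hμs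
      · rw [indicator_of_notMem hmem]
    have h4 : s ^ (2 * d) ≤ (1 - t) ^ (2 * d) := pow_le_pow_left₀ hs0 h _
    calc s ^ (2 * d) * s ^ (2 * m + 1) * μ s ≤ (1 - t) ^ (2 * d) * s ^ (2 * m + 1) * μ s := by gcongr
      _ ≤ _ := by rw [mul_assoc]; linarith

/-- The factor D^i grows at most like a fixed power of 2^i, which loses to the exponential of 2^i/5.
-/
theorem exists_pow_mul_exp_le (D : ℝ) :
    ∃ i : ℕ, D ^ i * Real.exp (-((2 ^ i - 1) / 5)) ≤ 1 / 2 := by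
  obtain ⟨m, hm⟩ := pow_unbounded_of_one_lt |D| one_lt_two
  have h1 := (Real.tendsto_pow_mul_exp_neg_atTop_nhds_zero m).comp
    ((tendsto_pow_atTop_atTop_of_one_lt (one_lt_two (α := ℝ))).atTop_div_const
      (show (0 : ℝ) < 5 by norm_num))
  have h2 := h1.eventually_lt_const (show (0 : ℝ) < 1 / (2 * 5 ^ m * Real.exp (1 / 5)) by positivity)
  obtain ⟨i, hi⟩ := h2.exists
  refine ⟨i, ?_⟩
  simp only [Function.comp_apply] at hi
  rw [lt_div_iff₀ (by positivity)] at hi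
  have e1 : Real.exp (-((2 ^ i - 1) / 5)) = Real.exp (-(2 ^ i / 5)) * Real.exp (1 / 5) := by
    rw [← Real.exp_add]; congr 1; ring
  have e2 : ((2 : ℝ) ^ i / 5) ^ m * 5 ^ m = (2 ^ m) ^ i := by
    rw [← mul_pow, div_mul_cancel₀ _ (by norm_num), ← pow_mul, ← pow_mul, mul_comm]
  have e3 : D ^ i ≤ (2 ^ m) ^ i := by
    calc D ^ i ≤ |D ^ i| := le_abs_self _
      _ = |D| ^ i := abs_pow _ _
      _ ≤ _ := by gcongr
  rw [e1]
  calc D ^ i * (Real.exp (-(2 ^ i / 5)) * Real.exp (1 / 5))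
      ≤ (2 ^ m) ^ i * (Real.exp (-(2 ^ i / 5)) * Real.exp (1 / 5)) := by gcongr
    _ ≤ 1 / 2 := by rw [← e2]; linarith

/-- After i doublings of the index the moment has lost at most D^i, whereas the part of the mass
away from the boundary has shrunk by exp(-(2^i - 1)/5). For suitable i that part is absorbed on the
left, so the mass within 1/(40j) of the boundary dominates the moment, which in turn dominates the
tail at 1/(10j). -/
theorem doubling_of_momentSeq {μ : ℝ → ℝ} (hμ : IsRadialWeight μ) {D : ℝ} (hD : 0 < D) {j₀ : ℕ}
    (h : ∀ j : ℕ, j₀ ≤ j → momentSeq μ 0 (4 * j) ≤ D * momentSeq μ 0 (8 * j)) :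
    ∃ C, 0 < C ∧ ∀ t, 0 < t → t ≤ 1 → tailFun μ t ≤ C * tailFun μ (t / 2) := by
  obtain ⟨i, hi⟩ := exists_pow_mul_exp_le D
  have hit : ∀ (l j : ℕ), j₀ ≤ j → momentSeq μ 0 (4 * j) ≤ D ^ l * momentSeq μ 0 (4 * (2 ^ l * j)) := by
    intro l j hj
    induction l with
    | zero => simp
    | succ l ih =>
      have h1 := h (2 ^ l * j) (hj.trans (Nat.le_mul_of_pos_left j (by positivity)))
      calc _ ≤ D ^ l * momentSeq μ 0 (4 * (2 ^ l * j)) := ih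
        _ ≤ D ^ l * (D * momentSeq μ 0 (8 * (2 ^ l * j))) := by gcongr
        _ = _ := by
          rw [pow_succ D, mul_assoc, show 4 * (2 ^ (l + 1) * j) = 8 * (2 ^ l * j) by ring]
  have hmain : ∀ j : ℕ, 1 ≤ j → j₀ ≤ j →
      tailFun μ (1 / (10 * (j : ℝ))) ≤ 8 * D ^ i * tailFun μ (1 / (40 * (j : ℝ))) := by
    intro j hj1 hj
    have hj0 : (1 : ℝ) ≤ j := by exact_mod_cast hj1
    have hlow := le_momentSeq_zero hμ (4 * j)
    have hmono : tailFun μ (1 / (10 * (j : ℝ))) ≤ tailFun μ (1 / (2 * (((4 * j : ℕ) : ℝ) + 1))) := by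
      refine hμ.monotone (one_div_le_one_div_of_le (by positivity) ?_)
      push_cast
      linarith
    have ht1 : 1 / (40 * (j : ℝ)) ≤ 1 := by rw [div_le_one (by positivity)]; linarith
    have h1 := momentSeq_zero_le_add hμ (4 * j) (4 * (2 ^ i - 1) * j) ht1
    have hnat : 4 * j + 4 * (2 ^ i - 1) * j = 4 * (2 ^ i * j) := by
      obtain ⟨x, hx⟩ := Nat.exists_eq_add_of_le' (Nat.one_le_two_pow (n := i))
      rw [hx, Nat.add_sub_cancel]
      ring
    rw [hnat] at h1
    have hexp : (1 - 1 / (40 * (j : ℝ))) ^ (2 * (4 * (2 ^ i - 1) * j)) ≤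
        Real.exp (-((2 ^ i - 1) / 5)) := by
      calc _ ≤ Real.exp (-(1 / (40 * (j : ℝ)))) ^ (2 * (4 * (2 ^ i - 1) * j)) := by
            refine pow_le_pow_left₀ (by linarith) ?_ _
            linarith [Real.add_one_le_exp (-(1 / (40 * (j : ℝ))))]
        _ = _ := by
            rw [← Real.exp_nat_mul]
            congr 1
            push_cast [Nat.one_le_two_pow]
            field_simp
            ring
    have hLj := momentSeq_zero_pos hμ (4 * j)
    have h2 : momentSeq μ 0 (4 * j) ≤ 1 / 2 * momentSeq μ 0 (4 * j) +
        D ^ i * tailFun μ (1 / (40 * (j : ℝ))) := by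
      calc _ ≤ D ^ i * momentSeq μ 0 (4 * (2 ^ i * j)) := hit i j hj
        _ ≤ D ^ i * (Real.exp (-((2 ^ i - 1) / 5)) * momentSeq μ 0 (4 * j) +
            tailFun μ (1 / (40 * (j : ℝ)))) := by
            gcongr
            refine h1.trans ?_
            gcongr
        _ = (D ^ i * Real.exp (-((2 ^ i - 1) / 5))) * momentSeq μ 0 (4 * j) +
            D ^ i * tailFun μ (1 / (40 * (j : ℝ))) := by ring
        _ ≤ _ := by gcongr
    linarith
  set n₁ := j₀ + 1 with hn₁
  set t₀ := 1 / (10 * (n₁ : ℝ)) with ht₀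
  have hn1 : (1 : ℝ) ≤ n₁ := by exact_mod_cast Nat.le_add_left 1 j₀
  have ht₀0 : 0 < t₀ := by positivity
  have hH := hμ.tailFun_pos (half_pos ht₀0)
  refine ⟨max (8 * D ^ i) (tailFun μ 1 / tailFun μ (t₀ / 2)), lt_max_of_lt_left (by positivity),
    fun t ht ht1 => ?_⟩
  have hHt := hμ.tailFun_pos (half_pos ht)
  rcases le_total t t₀ with htt | htt
  · rw [ht₀, le_div_iff₀ (by positivity)] at htt
    -- This choice gives t ≤ 1/(10j) and, because j ≥ 1, also 1/(40j) ≤ t/2.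
    set j := ⌊1 / (10 * t)⌋₊ with hj
    have hj1 : (j : ℝ) * (10 * t) ≤ 1 := by
      rw [← le_div_iff₀ (by positivity)]
      exact Nat.floor_le (by positivity)
    have hj2 : 1 < ((j : ℝ) + 1) * (10 * t) := by
      rw [← div_lt_iff₀ (by positivity)]
      exact Nat.lt_floor_add_one _
    have hj3 : n₁ ≤ j := by
      refine Nat.le_floor ?_
      rw [le_div_iff₀ (by positivity)]
      linarith
    have hj4 : (1 : ℝ) ≤ j := hn1.trans (by exact_mod_cast hj3)
    calc tailFun μ t ≤ tailFun μ (1 / (10 * (j : ℝ))) := by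
          refine hμ.monotone ?_
          rw [le_div_iff₀ (by positivity)]
          linarith
      _ ≤ 8 * D ^ i * tailFun μ (1 / (40 * (j : ℝ))) := hmain j (by omega) (by omega)
      _ ≤ 8 * D ^ i * tailFun μ (t / 2) := by
          gcongr
          refine hμ.monotone ?_
          rw [div_le_iff₀ (by positivity)]
          nlinarith
      _ ≤ _ := by gcongr; exact le_max_left _ _
  · calc tailFun μ t ≤ tailFun μ 1 := hμ.monotone ht1
      _ = tailFun μ 1 / tailFun μ (t₀ / 2) * tailFun μ (t₀ / 2) := by field_simp
      _ ≤ _ := by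
        have := (hμ.tailFun_pos one_pos).le
        gcongr
        · exact le_max_right _ _
        · exact hμ.monotone (by linarith)

theorem doubling_of_fracBesovLeBesov {μ : ℝ → ℝ} (hμ : IsRadialWeight μ) {p : ℝ} (hp : 1 ≤ p)
    (h : FracBesovLeBesov p μ) :
    ∃ C, 0 < C ∧ ∀ t, 0 < t → t ≤ 1 → tailFun μ t ≤ C * tailFun μ (t / 2) := by
  obtain ⟨C, hC, n₀, hB⟩ := lintegral_rpow_mul_powWeight_le hμ (by linarith) h
  obtain ⟨D, hD, hDj⟩ := momentSeq_two_mul_le hμ hp hC hB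
  refine doubling_of_momentSeq hμ (D := D * D) (by positivity) (j₀ := n₀ + 2) fun j hj => ?_
  -- The ratio 3/2 is applied twice, taking the index 4j to 6j and then to 9j, which passes 8j.
  have h1 := hDj (2 * j) (by omega) (by omega)
  have h2 := hDj (3 * j) (by omega) (by omega)
  calc momentSeq μ 0 (4 * j) = momentSeq μ 0 (2 * (2 * j)) := by ring_nf
    _ ≤ D * momentSeq μ 0 (3 * (2 * j)) := h1
    _ = D * momentSeq μ 0 (2 * (3 * j)) := by ring_nf
    _ ≤ D * (D * momentSeq μ 0 (3 * (3 * j))) := by gcongr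
    _ ≤ D * (D * momentSeq μ 0 (8 * j)) := by
        gcongr
        exact momentSeq_zero_antitone hμ (by omega)
    _ = _ := by ring

theorem memD_of_fracBesovLeBesov {μ : ℝ → ℝ} (hμ : IsRadialWeight μ) {p : ℝ} (hp : 0 < p)
    (hor : 1 ≤ p ∨ MemDHat μ) (h : FracBesovLeBesov p μ) : MemD (powWeight p μ) :=
  memD_of_fracBesovLeBesov_of_doubling hμ hp (hor.elim
    (fun hp1 => doubling_of_fracBesovLeBesov hμ hp1 h) fun hd => (memDHat_iff.1 hd).2) h

end FracBesov

theorem mainTheorem7 (μ : ℝ → ℝ) (hμ : FracBesov.IsRadialWeight μ) :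
    (∀ p : ℝ, 1 ≤ p →
      List.TFAE [
        FracBesov.MemD (fun r : ℝ => FracBesov.tail μ r ^ p / (1 - r) ^ 2),
        FracBesov.FracBesovLeBesov p μ ∧ FracBesov.BesovLeFracBesov p μ,
        FracBesov.FracBesovLeBesov p μ]) ∧
    (∀ p : ℝ, 0 < p → p ≤ 1 → FracBesov.MemDHat μ →
      List.TFAE [
        FracBesov.MemD (fun r : ℝ => FracBesov.tail μ r ^ p / (1 - r) ^ 2),
        FracBesov.FracBesovLeBesov p μ ∧ FracBesov.BesovLeFracBesov p μ,
        FracBesov.FracBesovLeBesov p μ]) := by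
  have key : ∀ p : ℝ, 0 < p → (1 ≤ p ∨ FracBesov.MemDHat μ) →
      List.TFAE [
        FracBesov.MemD (fun r : ℝ => FracBesov.tail μ r ^ p / (1 - r) ^ 2),
        FracBesov.FracBesovLeBesov p μ ∧ FracBesov.BesovLeFracBesov p μ,
        FracBesov.FracBesovLeBesov p μ] := by
    intro p hp hor
    tfae_have 1 → 2 := fun h =>
      ⟨FracBesov.fracBesovLeBesov_of_memD hμ hp h, FracBesov.besovLeFracBesov_of_memD hμ hp h⟩
    tfae_have 2 → 3 := fun h => h.1
    tfae_have 3 → 1 := fun h =>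
      FracBesov.memD_of_fracBesovLeBesov hμ hp hor h
    tfae_finish
  exact ⟨fun p hp => key p (by linarith) (Or.inl hp), fun p hp _ hD => key p hp (Or.inr hD)⟩
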